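/- **Setting.** Let $x_{t+1}=A_*x_t+B_*u_t+\omega_{t+1}$ ($t\ge1$, $x_t\in\mathbb R^n$, $n\ge 1$, $u_t\in\mathbb R^m$), $(A_*,B_*)$ controllable, $\Theta_*=(A_*,B_*)^\top$, $z_t=(x_t^\top,u_t^\top)^\top$. With respect to a filtration $(\mathcal F_t)$, to which $x_t,u_t,\omega_t,\eta_t$ are adapted, $\omega_{t+1}$ is a martingale difference with conditional covariance $W=\bar\sigma^2I$ and with conditionally $\sigma$-sub-Gaussian components. The costs satisfy $\alpha_0I\preceq Q,R\preceq\alpha_1I$, $\alpha_0>0$; $\|\Theta_*\|\le\vartheta$; $P_*$ is the positive semidefinite solution of the discrete algebraic Riccati equation, and $J_*=\operatorname{tr}(P_*W)\le\nu$. Put $\kappa=\sqrt{2\nu/(\alpha_0\bar\sigma^2)}$, $\gamma=1/(2\kappa^2)$ and, for some $\alpha\ge\kappa$, $\bar\alpha=\frac{40(1+\kappa^2)}{\gamma^2}\alpha^2\sigma^2(n+m\kappa^2\vartheta^2)+20\sigma^2\kappa^2m$. Let $\delta\in(0,1)$, $\mathcal G>0$, $\lambda_t=\mathcal G\log\frac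 t\delta$, $\bar p_t=\big(\log\frac t\delta/\log\frac1\delta\big)^\phi$ with $\bar p_t\le\sqrt t$ for all $t\ge1$, and let $\Theta_0$ satisfy $\operatorname{tr}((\Theta_*-\Theta_0)^\top(\Theta_*-\Theta_0))\le\epsilon^2$. Put $$V_t=\lambda_tI+\sum_{s=1}^{t-1}z_sz_s^\top,\qquad \hat\Theta_t=V_t^{-1}\Big(\sum_{s=1}^{t-1}z_sx_{s+1}^\top+\lambda_t\Theta_0\Big),$$ $$r_t=\Big(\sigma\sqrt{2n\log\tfrac{n\det V_t}{\delta\det(\lambda_tI)}}+\sqrt{\lambda_t}\,\epsilon\Big)^2,\qquad \mu_t=r_t+2\vartheta\sqrt{r_t}\,\|V_t\|^{1/2}.$$ **Algorithm.** The policy is computed at time $1$ and again at every time $t$ with $\det V_t>(1+\beta_{\tau})\det V_\tau$, $\tau$ being the time of the previous update; $\tau(t)\le t$ denotes the last update time. At an update time $t$ one takes an optimal $\Sigma$ of the relaxed primal program: minimize $\operatorname{tr}(\operatorname{diag}(Q,R)\Sigma)$ subject to $\Sigma\succeq0$, $\Sigma_{xx}\succeq\hat\Theta_t^\top\Sigma\hat\Theta_t+W-\mu_t\operatorname{tr}(\Sigma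 V_t^{-1})I$, puts $K=\Sigma_{ux}\Sigma_{xx}^{-1}$, and lets $P$ be an optimal solution of the dual program: maximize $\operatorname{tr}(PW)$ subject to $P\succeq0$, $\operatorname{diag}(Q-P,R)+\hat\Theta_tP\hat\Theta_t^\top\succeq\mu_t\operatorname{tr}(P)V_t^{-1}$ (if a program has no optimal solution, the choice is arbitrary, with $K=0$ if $\Sigma_{xx}$ is singular). Between updates $K$ and $P$ are kept; $K_t,P_t$ are those in force at time $t$. The input is $u_t=K_tx_t+\eta_t$ with $\eta_t\sim\mathcal N(0,\frac{2\sigma^2\kappa^2\bar p_t}{\sqrt t}I)$ independent of $x_1$ (if $t=1$), and of $\mathcal F_{t-1}$ and $\omega_t$ jointly (if $t\ge2$). **Good events and regret terms.** $\mathcal E_t$ is the event that for all $1\le s\le t$: $\operatorname{tr}((\Theta_*-\hat\Theta_s)^\top V_s(\Theta_*-\hat\Theta_s))\le r_s$, $\|B_*\eta_s+\omega_{s+1}\|^2\le10\sigma^2(n+m\kappa^2\vartheta^2)\log\frac s\delta$ and $\|\eta_s\|^2\le10\kappa^2\sigma^2m\log\frac s\delta$. Let $R(T)=\sum_{t=1}^T(x_t^\top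 Qx_t+u_t^\top Ru_t-J_*)$ and $$R_1=\sum_{t=1}^T\big(x_t^\top P_tx_t-x_{t+1}^\top P_tx_{t+1}\big)1_{\mathcal E_t},\qquad R_4=\frac{2\nu}{\bar\sigma^2}\sum_{t=1}^T(1+\beta_{\tau(t)})\mu_{\tau(t)}\,z_t^\top V_t^{-1}z_t\,1_{\mathcal E_t},$$ let $R_4^{0}$ be $R_4$ with the factor $1+\beta_{\tau(t)}$ replaced by $1$, and let $$R_2=\sum_{t=1}^T2\,\omega_{t+1}^\top P_t(A_*x_t+B_*u_t)1_{\mathcal E_t},\quad R_3=\sum_{t=1}^T\big(\omega_{t+1}^\top P_t\omega_{t+1}-\bar\sigma^2\operatorname{tr}P_t\big)1_{\mathcal E_t},\quad R_5=\sum_{t=1}^T\eta_t^\top(R+B_*^\top P_tB_*)\eta_t1_{\mathcal E_t}.$$ **Theorem.** Let $t_0\ge1$ and $D,\Xi\in\mathbb R$. There are $C>0$ and $k\in\mathbb N$, depending only on the constants and matrices above and on $t_0,D,\Xi$, such that the following holds. (0) Let $$\beta_{\tau}=\sqrt{\frac{2\ln\big(-(1+\frac{\bar\alpha}{\mathcal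 G}\tau)\log\delta\,\log\frac{\tau}\delta\big)}{4\nu(n+m)(1+\frac{\bar\alpha}{\mathcal G})\Big(r_{\tau}+2\vartheta\sqrt{\mathcal G+\bar\alpha\tau}\,\sqrt{r_{\tau}\log\frac{\tau}\delta}\Big)}}\qquad(*)$$ (the square root of a negative number, possible for finitely many $\tau$ only, being read as $0$). Then $\beta_\tau\le C\tau^{-1/4}(\log\frac\tau\delta)^k$ for all $\tau\ge1$. (1) Let the algorithm use the rule $(*)$. For every $T\ge1$, $\mathcal E_T$ has probability at least $1-\big(20+\log_2\frac{\log(T/\delta)}{\log(1/\delta)}\big)\delta$. Almost surely, if $$\mu_t\|V_t^{-1}\|\le\frac1{16\kappa^{10}}\quad\text{for all }t\ge t_0,\qquad(**)$$ and if $\|x_t\|\le |D|$ for $t\le t_0$ and $\|K_t\|\le D$ for $t<t_0$, then for all $T\ge1$ $$R_1+R_4\le R_4^0+C\,T^{1/4}\big(\log\tfrac T\delta\big)^k,$$ and on $\mathcal E_T$ moreover $R(T)\le R_2+R_3+R_4^0+R_5+C\,T^{1/4}(\log\frac T\delta)^k$. (2) For every $\xi\in(0,\Xi]$, if the algorithm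 uses the constant $\beta=\xi$ instead, (1) holds with $C\,T^{1/4}(\log\frac T\delta)^k$ replaced by $C\big(\xi\sqrt T(\log\frac T\delta)^k+\log\frac T\delta\,\log_{1+\xi}\frac T\delta\big)$, with the same $C$ and $k$. (3) For every $\xi>0$ the bound in (1) is of smaller order than the one in (2): $C\,T^{1/4}(\log\frac T\delta)^k=o\big(C(\xi\sqrt T(\log\frac T\delta)^k+\log\frac T\delta\log_{1+\xi}\frac T\delta)\big)$ as $T\to\infty$. -/

import Mathlib

open scoped Matrix Matrix.Norms.L2Operator
open MeasureTheory ProbabilityTheory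

universe u

namespace ASLO

noncomputable section

/-- Squared Euclidean norm of a vector. -/
def sqNorm {ι : Type*} [Fintype ι] (v : ι → ℝ) : ℝ := v ⬝ᵥ v

/-- The quadratic form `vᵀ M v`. -/
def quad {ι : Type*} [Fintype ι] (M : Matrix ι ι ℝ) (v : ι → ℝ) : ℝ := v ⬝ᵥ (M *ᵥ v)

/-- Data of the problem: the plant `x⁺ = A x + B u + w`, the cost matrices, the solution `Pstar`
of the Riccati equation of the plant, the initial estimate `Theta0` and the scalar constants.
`σ` is the sub-Gaussian parameter of the noise and `σw ^ 2` is its variance, `G` is the factor in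
the regularization `λ_t = G log (t/δ)`, `α` parametrizes the size of the initial state, `φ` is the
power of the logarithm in the input perturbation and `ε` is the accuracy of `Theta0`. -/
structure Setup (n m : ℕ) where
  A : Matrix (Fin n) (Fin n) ℝ
  B : Matrix (Fin n) (Fin m) ℝ
  Q : Matrix (Fin n) (Fin n) ℝ
  R : Matrix (Fin m) (Fin m) ℝ
  Pstar : Matrix (Fin n) (Fin n) ℝ
  Theta0 : Matrix (Fin n ⊕ Fin m) (Fin n) ℝ
  α₀ : ℝ
  α₁ : ℝ
  ϑ : ℝ
  ν : ℝ
  σ : ℝ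
  σw : ℝ
  δ : ℝ
  G : ℝ
  α : ℝ
  φ : ℝ
  ε : ℝ

namespace Setup

variable {n m : ℕ} (S : Setup n m)

/-- `Θ_* = (A, B)ᵀ`. -/
def Theta : Matrix (Fin n ⊕ Fin m) (Fin n) ℝ := Matrix.fromRows S.Aᵀ S.Bᵀ

/-- The noise covariance `W = σw² I`. -/
def W : Matrix (Fin n) (Fin n) ℝ := (S.σw ^ 2) • (1 : Matrix (Fin n) (Fin n) ℝ)

/-- The optimal average expected cost `J_* = P_* • W`. -/
def Jstar : ℝ := (S.Pstarᵀ * S.W).trace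

def κ : ℝ := √(2 * S.ν / (S.α₀ * S.σw ^ 2))

def γ : ℝ := 1 / (2 * S.κ ^ 2)

/-- The constant `ᾱ`. -/
def αbar : ℝ :=
  40 * (1 + S.κ ^ 2) / S.γ ^ 2 * S.α ^ 2 * S.σ ^ 2 * (n + m * S.κ ^ 2 * S.ϑ ^ 2)
    + 20 * S.σ ^ 2 * S.κ ^ 2 * m

/-- The regularization parameter `λ_t`. -/
def lam (t : ℕ) : ℝ := S.G * Real.log (t / S.δ)

/-- `p̄_t = (log (t/δ) / log (1/δ)) ^ φ`. -/
def pbar (t : ℕ) : ℝ := (Real.log (t / S.δ) / Real.log (1 / S.δ)) ^ S.φ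

/-- Variance of each coordinate of the input perturbation `η_t`. -/
def etaVar (t : ℕ) : ℝ := 2 * S.σ ^ 2 * S.κ ^ 2 * S.pbar t / √t

/-- The block diagonal cost matrix `diag (Q, R)`. -/
def costMat : Matrix (Fin n ⊕ Fin m) (Fin n ⊕ Fin m) ℝ := Matrix.fromBlocks S.Q 0 0 S.R

/-- Controllability of `(A, B)`: the matrix `[B, A B, …, A ^ (n - 1) B]` has rank `n`. -/
def Controllable : Prop :=
  (Matrix.of fun (i : Fin n) (p : Fin n × Fin m) => (S.A ^ (p.1 : ℕ) * S.B) i p.2).rank = n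

/-- `Pstar` is the positive semidefinite solution of the discrete algebraic Riccati equation. -/
def Riccati : Prop :=
  S.Pstar.PosSemidef ∧
    S.Pstar = S.Q + S.Aᵀ * S.Pstar * S.A
      - S.Aᵀ * S.Pstar * S.B * (S.Bᵀ * S.Pstar * S.B + S.R)⁻¹ * S.Bᵀ * S.Pstar * S.A

/-- The standing assumptions on the plant, on the costs and on the constants. -/
structure Admissible : Prop where
  controllable : S.Controllable
  riccati : S.Riccati
  α₀_pos : 0 < S.α₀
  Q_lower : (S.Q - S.α₀ • (1 : Matrix (Fin n) (Fin n) ℝ)).PosSemidef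
  Q_upper : (S.α₁ • (1 : Matrix (Fin n) (Fin n) ℝ) - S.Q).PosSemidef
  R_lower : (S.R - S.α₀ • (1 : Matrix (Fin m) (Fin m) ℝ)).PosSemidef
  R_upper : (S.α₁ • (1 : Matrix (Fin m) (Fin m) ℝ) - S.R).PosSemidef
  ϑ_pos : 0 < S.ϑ
  Theta_le : ‖S.Theta‖ ≤ S.ϑ
  ν_pos : 0 < S.ν
  Jstar_le : S.Jstar ≤ S.ν
  σ_pos : 0 < S.σ
  σw_pos : 0 < S.σw
  δ_pos : 0 < S.δ
  δ_lt_one : S.δ < 1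
  G_pos : 0 < S.G
  κ_le_α : S.κ ≤ S.α
  φ_bound : ∀ t : ℕ, 1 ≤ t → S.pbar t ≤ √t
  ε_nonneg : 0 ≤ S.ε
  Theta0_close : ((S.Theta - S.Theta0)ᵀ * (S.Theta - S.Theta0)).trace ≤ S.ε ^ 2

/-! ### The relaxed semidefinite programs -/

/-- Feasibility for the relaxed primal program with estimate `Th`, covariance `V`, parameter `μ`:
`Σ ⪰ 0` and `Σ_xx ⪰ Thᵀ Σ Th + W - μ (Σ • V⁻¹) I`. -/
def PrimalFeasible (Th : Matrix (Fin n ⊕ Fin m) (Fin n) ℝ)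
    (V : Matrix (Fin n ⊕ Fin m) (Fin n ⊕ Fin m) ℝ) (μ : ℝ)
    (Sig : Matrix (Fin n ⊕ Fin m) (Fin n ⊕ Fin m) ℝ) : Prop :=
  Sig.PosSemidef ∧
    (Sig.toBlocks₁₁ - (Thᵀ * Sig * Th + S.W
      - (μ * (Sigᵀ * V⁻¹).trace) • (1 : Matrix (Fin n) (Fin n) ℝ))).PosSemidef

/-- Optimality for the relaxed primal program: `diag (Q, R) • Σ` is minimal. -/
def PrimalOptimal (Th : Matrix (Fin n ⊕ Fin m) (Fin n) ℝ)
    (V : Matrix (Fin n ⊕ Fin m) (Fin n ⊕ Fin m) ℝ) (μ : ℝ)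
    (Sig : Matrix (Fin n ⊕ Fin m) (Fin n ⊕ Fin m) ℝ) : Prop :=
  S.PrimalFeasible Th V μ Sig ∧
    ∀ Sig', S.PrimalFeasible Th V μ Sig' →
      (S.costMatᵀ * Sig).trace ≤ (S.costMatᵀ * Sig').trace

/-- Feasibility for the relaxed dual program: `P ⪰ 0` and
`diag (Q - P, R) + Th P Thᵀ ⪰ μ ‖P‖_* V⁻¹`, the trace norm of `P ⪰ 0` being its trace. -/
def DualFeasible (Th : Matrix (Fin n ⊕ Fin m) (Fin n) ℝ)
    (V : Matrix (Fin n ⊕ Fin m) (Fin n ⊕ Fin m) ℝ) (μ : ℝ)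
    (P : Matrix (Fin n) (Fin n) ℝ) : Prop :=
  P.PosSemidef ∧
    (Matrix.fromBlocks (S.Q - P) 0 0 S.R + Th * P * Thᵀ - (μ * P.trace) • V⁻¹).PosSemidef

/-- Optimality for the relaxed dual program: `P • W` is maximal. -/
def DualOptimal (Th : Matrix (Fin n ⊕ Fin m) (Fin n) ℝ)
    (V : Matrix (Fin n ⊕ Fin m) (Fin n ⊕ Fin m) ℝ) (μ : ℝ)
    (P : Matrix (Fin n) (Fin n) ℝ) : Prop :=
  S.DualFeasible Th V μ P ∧
    ∀ P', S.DualFeasible Th V μ P' → (P'ᵀ * S.W).trace ≤ (Pᵀ * S.W).trace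

end Setup

/-- A trajectory, indexed by time `t ≥ 1`: state `x`, input `u`, input perturbation `η`, noise `w`
(with `w (t + 1)` entering `x (t + 1)`), and the matrices `Sig t`, `P t` obtained from the relaxed
primal and dual programs if the policy is updated at time `t`. -/
structure Traj (n m : ℕ) where
  x : ℕ → Fin n → ℝ
  u : ℕ → Fin m → ℝ
  η : ℕ → Fin m → ℝ
  w : ℕ → Fin n → ℝ
  Sig : ℕ → Matrix (Fin n ⊕ Fin m) (Fin n ⊕ Fin m) ℝ
  P : ℕ → Matrix (Fin n) (Fin n) ℝ

section Algorithm

variable {n m : ℕ} (S : Setup n m) (X : Traj n m)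

/-- `z_t = (x_t, u_t)`. -/
def z (t : ℕ) : Fin n ⊕ Fin m → ℝ := Sum.elim (X.x t) (X.u t)

/-- `V_t = λ_t I + ∑_{1 ≤ s < t} z_s z_sᵀ`. -/
def V (t : ℕ) : Matrix (Fin n ⊕ Fin m) (Fin n ⊕ Fin m) ℝ :=
  S.lam t • (1 : Matrix (Fin n ⊕ Fin m) (Fin n ⊕ Fin m) ℝ)
    + ∑ s ∈ Finset.Ico 1 t, Matrix.vecMulVec (z X s) (z X s)

/-- The regularized least squares estimate. -/
def ThetaHat (t : ℕ) : Matrix (Fin n ⊕ Fin m) (Fin n) ℝ :=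
  (V S X t)⁻¹ *
    (∑ s ∈ Finset.Ico 1 t, Matrix.vecMulVec (z X s) (X.x (s + 1)) + S.lam t • S.Theta0)

/-- The squared radius of the confidence ellipsoid. -/
def r (t : ℕ) : ℝ :=
  (S.σ * √(2 * n * Real.log (n * (V S X t).det /
      (S.δ * (S.lam t • (1 : Matrix (Fin n ⊕ Fin m) (Fin n ⊕ Fin m) ℝ)).det)))
    + √(S.lam t) * S.ε) ^ 2

/-- `μ_t = r_t + 2 ϑ √r_t ‖V_t‖^{1/2}`, with the spectral norm. -/
def mu (t : ℕ) : ℝ := r S X t + 2 * S.ϑ * √(r S X t) * √‖V S X t‖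

/-- Last policy update time up to (and including) time `t`, when the update criterion is
`det V_t > (1 + b τ) det V_τ`; the first policy is computed at time `1`. -/
def tau (b : ℕ → ℝ) : ℕ → ℕ
  | 0 => 1
  | 1 => 1
  | t + 2 =>
    open Classical in
    if (V S X (t + 2)).det > (1 + b (tau b (t + 1))) * (V S X (tau b (t + 1))).det
    then t + 2 else tau b (t + 1)

/-- The gain in force at time `t`, `K = Σ_ux Σ_xx⁻¹` with `Σ` from the last update. -/
def K (b : ℕ → ℝ) (t : ℕ) : Matrix (Fin m) (Fin n) ℝ :=
  (X.Sig (tau S X b t)).toBlocks₂₁ * ((X.Sig (tau S X b t)).toBlocks₁₁)⁻¹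

/-- The dual solution belonging to the policy in force at time `t`. -/
def PP (b : ℕ → ℝ) (t : ℕ) : Matrix (Fin n) (Fin n) ℝ := X.P (tau S X b t)

/-- `X` is a trajectory of the plant controlled by the algorithm with update rule `b`. At every
update time optimal solutions of the two relaxed programs are computed, whenever they exist. -/
structure IsRun (b : ℕ → ℝ) : Prop where
  dyn : ∀ t, 1 ≤ t → X.x (t + 1) = S.A *ᵥ X.x t + S.B *ᵥ X.u t + X.w (t + 1)
  input : ∀ t, 1 ≤ t → X.u t = K S X b t *ᵥ X.x t + X.η t
  primal : ∀ t, 1 ≤ t → tau S X b t = t →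
    (∃ Sig, S.PrimalOptimal (ThetaHat S X t) (V S X t) (mu S X t) Sig) →
      S.PrimalOptimal (ThetaHat S X t) (V S X t) (mu S X t) (X.Sig t)
  dual : ∀ t, 1 ≤ t → tau S X b t = t →
    (∃ P, S.DualOptimal (ThetaHat S X t) (V S X t) (mu S X t) P) →
      S.DualOptimal (ThetaHat S X t) (V S X t) (mu S X t) (X.P t)

/-- The adaptive choice of `β_τ`. (The square root of a negative number is read as `0`; this can
concern finitely many small `τ` only.) -/
def betaAdaptive (τ : ℕ) : ℝ :=
  √((2 * Real.log (-((1 + S.αbar / S.G * τ) * Real.log S.δ * Real.log (τ / S.δ)))) /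
    (4 * S.ν * (n + m) * (1 + S.αbar / S.G) *
      (r S X τ + 2 * S.ϑ * √(S.G + S.αbar * τ) * √(r S X τ * Real.log (τ / S.δ)))))

/-- The condition `μ_t ‖V_t⁻¹‖ ≤ 1 / (16 κ¹⁰)` for all `t ≥ t₀`. -/
def Cond0 (t₀ : ℕ) : Prop :=
  ∀ t, t₀ ≤ t → mu S X t * ‖(V S X t)⁻¹‖ ≤ 1 / (16 * S.κ ^ 10)

/-- The data up to time `t₀` are bounded by `D`: the states up to time `t₀` and the gains in force
before time `t₀`. (For `t₀ = 1` this only bounds the initial state.) -/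
def InitBound (b : ℕ → ℝ) (t₀ : ℕ) (D : ℝ) : Prop :=
  (∀ t, 1 ≤ t → t ≤ t₀ → sqNorm (X.x t) ≤ D ^ 2) ∧
    ∀ t, 1 ≤ t → t < t₀ → ‖K S X b t‖ ≤ D

/-- The good event `𝓔_t`: up to time `t` the true parameter is in the confidence ellipsoids, and
the disturbances respect their sub-Gaussian envelopes. -/
def Good (t : ℕ) : Prop :=
  ∀ s, 1 ≤ s → s ≤ t →
    ((S.Theta - ThetaHat S X s)ᵀ * V S X s * (S.Theta - ThetaHat S X s)).trace ≤ r S X s ∧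
    sqNorm (S.B *ᵥ X.η s + X.w (s + 1)) ≤
      10 * S.σ ^ 2 * (n + m * S.κ ^ 2 * S.ϑ ^ 2) * Real.log (s / S.δ) ∧
    sqNorm (X.η s) ≤ 10 * S.κ ^ 2 * S.σ ^ 2 * m * Real.log (s / S.δ)

/-- `∑_{t=1}^T f t · 1_{𝓔_t}`. -/
def goodSum (T : ℕ) (f : ℕ → ℝ) : ℝ :=
  ∑ t ∈ Finset.Icc 1 T, Set.indicator {s | Good S X s} f t

/-- The regret after `T` steps. -/
def regret (T : ℕ) : ℝ :=
  ∑ t ∈ Finset.Icc 1 T, (quad S.Q (X.x t) + quad S.R (X.u t) - S.Jstar)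

/-- `R₁ = ∑ (x_tᵀ P_t x_t - x_{t+1}ᵀ P_t x_{t+1}) 1_{𝓔_t}`. -/
def R1 (b : ℕ → ℝ) (T : ℕ) : ℝ :=
  goodSum S X T fun t => quad (PP S X b t) (X.x t) - quad (PP S X b t) (X.x (t + 1))

/-- `R₂ = ∑ 2 w_{t+1}ᵀ P_t (A x_t + B u_t) 1_{𝓔_t}`. -/
def R2 (b : ℕ → ℝ) (T : ℕ) : ℝ :=
  goodSum S X T fun t =>
    2 * (X.w (t + 1) ⬝ᵥ (PP S X b t *ᵥ (S.A *ᵥ X.x t + S.B *ᵥ X.u t)))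

/-- `R₃ = ∑ (w_{t+1}ᵀ P_t w_{t+1} - σw² ‖P_t‖_*) 1_{𝓔_t}`. -/
def R3 (b : ℕ → ℝ) (T : ℕ) : ℝ :=
  goodSum S X T fun t =>
    quad (PP S X b t) (X.w (t + 1)) - S.σw ^ 2 * (PP S X b t).trace

/-- `R₄ = (2ν/σw²) ∑ (1 + β_{τ(t)}) μ_{τ(t)} z_tᵀ V_t⁻¹ z_t 1_{𝓔_t}`. -/
def R4 (b : ℕ → ℝ) (T : ℕ) : ℝ :=
  2 * S.ν / S.σw ^ 2 * goodSum S X T fun t =>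
    (1 + b (tau S X b t)) * mu S X (tau S X b t) * quad (V S X t)⁻¹ (z X t)

/-- The part of `R₄` in which `β` does not occur explicitly. -/
def R4free (b : ℕ → ℝ) (T : ℕ) : ℝ :=
  2 * S.ν / S.σw ^ 2 * goodSum S X T fun t =>
    mu S X (tau S X b t) * quad (V S X t)⁻¹ (z X t)

/-- Contribution of the input perturbation, `R₅ = ∑ η_tᵀ (R + Bᵀ P_t B) η_t 1_{𝓔_t}`. -/
def R5 (b : ℕ → ℝ) (T : ℕ) : ℝ :=
  goodSum S X T fun t => quad (S.R + S.Bᵀ * PP S X b t * S.B) (X.η t)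

end Algorithm

/-- The stochastic model: `w` is a conditionally sub-Gaussian martingale difference with
conditional covariance `σw² I`, and `η t` is Gaussian with covariance `etaVar t • I` and
independent of everything that precedes it. -/
def StochasticModel {n m : ℕ} (S : Setup n m) {Ω : Type u} [mΩ : MeasurableSpace Ω]
    (Pr : Measure Ω) (X : Ω → Traj n m) : Prop :=
  ∃ F : Filtration ℕ mΩ,
    (∀ t, 1 ≤ t → Measurable[F t] (fun ω => (X ω).x t)) ∧
    (∀ t, 1 ≤ t → Measurable[F t] (fun ω => (X ω).u t)) ∧
    (∀ t, 1 ≤ t → Measurable[F t] (fun ω => (X ω).η t)) ∧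
    (∀ t, 1 ≤ t → Measurable[F (t + 1)] (fun ω => (X ω).w (t + 1))) ∧
    (∀ t, 1 ≤ t → ∀ j, Integrable (fun ω => (X ω).w (t + 1) j) Pr ∧
      Pr[fun ω => (X ω).w (t + 1) j | F t] =ᵐ[Pr] 0) ∧
    (∀ t, 1 ≤ t → ∀ i j, Integrable (fun ω => (X ω).w (t + 1) i * (X ω).w (t + 1) j) Pr ∧
      Pr[fun ω => (X ω).w (t + 1) i * (X ω).w (t + 1) j | F t] =ᵐ[Pr] fun _ => S.W i j) ∧
    (∀ t, 1 ≤ t → ∀ (g : ℝ) j, Integrable (fun ω => Real.exp (g * (X ω).w (t + 1) j)) Pr ∧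
      Pr[fun ω => Real.exp (g * (X ω).w (t + 1) j) | F t]
        ≤ᵐ[Pr] fun _ => Real.exp (g ^ 2 * S.σ ^ 2 / 2)) ∧
    (∀ t, 1 ≤ t → Pr.map (fun ω => (X ω).η t) =
      Measure.pi fun _ : Fin m => gaussianReal 0 (S.etaVar t).toNNReal) ∧
    Indep (MeasurableSpace.comap (fun ω => (X ω).η 1) inferInstance)
      (MeasurableSpace.comap (fun ω => (X ω).x 1) inferInstance) Pr ∧
    (∀ t, 1 ≤ t → Indep (MeasurableSpace.comap (fun ω => (X ω).η (t + 1)) inferInstance)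
      (F t ⊔ MeasurableSpace.comap (fun ω => (X ω).w (t + 1)) inferInstance) Pr)

/-- Bound on the probability that `𝓔_T` fails: a multiple of `δ`, where the doubly logarithmic
term counts how often the regularization parameter doubles until time `T`. -/
def failProb (δ : ℝ) (T : ℕ) : ℝ :=
  (20 + Real.logb 2 (Real.log (T / δ) / Real.log (1 / δ))) * δ

/-- The order `T^{1/4}`, up to logarithmic factors. -/
def rateAdaptive (δ C : ℝ) (k T : ℕ) : ℝ :=
  C * (T : ℝ) ^ (1 / 4 : ℝ) * Real.log (T / δ) ^ k

/-- The order `ξ √T + log_{1+ξ} T`, up to logarithmic factors. -/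
def rateConst (δ C : ℝ) (k : ℕ) (ξ : ℝ) (T : ℕ) : ℝ :=
  C * (ξ * √T * Real.log (T / δ) ^ k + Real.log (T / δ) * Real.logb (1 + ξ) (T / δ))

end

end ASLO

/-! An update rule causes extra regret in two ways that pull against each other. Between updates
`P_t` is constant and `R₁` telescopes, so `R₁` costs one logarithm per update, and a determinant
threshold `1 + β` permits about `log det V_T / log (1 + β)` updates (`numUpdates_mul_le`,
`exists_R1_bound`). Conversely, a policy kept in force lags behind the data by a factor of at most
`1 + β` in `V⁻¹`. Since the sum of `z_tᵀ V_t⁻¹ z_t` is logarithmic (`exists_sum_quad_inv_bound`),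
this lag costs `max β_τ μ_τ` up to logarithms (`exists_R4_sub_R4free_bound`). As `μ_τ` is at most
`√τ` up to logarithms, a `β_τ` of order `τ^(-1/4)` brings both costs to `T^(1/4)`, whereas a
constant `ξ` leaves the bound `ξ √T`.

Everything rests on states of logarithmic size, however often the policy changes. On the good event
the estimate may replace the plant in any quadratic form at the price of the relaxation term
(`Consistent`). Hence a dual feasible `P` satisfies the dynamic programming inequality of the true
plant, and iteration along the optimal closed loop gives `P ⪯ P_*` (`quad_le_quad_Pstar`). Strong
duality, proved by separation of convex sets, and complementary slackness show that the dual slack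
annihilates `(x, K x)` (`policy_optimality`, `dualSlack_mulVec_gain`): along the computed gain the
inequality is an equality up to the relaxation. This gives the one-step regret inequality
(`cost_le_of_complementary`). Under `(**)` it also gives `P_* ⪯ P / (1 - θ)` with a small `θ`, so
that `P_*` is a Lyapunov function for every such gain (`gain_stable`). A Lyapunov function shared by
all policies makes switching harmless, and states, `log det V_t` and `r_t` are `O(log t)`. Policies
computed before `t₀` need not stabilize, but they are out of force after a time fixed in advance,
because `det V_t ≥ λ_t^(n+m)` tends to infinity.

The probability of the good event comes from a self-normalized martingale bound, that is, an
exponential supermartingale with Ville's inequality. It requires a fixed regularization and is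
therefore applied on a dyadic grid covering the values of `λ_t`. The envelopes of the disturbances
come from exponential moments of squares. Once the good event fails, the truncated sums stop
changing, so the bound for `R₁ + R₄` survives (`excess_le_of_good`). -/

set_option linter.unusedSectionVars false

namespace ASLO

/-! ### Quadratic forms -/

section LinearAlgebra

variable {ι ι' : Type*} [Fintype ι] [Fintype ι']

lemma sqNorm_nonneg (v : ι → ℝ) : 0 ≤ sqNorm v :=
  Finset.sum_nonneg fun i _ => mul_self_nonneg (v i)

lemma sqNorm_eq_sum (v : ι → ℝ) : sqNorm v = ∑ i, v i ^ 2 := by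
  simp [sqNorm, dotProduct, sq]

lemma sqNorm_eq_zero {v : ι → ℝ} (h : sqNorm v = 0) : v = 0 := by
  rwa [sqNorm, dotProduct_self_eq_zero] at h

lemma sqNorm_smul (c : ℝ) (v : ι → ℝ) : sqNorm (c • v) = c ^ 2 * sqNorm v := by
  simp [sqNorm]; ring

lemma dotProduct_sq_le (u v : ι → ℝ) : (u ⬝ᵥ v) ^ 2 ≤ sqNorm u * sqNorm v := by
  rw [sqNorm_eq_sum, sqNorm_eq_sum]
  exact Finset.sum_mul_sq_le_sq_mul_sq _ _ _

lemma sqNorm_add_le (u v : ι → ℝ) : sqNorm (u + v) ≤ 2 * sqNorm u + 2 * sqNorm v := by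
  simp only [sqNorm_eq_sum, Finset.mul_sum, ← Finset.sum_add_distrib]
  exact Finset.sum_le_sum fun i _ => by simp only [Pi.add_apply]; nlinarith [sq_nonneg (u i - v i)]

lemma quad_add (M N : Matrix ι ι ℝ) (v : ι → ℝ) : quad (M + N) v = quad M v + quad N v := by
  simp [quad, Matrix.add_mulVec]

lemma quad_sub (M N : Matrix ι ι ℝ) (v : ι → ℝ) : quad (M - N) v = quad M v - quad N v := by
  simp [quad, Matrix.sub_mulVec]

lemma quad_smul (c : ℝ) (M : Matrix ι ι ℝ) (v : ι → ℝ) : quad (c • M) v = c * quad M v := by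
  simp [quad, Matrix.smul_mulVec]

lemma quad_one [DecidableEq ι] (v : ι → ℝ) : quad (1 : Matrix ι ι ℝ) v = sqNorm v := by
  simp [quad, sqNorm]

lemma quad_sum {α : Type*} (s : Finset α) (M : α → Matrix ι ι ℝ) (v : ι → ℝ) :
    quad (∑ i ∈ s, M i) v = ∑ i ∈ s, quad (M i) v := by
  simp [quad, Matrix.sum_mulVec, dotProduct_sum]

lemma quad_conj (N : Matrix ι' ι ℝ) (M : Matrix ι' ι' ℝ) (v : ι → ℝ) :
    quad (Nᵀ * M * N) v = quad M (N *ᵥ v) := by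
  simp only [quad, ← Matrix.mulVec_mulVec]
  rw [Matrix.mulVec_transpose, dotProduct_comm, ← Matrix.dotProduct_mulVec, dotProduct_comm]

lemma quad_conj' (N : Matrix ι ι' ℝ) (M : Matrix ι' ι' ℝ) (v : ι → ℝ) :
    quad (N * M * Nᵀ) v = quad M (Nᵀ *ᵥ v) := by
  simpa using quad_conj Nᵀ M v

lemma quad_vecMulVec (a b v : ι → ℝ) : quad (Matrix.vecMulVec a b) v = (a ⬝ᵥ v) * (b ⬝ᵥ v) := by
  simp only [quad, Matrix.vecMulVec_mulVec, dotProduct_smul, MulOpposite.smul_eq_mul_unop,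
    MulOpposite.unop_op, dotProduct_comm v a]

lemma quad_smul_vec (c : ℝ) (M : Matrix ι ι ℝ) (v : ι → ℝ) : quad M (c • v) = c ^ 2 * quad M v := by
  simp only [quad, Matrix.mulVec_smul, smul_dotProduct, dotProduct_smul, smul_eq_mul]; ring

lemma transpose_eq_of_posSemidef {M : Matrix ι ι ℝ} (h : M.PosSemidef) : Mᵀ = M := by
  simpa [Matrix.IsHermitian] using h.1

lemma posSemidef_iff_quad {M : Matrix ι ι ℝ} :
    M.PosSemidef ↔ Mᵀ = M ∧ ∀ v, 0 ≤ quad M v := by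
  rw [Matrix.posSemidef_iff_dotProduct_mulVec]
  simp [Matrix.IsHermitian, quad]

lemma quad_nonneg {M : Matrix ι ι ℝ} (h : M.PosSemidef) (v : ι → ℝ) : 0 ≤ quad M v :=
  (posSemidef_iff_quad.1 h).2 v

lemma dot_mulVec_comm {M : Matrix ι ι ℝ} (h : Mᵀ = M) (u v : ι → ℝ) :
    u ⬝ᵥ (M *ᵥ v) = v ⬝ᵥ (M *ᵥ u) := by
  conv_lhs => rw [← h, Matrix.mulVec_transpose, dotProduct_comm, ← Matrix.dotProduct_mulVec]

lemma quad_add_vec {M : Matrix ι ι ℝ} (h : Mᵀ = M) (u v : ι → ℝ) :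
    quad M (u + v) = quad M u + 2 * (u ⬝ᵥ (M *ᵥ v)) + quad M v := by
  simp only [quad, Matrix.mulVec_add, add_dotProduct, dotProduct_add, dot_mulVec_comm h v u]; ring

/-- The polynomial `t ↦ quad M (u + t • v)` is nonnegative, so its discriminant is nonpositive. -/
lemma quad_cauchy {M : Matrix ι ι ℝ} (h : M.PosSemidef) (u v : ι → ℝ) :
    (u ⬝ᵥ (M *ᵥ v)) ^ 2 ≤ quad M u * quad M v := by
  have key : ∀ t : ℝ, 0 ≤ quad M v * (t * t) + (2 * (u ⬝ᵥ (M *ᵥ v))) * t + quad M u := by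
    intro t
    have := quad_nonneg h (u + t • v)
    rw [quad_add_vec (transpose_eq_of_posSemidef h), quad_smul_vec, Matrix.mulVec_smul,
      dotProduct_smul, smul_eq_mul] at this
    linarith
  have := discrim_le_zero key
  rw [discrim] at this
  linarith

/-- The triangle inequality for the seminorm of a positive semidefinite matrix. -/
lemma sqrt_quad_add_le {M : Matrix ι ι ℝ} (h : M.PosSemidef) (u v : ι → ℝ) :
    √(quad M (u + v)) ≤ √(quad M u) + √(quad M v) := by
  rw [Real.sqrt_le_left (by positivity), quad_add_vec (transpose_eq_of_posSemidef h), add_sq,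
    Real.sq_sqrt (quad_nonneg h u), Real.sq_sqrt (quad_nonneg h v), mul_assoc,
    ← Real.sqrt_mul (quad_nonneg h u)]
  have := Real.le_sqrt_of_sq_le (quad_cauchy h u v)
  linarith

lemma posSemidef_exists_sqrt [DecidableEq ι] {M : Matrix ι ι ℝ} (h : M.PosSemidef) :
    ∃ B : Matrix ι ι ℝ, M = Bᵀ * B := by
  open scoped MatrixOrder in
  obtain ⟨B, hB⟩ := CStarAlgebra.nonneg_iff_eq_star_mul_self.1 (Matrix.nonneg_iff_posSemidef.2 h)
  exact ⟨B, by simpa [Matrix.star_eq_conjTranspose] using hB⟩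

lemma posSemidef_conj {M : Matrix ι ι ℝ} (h : M.PosSemidef) (N : Matrix ι ι' ℝ) :
    (Nᵀ * M * N).PosSemidef := by
  simpa using h.conjTranspose_mul_mul_same N

lemma posSemidef_vecMulVec (v : ι → ℝ) : (Matrix.vecMulVec v v).PosSemidef := by
  refine posSemidef_iff_quad.2 ⟨by simp [Matrix.transpose_vecMulVec], fun u => ?_⟩
  rw [quad_vecMulVec]; exact mul_self_nonneg _

/-- Factoring a semidefinite matrix as `Bᵀ * B` reduces its trace pairings to quadratic forms at the
rows of `B`; the trace inequalities below all go through this. -/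
lemma trace_transpose_mul_self_mul (B : Matrix ι' ι ℝ) (N : Matrix ι ι ℝ) :
    (Bᵀ * B * N).trace = ∑ i, quad N (fun j => B i j) := by
  rw [Matrix.mul_assoc, Matrix.trace_mul_comm]
  simp only [Matrix.trace, Matrix.diag, Matrix.mul_apply, Matrix.transpose_apply, quad, dotProduct,
    Matrix.mulVec]
  refine Finset.sum_congr rfl fun i _ => ?_
  simp only [Finset.sum_mul, Finset.mul_sum]
  rw [Finset.sum_comm]
  simp [mul_assoc]

lemma trace_mul_nonneg [DecidableEq ι] {A N : Matrix ι ι ℝ} (hA : A.PosSemidef)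
    (hN : ∀ v, 0 ≤ quad N v) : 0 ≤ (A * N).trace := by
  obtain ⟨B, rfl⟩ := posSemidef_exists_sqrt hA
  rw [trace_transpose_mul_self_mul]
  exact Finset.sum_nonneg fun i _ => hN _

lemma trace_mul_mono [DecidableEq ι] {A M N : Matrix ι ι ℝ} (hA : A.PosSemidef)
    (h : ∀ v, quad M v ≤ quad N v) : (A * M).trace ≤ (A * N).trace := by
  have := trace_mul_nonneg (N := N - M) hA fun v => by rw [quad_sub]; linarith [h v]
  rw [Matrix.mul_sub, Matrix.trace_sub] at this
  linarith

lemma mulVec_eq_zero_of_quad_eq_zero {N : Matrix ι ι ℝ} (hN : N.PosSemidef) {v : ι → ℝ}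
    (h : quad N v = 0) : N *ᵥ v = 0 := by
  have := quad_cauchy hN (N *ᵥ v) v
  rw [h, mul_zero] at this
  exact sqNorm_eq_zero (pow_eq_zero_iff two_ne_zero |>.1 (le_antisymm this (sq_nonneg _)))

/-- Complementary slackness: the trace is a sum of nonnegative values of the form `N` at the rows of
a factor of `A`, and a zero of a semidefinite form lies in the kernel. -/
lemma mul_eq_zero_of_trace_mul_eq_zero [DecidableEq ι] {A N : Matrix ι ι ℝ} (hA : A.PosSemidef)
    (hN : N.PosSemidef) (h : (A * N).trace = 0) : N * A = 0 := by
  obtain ⟨B, rfl⟩ := posSemidef_exists_sqrt hA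
  rw [trace_transpose_mul_self_mul, Finset.sum_eq_zero_iff_of_nonneg
    (fun i _ => quad_nonneg hN _)] at h
  have : N * Bᵀ = 0 := by
    ext i j
    have := congrFun (mulVec_eq_zero_of_quad_eq_zero hN (h j (Finset.mem_univ _))) i
    simpa [Matrix.mulVec, dotProduct, Matrix.mul_apply] using this
  rw [← Matrix.mul_assoc, this, Matrix.zero_mul]

/-- Pair `P` with both sides of `v vᵀ ⪯ |v|² I`. -/
lemma quad_le_trace [DecidableEq ι] {P : Matrix ι ι ℝ} (hP : P.PosSemidef) (v : ι → ℝ) :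
    quad P v ≤ P.trace * sqNorm v := by
  have h := trace_mul_mono (M := Matrix.vecMulVec v v) (N := sqNorm v • 1) hP fun u => by
    rw [quad_vecMulVec, quad_smul, quad_one, ← sq]
    exact dotProduct_sq_le v u
  rw [Matrix.mul_smul, Matrix.mul_one, Matrix.trace_smul, smul_eq_mul, mul_comm (sqNorm v)] at h
  refine le_trans (le_of_eq ?_) h
  rw [Matrix.trace_mul_comm, Matrix.vecMulVec_mul, Matrix.trace_vecMulVec, quad,
    Matrix.dotProduct_mulVec, dotProduct_comm]

lemma trace_le_of_quad_le [DecidableEq ι] {M N : Matrix ι ι ℝ} (h : ∀ v, quad M v ≤ quad N v) :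
    M.trace ≤ N.trace := by
  simpa using trace_mul_mono Matrix.PosSemidef.one h

/-! ### The spectral norm -/

lemma sqNorm_eq_norm_sq (v : ι → ℝ) : sqNorm v = ‖(WithLp.toLp 2 v : EuclideanSpace ℝ ι)‖ ^ 2 := by
  rw [EuclideanSpace.norm_sq_eq, sqNorm_eq_sum]; simp

lemma sqNorm_mulVec_le [DecidableEq ι'] (M : Matrix ι ι' ℝ) (v : ι' → ℝ) :
    sqNorm (M *ᵥ v) ≤ ‖M‖ ^ 2 * sqNorm v := by
  rw [sqNorm_eq_norm_sq, sqNorm_eq_norm_sq, ← mul_pow]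
  exact pow_le_pow_left₀ (norm_nonneg _) (M.l2_opNorm_mulVec (WithLp.toLp 2 v)) 2

lemma quad_le_norm [DecidableEq ι] (M : Matrix ι ι ℝ) (v : ι → ℝ) :
    quad M v ≤ ‖M‖ * sqNorm v := by
  have h := (dotProduct_sq_le v (M *ᵥ v)).trans
    (mul_le_mul_of_nonneg_left (sqNorm_mulVec_le M v) (sqNorm_nonneg v))
  have h2 : (v ⬝ᵥ M *ᵥ v) ^ 2 ≤ (‖M‖ * sqNorm v) ^ 2 := h.trans (le_of_eq (by ring))
  exact (le_abs_self _).trans (abs_le_of_sq_le_sq h2 (mul_nonneg (norm_nonneg _) (sqNorm_nonneg v)))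

/-- Cauchy–Schwarz for the form `M` between `M v` and `v` gives `|M v|⁴ ≤ b |M v|² quad M v`; then
one factor is cancelled. -/
lemma sqNorm_mulVec_le_of_posSemidef {M : Matrix ι ι ℝ} (hM : M.PosSemidef) {b : ℝ}
    (h : ∀ v, quad M v ≤ b * sqNorm v) (hb : 0 ≤ b) (v : ι → ℝ) :
    sqNorm (M *ᵥ v) ≤ b * quad M v := by
  have h1 : (sqNorm (M *ᵥ v)) ^ 2 ≤ b * sqNorm (M *ᵥ v) * quad M v :=
    (quad_cauchy hM (M *ᵥ v) v).trans (mul_le_mul_of_nonneg_right (h _) (quad_nonneg hM v))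
  rcases (sqNorm_nonneg (M *ᵥ v)).eq_or_lt with h0 | h0
  · rw [← h0]; exact mul_nonneg hb (quad_nonneg hM v)
  · nlinarith

lemma norm_le_of_sqNorm_le [DecidableEq ι'] {M : Matrix ι ι' ℝ} {b : ℝ} (hb : 0 ≤ b)
    (h : ∀ v, sqNorm (M *ᵥ v) ≤ b ^ 2 * sqNorm v) : ‖M‖ ≤ b := by
  rw [Matrix.l2_opNorm_def]
  refine ContinuousLinearMap.opNorm_le_bound _ hb fun v => ?_
  have := h v.ofLp
  rw [sqNorm_eq_norm_sq, sqNorm_eq_norm_sq, ← mul_pow] at this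
  exact le_of_sq_le_sq this (by positivity)

lemma norm_le_of_quad_le [DecidableEq ι] {M : Matrix ι ι ℝ} (hM : M.PosSemidef) {b : ℝ}
    (h : ∀ v, quad M v ≤ b * sqNorm v) (hb : 0 ≤ b) : ‖M‖ ≤ b :=
  norm_le_of_sqNorm_le hb fun v => (sqNorm_mulVec_le_of_posSemidef hM h hb v).trans <| by
    rw [sq, mul_assoc]; exact mul_le_mul_of_nonneg_left (h v) hb

/-! ### Diagonalization, determinants and inverses -/

variable [DecidableEq ι]

lemma exists_diagonalization {M : Matrix ι ι ℝ} (h : Mᵀ = M) :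
    ∃ (U : Matrix ι ι ℝ) (d : ι → ℝ), Uᵀ * U = 1 ∧ U * Uᵀ = 1 ∧ M = U * Matrix.diagonal d * Uᵀ := by
  have hM : M.IsHermitian := by simpa [Matrix.IsHermitian] using h
  refine ⟨hM.eigenvectorUnitary, hM.eigenvalues, ?_, ?_, ?_⟩
  · have := Unitary.coe_star_mul_self hM.eigenvectorUnitary
    simpa [Matrix.star_eq_conjTranspose] using this
  · have := Unitary.coe_mul_star_self hM.eigenvectorUnitary
    simpa [Matrix.star_eq_conjTranspose] using this
  · have := hM.spectral_theorem
    rw [Unitary.conjStarAlgAut_apply] at this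
    simpa [Matrix.star_eq_conjTranspose, Function.comp_def] using this

lemma det_conj_orthogonal {U : Matrix ι ι ℝ} (hU : Uᵀ * U = 1) (N : Matrix ι ι ℝ) :
    (U * N * Uᵀ).det = N.det := by
  rw [Matrix.det_mul_right_comm, ← Matrix.det_mul_right_comm, Matrix.mul_assoc,
    Matrix.det_mul_comm, Matrix.mul_assoc, hU, Matrix.mul_one]

lemma quad_diagonal (d v : ι → ℝ) : quad (Matrix.diagonal d) v = ∑ i, d i * v i ^ 2 := by
  simp only [quad, dotProduct, Matrix.mulVec_diagonal]
  exact Finset.sum_congr rfl fun i _ => by ring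

lemma sqNorm_orthogonal {U : Matrix ι ι ℝ} (hU : Uᵀ * U = 1) (v : ι → ℝ) :
    sqNorm (U *ᵥ v) = sqNorm v := by
  have := quad_conj U 1 v
  rwa [Matrix.mul_one, hU, quad_one, quad_one, eq_comm] at this

lemma quad_diagonalization_col {U : Matrix ι ι ℝ} (hU : Uᵀ * U = 1) (d : ι → ℝ) (i : ι) :
    quad (U * Matrix.diagonal d * Uᵀ) (U *ᵥ Pi.single i 1) = d i ∧
      sqNorm (U *ᵥ Pi.single i (1 : ℝ)) = 1 := by
  rw [quad_conj', Matrix.mulVec_mulVec, hU, Matrix.one_mulVec, sqNorm_orthogonal hU]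
  simp [quad_diagonal, sqNorm, Pi.single_apply, ite_pow]

lemma quad_inv {V : Matrix ι ι ℝ} (hV : V.PosDef) (v : ι → ℝ) :
    quad V (V⁻¹ *ᵥ v) = quad V⁻¹ v := by
  have hu : IsUnit V.det := hV.det_pos.ne'.isUnit
  simp only [quad, Matrix.mulVec_mulVec, Matrix.mul_nonsing_inv _ hu, Matrix.one_mulVec]
  exact dotProduct_comm _ _

lemma dotProduct_sq_le_quad_inv {V : Matrix ι ι ℝ} (hV : V.PosDef) (u v : ι → ℝ) :
    (u ⬝ᵥ v) ^ 2 ≤ quad V u * quad V⁻¹ v := by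
  have hu : IsUnit V.det := hV.det_pos.ne'.isUnit
  have := quad_cauchy hV.posSemidef u (V⁻¹ *ᵥ v)
  rwa [quad_inv hV, Matrix.mulVec_mulVec, Matrix.mul_nonsing_inv _ hu, Matrix.one_mulVec] at this

/-- Inversion reverses the Loewner order: apply the dual Cauchy–Schwarz inequality at `u = V'⁻¹ v`
and cancel `quad V'⁻¹ v`. If that value vanishes then `v = 0`, which is treated apart since the sign
of `c` is not prescribed. -/
lemma quad_inv_le_of_le {V V' : Matrix ι ι ℝ} (hV : V.PosDef) (hV' : V'.PosDef) {c : ℝ}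
    (h : ∀ v, quad V v ≤ c * quad V' v) (v : ι → ℝ) : quad V'⁻¹ v ≤ c * quad V⁻¹ v := by
  have h0 : 0 ≤ quad V'⁻¹ v := quad_nonneg hV'.inv.posSemidef v
  have h0' : 0 ≤ quad V⁻¹ v := quad_nonneg hV.inv.posSemidef v
  have h1 := dotProduct_sq_le_quad_inv hV (V'⁻¹ *ᵥ v) v
  have h2 : (V'⁻¹ *ᵥ v) ⬝ᵥ v = quad V'⁻¹ v := dotProduct_comm _ _
  have h3 := h (V'⁻¹ *ᵥ v)
  rw [quad_inv hV'] at h3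
  rw [h2] at h1
  rcases h0.eq_or_lt with h4 | h4
  · rw [← h4] at h3 ⊢
    by_contra! hc
    have h5 := quad_nonneg hV.posSemidef (V⁻¹ *ᵥ v)
    have h6 : v = 0 := by
      have h7 := mulVec_eq_zero_of_quad_eq_zero hV'.inv.posSemidef h4.symm
      have h8 : V' *ᵥ (V'⁻¹ *ᵥ v) = 0 := by rw [h7, Matrix.mulVec_zero]
      rwa [Matrix.mulVec_mulVec, Matrix.mul_nonsing_inv _ hV'.det_pos.ne'.isUnit,
        Matrix.one_mulVec] at h8
    subst h6
    simp [quad] at hc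
  · have h5 : quad V'⁻¹ v * quad V'⁻¹ v ≤ quad V'⁻¹ v * (c * quad V⁻¹ v) := by nlinarith
    exact le_of_mul_le_mul_left h5 h4

lemma quad_inv_le_of_smul_le {V : Matrix ι ι ℝ} (hV : V.PosDef) {c : ℝ} (hc : 0 < c)
    (h : ∀ v, c * sqNorm v ≤ quad V v) (v : ι → ℝ) : quad V⁻¹ v ≤ sqNorm v / c := by
  have := quad_inv_le_of_le Matrix.PosDef.one hV (c := 1 / c) (fun v => by
    rw [quad_one, one_div, inv_mul_eq_div, le_div_iff₀ hc]; linarith [h v]) v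
  rw [inv_one, quad_one] at this
  rwa [div_eq_inv_mul, ← one_div c]

lemma det_le_pow_of_quad_le {V : Matrix ι ι ℝ} (hV : V.PosSemidef) {b : ℝ}
    (h : ∀ v, quad V v ≤ b * sqNorm v) : V.det ≤ b ^ Fintype.card ι := by
  obtain ⟨U, d, hU, hU', rfl⟩ := exists_diagonalization (transpose_eq_of_posSemidef hV)
  rw [det_conj_orthogonal hU, Matrix.det_diagonal, ← Finset.card_univ]
  have := quad_diagonalization_col hU d
  rw [← Finset.prod_const]
  refine Finset.prod_le_prod (fun i _ => ?_) fun i _ => ?_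
  · rw [← (this i).1]; exact quad_nonneg hV _
  · have h1 := h (U *ᵥ Pi.single i 1)
    rwa [(this i).1, (this i).2, mul_one] at h1

lemma one_le_prod_of_one_le (s : Finset ι) {d : ι → ℝ} (h : ∀ j, 1 ≤ d j) : 1 ≤ ∏ j ∈ s, d j := by
  rw [← Finset.prod_const_one (s := s)]
  exact Finset.prod_le_prod (fun _ _ => zero_le_one) fun j _ => h j

/-- When all eigenvalues are at least one, each of them is at most their product. -/
lemma quad_le_det_mul_of_sqNorm_le {M : Matrix ι ι ℝ} (hM : Mᵀ = M)
    (h : ∀ v, sqNorm v ≤ quad M v) : 1 ≤ M.det ∧ ∀ v, quad M v ≤ M.det * sqNorm v := by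
  obtain ⟨U, d, hU, hU', rfl⟩ := exists_diagonalization hM
  have hcol := quad_diagonalization_col hU d
  have hd : ∀ i, 1 ≤ d i := fun i => by
    have h1 := h (U *ᵥ Pi.single i 1)
    rwa [(hcol i).1, (hcol i).2] at h1
  have hd' : ∀ i, d i ≤ ∏ j, d j := fun i => by
    rw [← Finset.mul_prod_erase _ _ (Finset.mem_univ i)]
    refine le_mul_of_one_le_right (by linarith [hd i]) ?_
    exact one_le_prod_of_one_le _ hd
  rw [det_conj_orthogonal hU, Matrix.det_diagonal]
  refine ⟨one_le_prod_of_one_le _ hd, fun v => ?_⟩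
  have hU2 : Uᵀᵀ * Uᵀ = 1 := by rwa [Matrix.transpose_transpose]
  rw [quad_conj', quad_diagonal, ← sqNorm_orthogonal hU2 v, sqNorm_eq_sum, Finset.mul_sum]
  exact Finset.sum_le_sum fun i _ => mul_le_mul_of_nonneg_right (hd' i) (sq_nonneg _)

/-- The congruence by `B⁻¹`, where `V = Bᵀ * B`, turns `V` into the identity and reduces the claim
to `quad_le_det_mul_of_sqNorm_le`. This is what lets a rule phrased in determinants control `V_t`
relative to `V_τ` as quadratic forms. -/
lemma det_le_det_and_quad_le {V V' : Matrix ι ι ℝ} (hV : V.PosDef) (hV' : V'ᵀ = V')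
    (h : ∀ v, quad V v ≤ quad V' v) :
    V.det ≤ V'.det ∧ ∀ v, V.det * quad V' v ≤ V'.det * quad V v := by
  obtain ⟨B, hB⟩ := posSemidef_exists_sqrt hV.posSemidef
  have hdet : V.det = B.det * B.det := by rw [hB, Matrix.det_mul, Matrix.det_transpose]
  have hB0 : B.det ≠ 0 := fun h0 => hV.det_pos.ne' (by rw [hdet, h0, zero_mul])
  have hBu : IsUnit B.det := hB0.isUnit
  have hVq : ∀ v, quad V v = sqNorm (B *ᵥ v) := fun v => by
    have := quad_conj B 1 v
    rwa [Matrix.mul_one, ← hB, quad_one] at this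
  have hM := quad_le_det_mul_of_sqNorm_le (M := (B⁻¹)ᵀ * V' * B⁻¹)
    (by simp [Matrix.transpose_mul, hV', Matrix.mul_assoc]) fun v => by
      rw [quad_conj]
      refine le_trans (le_of_eq ?_) (h _)
      rw [hVq, Matrix.mulVec_mulVec, Matrix.mul_nonsing_inv _ hBu, Matrix.one_mulVec]
  have hdM : V.det * ((B⁻¹)ᵀ * V' * B⁻¹).det = V'.det := by
    rw [Matrix.det_mul, Matrix.det_mul, Matrix.det_transpose, Matrix.det_nonsing_inv,
      Ring.inverse_eq_inv', hdet]
    field_simp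
  have hpos := hV.det_pos
  refine ⟨by rw [← hdM]; nlinarith [hM.1], fun v => ?_⟩
  have h1 := hM.2 (B *ᵥ v)
  rw [quad_conj, Matrix.mulVec_mulVec, Matrix.nonsing_inv_mul _ hBu, Matrix.one_mulVec,
    ← hVq] at h1
  rw [← hdM, mul_assoc]
  exact mul_le_mul_of_nonneg_left h1 hpos.le

lemma det_add_rankOne {V : Matrix ι ι ℝ} (hV : V.PosDef) (z : ι → ℝ) :
    (V + Matrix.vecMulVec z z).det = V.det * (1 + quad V⁻¹ z) := by
  have hu : IsUnit V.det := hV.det_pos.ne'.isUnit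
  have : V + Matrix.vecMulVec z z = V * (1 + Matrix.vecMulVec (V⁻¹ *ᵥ z) z) := by
    rw [Matrix.mul_add, Matrix.mul_one, Matrix.mul_vecMulVec, Matrix.mulVec_mulVec,
      Matrix.mul_nonsing_inv _ hu, Matrix.one_mulVec]
  rw [this, Matrix.det_mul, Matrix.vecMulVec_eq Unit, Matrix.det_one_add_replicateCol_mul_replicateRow]
  rfl

lemma posDef_add_rankOne {V : Matrix ι ι ℝ} (hV : V.PosDef) (z : ι → ℝ) :
    (V + Matrix.vecMulVec z z).PosDef := hV.add_posSemidef (posSemidef_vecMulVec z)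

/-- The rank-one update of the weighted norm of a sum of regressors. -/
lemma quad_inv_add_rankOne {V : Matrix ι ι ℝ} (hV : V.PosDef) (z s : ι → ℝ) (w : ℝ) :
    quad (V + Matrix.vecMulVec z z)⁻¹ (s + w • z) = quad V⁻¹ s +
      (2 * (z ⬝ᵥ (V⁻¹ *ᵥ s)) * w + quad V⁻¹ z * w ^ 2 - (z ⬝ᵥ (V⁻¹ *ᵥ s)) ^ 2) /
        (1 + quad V⁻¹ z) := by
  have hu : IsUnit V.det := hV.det_pos.ne'.isUnit
  have hu' : IsUnit (V + Matrix.vecMulVec z z).det := (posDef_add_rankOne hV z).det_pos.ne'.isUnit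
  set a := z ⬝ᵥ (V⁻¹ *ᵥ s) with ha
  set q := quad V⁻¹ z with hq
  have hq0 : 0 ≤ q := quad_nonneg hV.inv.posSemidef z
  -- Sherman–Morrison, verified by applying the updated matrix to the claimed solution.
  have hsol : (V + Matrix.vecMulVec z z)⁻¹ *ᵥ (s + w • z) =
      V⁻¹ *ᵥ s + ((w - a) / (1 + q)) • (V⁻¹ *ᵥ z) := by
    have h1 : (V + Matrix.vecMulVec z z) *ᵥ (V⁻¹ *ᵥ s + ((w - a) / (1 + q)) • (V⁻¹ *ᵥ z)) =
        s + w • z := by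
      rw [Matrix.add_mulVec, Matrix.mulVec_add, Matrix.mulVec_smul, Matrix.mulVec_mulVec,
        Matrix.mulVec_mulVec, Matrix.mul_nonsing_inv _ hu, Matrix.one_mulVec, Matrix.one_mulVec,
        Matrix.vecMulVec_mulVec, dotProduct_add, dotProduct_smul, ← ha]
      change s + ((w - a) / (1 + q)) • z + MulOpposite.op (a + ((w - a) / (1 + q)) * q) • z = _
      ext i
      simp only [Pi.add_apply, Pi.smul_apply, smul_eq_mul, MulOpposite.smul_eq_mul_unop,
        MulOpposite.unop_op]
      field_simp
      ring
    rw [← h1, Matrix.mulVec_mulVec, Matrix.nonsing_inv_mul _ hu', Matrix.one_mulVec]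
  have hs : s ⬝ᵥ (V⁻¹ *ᵥ z) = a :=
    dot_mulVec_comm (transpose_eq_of_posSemidef hV.inv.posSemidef) s z
  rw [quad, hsol]
  simp only [add_dotProduct, dotProduct_add, smul_dotProduct, dotProduct_smul, hs, smul_eq_mul,
    ← ha]
  change quad V⁻¹ s + w * a + (w - a) / (1 + q) * (a + w * q) = _
  field_simp
  ring

/-- The numbers `d` are the eigenvalues of `M` and do not depend on `c`, so determinants with
different regularizations can be compared factor by factor. -/
lemma det_smul_one_add {M : Matrix ι ι ℝ} (hM : M.PosSemidef) :
    ∃ d : ι → ℝ, (∀ i, 0 ≤ d i) ∧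
      ∀ c : ℝ, (c • (1 : Matrix ι ι ℝ) + M).det = ∏ i, (c + d i) := by
  obtain ⟨U, d, hU, hU', rfl⟩ := exists_diagonalization (transpose_eq_of_posSemidef hM)
  refine ⟨d, fun i => ?_, fun c => ?_⟩
  · rw [← (quad_diagonalization_col hU d i).1]; exact quad_nonneg hM _
  · have : c • (1 : Matrix ι ι ℝ) + U * Matrix.diagonal d * Uᵀ =
        U * Matrix.diagonal (fun i => c + d i) * Uᵀ := by
      rw [← Matrix.diagonal_add, Matrix.mul_add, Matrix.add_mul, ← Matrix.smul_one_eq_diagonal,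
        Matrix.mul_smul, Matrix.mul_one, Matrix.smul_mul, hU']
    rw [this, det_conj_orthogonal hU, Matrix.det_diagonal]

end LinearAlgebra

/-! ### Sub-Gaussian laws -/

section SubGaussian

open scoped ENNReal

/-- The law `ρ` on the line is centered sub-Gaussian with parameter `σ`. -/
def SubGaussianLaw (ρ : Measure ℝ) (σ : ℝ) : Prop :=
  ∀ g : ℝ, ∫⁻ y, ENNReal.ofReal (Real.exp (g * y)) ∂ρ ≤ ENNReal.ofReal (Real.exp (g ^ 2 * σ ^ 2 / 2))

lemma lintegral_exp_mul_gaussian (v : NNReal) (c : ℝ) :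
    ∫⁻ g, ENNReal.ofReal (Real.exp (c * g)) ∂(gaussianReal 0 v)
      = ENNReal.ofReal (Real.exp (v * c ^ 2 / 2)) := by
  rw [← ofReal_integral_eq_lintegral_ofReal (integrable_exp_mul_gaussianReal c)
    (Filter.Eventually.of_forall fun _ => (Real.exp_pos _).le)]
  have := congrFun (mgf_fun_id_gaussianReal (μ := 0) (v := v)) c
  simp only [mgf] at this
  rw [this]; simp

/-- Completing the square turns the integrand times the standard density into a multiple of the
Gaussian density with mean `c s / (1 - s²)` and variance `1 / (1 - s²)`. -/
lemma lintegral_exp_half_sq_gaussian (c s : ℝ) (hs : s ^ 2 < 1) :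
    ∫⁻ g, ENNReal.ofReal (Real.exp (1 / 2 * (c + s * g) ^ 2)) ∂(gaussianReal 0 1)
      = ENNReal.ofReal ((√(1 - s ^ 2))⁻¹ * Real.exp (c ^ 2 / (2 * (1 - s ^ 2)))) := by
  have hp : 0 < 1 - s ^ 2 := by linarith
  obtain ⟨v, hv⟩ : ∃ v : NNReal, (v : ℝ) = 1 / (1 - s ^ 2) := ⟨⟨_, by positivity⟩, rfl⟩
  have hv0 : v ≠ 0 := by
    rintro rfl
    have : 0 < 1 / (1 - s ^ 2) := by positivity
    exact this.ne hv
  rw [gaussianReal_of_var_ne_zero _ one_ne_zero, lintegral_withDensity_eq_lintegral_mul _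
    (measurable_gaussianPDF _ _) (by fun_prop)]
  have key : ∀ g : ℝ, (gaussianPDF 0 1 * fun g => ENNReal.ofReal (Real.exp (1 / 2 * (c + s * g) ^ 2))) g
      = ENNReal.ofReal ((√(1 - s ^ 2))⁻¹ * Real.exp (c ^ 2 / (2 * (1 - s ^ 2))))
        * gaussianPDF (c * s / (1 - s ^ 2)) v g := by
    intro g
    simp only [Pi.mul_apply, gaussianPDF]
    rw [← ENNReal.ofReal_mul (gaussianPDFReal_nonneg _ _ _), ← ENNReal.ofReal_mul (by positivity)]
    congr 1
    simp only [gaussianPDFReal, hv, NNReal.coe_one, mul_one]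
    have h1 : √(2 * Real.pi * (1 / (1 - s ^ 2))) = √(2 * Real.pi) * (√(1 - s ^ 2))⁻¹ := by
      rw [Real.sqrt_mul (by positivity), one_div, Real.sqrt_inv]
    have h2 : √(1 - s ^ 2) ≠ 0 := (Real.sqrt_pos.2 hp).ne'
    rw [h1, mul_inv, inv_inv, mul_assoc, ← Real.exp_add]
    rw [show (√(1 - s ^ 2))⁻¹ * Real.exp (c ^ 2 / (2 * (1 - s ^ 2))) *
        ((√(2 * Real.pi))⁻¹ * √(1 - s ^ 2) *
          Real.exp (-(g - c * s / (1 - s ^ 2)) ^ 2 / (2 * (1 / (1 - s ^ 2))))) =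
        (√(2 * Real.pi))⁻¹ * (Real.exp (c ^ 2 / (2 * (1 - s ^ 2))) *
          Real.exp (-(g - c * s / (1 - s ^ 2)) ^ 2 / (2 * (1 / (1 - s ^ 2))))) by
      field_simp, ← Real.exp_add]
    congr 2
    field_simp
    ring
  simp_rw [key]
  rw [lintegral_const_mul _ (measurable_gaussianPDF _ _), lintegral_gaussianPDF_eq_one _ hv0, mul_one]

/-- Exponential moments of squares under a sub-Gaussian law, by Gaussian linearization. -/
lemma SubGaussianLaw.lintegral_exp_quadratic_le {ρ : Measure ℝ} [IsProbabilityMeasure ρ] {σ : ℝ}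
    (h : SubGaussianLaw ρ σ) (hσ : 0 < σ) (c s : ℝ) (hs : s ^ 2 < 1) :
    ∫⁻ y, ENNReal.ofReal (Real.exp (c * y + s ^ 2 * y ^ 2 / (2 * σ ^ 2))) ∂ρ ≤
      ENNReal.ofReal ((√(1 - s ^ 2))⁻¹ * Real.exp (σ ^ 2 * c ^ 2 / (2 * (1 - s ^ 2)))) := by
  -- `exp (s² y² / (2σ²))` is the average of `exp ((s / σ) g y)` over a standard Gaussian `g`. After
  -- Tonelli, the exponent is linear in `y` for each `g`, and the sub-Gaussian bound applies.
  have h1 : ∀ y : ℝ, ENNReal.ofReal (Real.exp (c * y + s ^ 2 * y ^ 2 / (2 * σ ^ 2))) =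
      ∫⁻ g, ENNReal.ofReal (Real.exp ((c + s / σ * g) * y)) ∂(gaussianReal 0 1) := by
    intro y
    have : ∀ g : ℝ, ENNReal.ofReal (Real.exp ((c + s / σ * g) * y)) =
        ENNReal.ofReal (Real.exp (c * y)) * ENNReal.ofReal (Real.exp ((s / σ * y) * g)) := by
      intro g
      rw [← ENNReal.ofReal_mul (Real.exp_pos _).le, ← Real.exp_add]; congr 2; ring
    simp_rw [this]
    rw [lintegral_const_mul _ (by fun_prop), lintegral_exp_mul_gaussian,
      ← ENNReal.ofReal_mul (Real.exp_pos _).le, ← Real.exp_add]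
    congr 2
    simp only [NNReal.coe_one]
    field_simp
  simp_rw [h1]
  rw [lintegral_lintegral_swap (by fun_prop)]
  calc ∫⁻ g, ∫⁻ y, ENNReal.ofReal (Real.exp ((c + s / σ * g) * y)) ∂ρ ∂(gaussianReal 0 1)
      ≤ ∫⁻ g, ENNReal.ofReal (Real.exp (1 / 2 * (σ * c + s * g) ^ 2)) ∂(gaussianReal 0 1) := by
        refine lintegral_mono fun g => (h _).trans (le_of_eq ?_)
        congr 2
        field_simp
    _ = _ := by
        rw [lintegral_exp_half_sq_gaussian _ _ hs]; congr 3; ring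

/-- A conditional moment bound holds off a null set that depends on the exponent, so only countably
many exponents can be handled at once. Fatou's lemma passes to the real ones. -/
lemma subGaussianLaw_of_rat {ρ : Measure ℝ} {σ : ℝ}
    (h : ∀ q : ℚ, ∫⁻ y, ENNReal.ofReal (Real.exp (q * y)) ∂ρ ≤
      ENNReal.ofReal (Real.exp ((q : ℝ) ^ 2 * σ ^ 2 / 2))) : SubGaussianLaw ρ σ := by
  intro g
  obtain ⟨a, ha⟩ : ∃ a : ℕ → ℚ, Filter.Tendsto (fun n => (a n : ℝ)) Filter.atTop (nhds g) := by
    obtain ⟨a, -, -, ha⟩ := Real.exists_seq_rat_strictMono_tendsto g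
    exact ⟨a, ha⟩
  have h1 : ∀ y : ℝ, ENNReal.ofReal (Real.exp (g * y)) =
      Filter.liminf (fun n => ENNReal.ofReal (Real.exp (a n * y))) Filter.atTop := by
    intro y
    refine (Filter.Tendsto.liminf_eq ?_).symm
    exact ENNReal.tendsto_ofReal ((Real.continuous_exp.tendsto _).comp (ha.mul_const y))
  have h2 : Filter.Tendsto (fun n => ENNReal.ofReal (Real.exp ((a n : ℝ) ^ 2 * σ ^ 2 / 2)))
      Filter.atTop (nhds (ENNReal.ofReal (Real.exp (g ^ 2 * σ ^ 2 / 2)))) :=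
    ENNReal.tendsto_ofReal ((Real.continuous_exp.tendsto _).comp
      (((ha.pow 2).mul_const _).div_const _))
  simp_rw [h1]
  refine (lintegral_liminf_le fun n => by fun_prop).trans ?_
  rw [← h2.liminf_eq]
  exact Filter.liminf_le_liminf (Filter.Eventually.of_forall fun n => h (a n))

/-- Freezing: an integral over the joint law of the past and of a conditionally sub-Gaussian
variable is at most the integral of any bound valid for all sub-Gaussian laws. -/
lemma lintegral_le_of_condSubGaussian {Ω : Type*} {mΩ : MeasurableSpace Ω} {Pr : Measure Ω}
    [IsProbabilityMeasure Pr] {m : MeasurableSpace Ω} (hm : m ≤ mΩ) {Y : Ω → ℝ}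
    (hY : Measurable[mΩ] Y) {σ : ℝ}
    (hsub : ∀ g : ℝ, Integrable (fun ω => Real.exp (g * Y ω)) Pr ∧
      Pr[fun ω => Real.exp (g * Y ω) | m] ≤ᵐ[Pr] fun _ => Real.exp (g ^ 2 * σ ^ 2 / 2))
    {f : Ω → ℝ → ℝ≥0∞} (hf : Measurable[m.prod inferInstance] (Function.uncurry f)) {h : Ω → ℝ≥0∞}
    (hfh : ∀ (ω : Ω) (ρ : Measure ℝ), IsProbabilityMeasure ρ → SubGaussianLaw ρ σ →
      ∫⁻ y, f ω y ∂ρ ≤ h ω) :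
    ∫⁻ ω, f ω (Y ω) ∂Pr ≤ ∫⁻ ω, h ω ∂Pr := by
  have hid : @Measurable Ω Ω mΩ m id := measurable_id'' hm
  -- The regular conditional law of `Y` given `m`, obtained by conditioning on the identity map from
  -- `Ω` to `Ω` equipped with `m`.
  let κ : @Kernel Ω ℝ m _ := @condDistrib Ω Ω ℝ _ _ _ mΩ m Y id Pr _
  have hκm : @IsMarkovKernel Ω ℝ m _ κ := @instIsMarkovKernelCondDistrib Ω Ω ℝ _ _ _ mΩ Pr _ id Y m
  have h1 : ∀ᵐ ω ∂Pr, SubGaussianLaw (κ ω) σ := by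
    have : ∀ q : ℚ, ∀ᵐ ω ∂Pr, ∫⁻ y, ENNReal.ofReal (Real.exp (q * y)) ∂(κ ω) ≤
        ENNReal.ofReal (Real.exp ((q : ℝ) ^ 2 * σ ^ 2 / 2)) := by
      intro q
      have e1 := @condExp_ae_eq_integral_condDistrib Ω Ω ℝ ℝ _ _ _ _ mΩ Pr _ id Y m _ _ hid
        hY.aemeasurable (fun y => Real.exp (q * y)) (by fun_prop) (hsub q).1
      rw [MeasurableSpace.comap_id] at e1
      have e2 := @MeasureTheory.Integrable.condDistrib_ae Ω Ω ℝ ℝ _ _ _ _ mΩ Pr _ id Y m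
        (fun p => Real.exp (q * p.2)) hid.aemeasurable hY.aemeasurable
        ((integrable_map_measure (by fun_prop) (by
          exact (hid.prodMk hY).aemeasurable)).2 (hsub q).1)
      filter_upwards [e1, e2, (hsub q).2] with ω w1 w2 w3
      refine (le_of_eq (ofReal_integral_eq_lintegral_ofReal w2
        (Filter.Eventually.of_forall fun _ => (Real.exp_pos _).le)).symm).trans ?_
      refine ENNReal.ofReal_le_ofReal ?_
      rw [w1] at w3
      exact w3
    filter_upwards [ae_all_iff.2 this] with ω hω using subGaussianLaw_of_rat hω
  have hpair : @Measurable Ω (Ω × ℝ) mΩ (m.prod inferInstance) (fun ω => (id ω, Y ω)) :=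
    @Measurable.prodMk Ω mΩ Ω ℝ m inferInstance _ _ hid hY
  have h2 : ∫⁻ ω, f ω (Y ω) ∂Pr = ∫⁻ ω, ∫⁻ y, f ω y ∂(κ ω) ∂Pr := by
    have e1 : ∫⁻ ω, f ω (Y ω) ∂Pr = ∫⁻ p, Function.uncurry f p
        ∂(@Measure.map Ω (Ω × ℝ) mΩ (m.prod inferInstance) (fun ω => (id ω, Y ω)) Pr) := by
      rw [@lintegral_map _ _ mΩ (m.prod inferInstance) _ _ _ hf hpair]
      rfl
    rw [e1, ← @compProd_map_condDistrib Ω Ω ℝ _ _ _ mΩ Pr _ id Y m hY.aemeasurable,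
      Measure.lintegral_compProd hf, @lintegral_map Ω Ω mΩ m _ _ _ ?_ hid]
    · rfl
    · exact hf.lintegral_kernel_prod_right'
  rw [h2]
  refine lintegral_mono_ae ?_
  filter_upwards [h1] with ω hω
  exact hfh ω _ (hκm.isProbabilityMeasure ω) hω

end SubGaussian

/-! ### Self-normalized bounds for vector-valued martingales -/

section SelfNormalized

open scoped ENNReal

variable {Ω : Type*} {mΩ : MeasurableSpace Ω} {Pr : Measure Ω} [IsProbabilityMeasure Pr]

/-- Ville's maximal inequality for nonnegative supermartingales indexed by `t ≥ 1`. -/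
lemma mul_measure_exists_le_le (F : Filtration ℕ mΩ) {M : ℕ → Ω → ℝ≥0∞}
    (hM : ∀ t, 1 ≤ t → Measurable[F t] (M t))
    (hstep : ∀ t, 1 ≤ t → ∀ B, MeasurableSet[F t] B →
      ∫⁻ ω in B, M (t + 1) ω ∂Pr ≤ ∫⁻ ω in B, M t ω ∂Pr) (c : ℝ≥0∞) (T : ℕ) :
    c * Pr {ω | ∃ t, 1 ≤ t ∧ t ≤ T ∧ c ≤ M t ω} ≤ ∫⁻ ω, M 1 ω ∂Pr := by
  have hmeas : ∀ T, MeasurableSet[F (T + 1)] {ω | ∀ t, 1 ≤ t → t ≤ T + 1 → M t ω < c} := by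
    intro T
    simp only [Set.ofPred_forall]
    refine MeasurableSet.iInter fun t => MeasurableSet.iInter fun ht => MeasurableSet.iInter
      fun ht' => ?_
    exact measurableSet_lt ((hM t ht).mono (F.mono ht') le_rfl) measurable_const
  -- The process is stopped when it first reaches `c`: where this has happened it contributes at
  -- least `c`, elsewhere the supermartingale inequality is applied on the event of not having
  -- reached `c` so far, which is measurable at the current time.
  have key : ∀ T, c * Pr {ω | ∀ t, 1 ≤ t → t ≤ T + 1 → M t ω < c}ᶜ +
      ∫⁻ ω in {ω | ∀ t, 1 ≤ t → t ≤ T + 1 → M t ω < c}, M (T + 1) ω ∂Pr ≤ ∫⁻ ω, M 1 ω ∂Pr := by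
    intro T
    induction T with
    | zero =>
      have hA := (F.le _) _ (hmeas 0)
      rw [← lintegral_add_compl (μ := Pr) (M 1) hA, add_comm (c * _)]
      refine add_le_add le_rfl ?_
      rw [← setLIntegral_const]
      refine setLIntegral_mono' hA.compl fun ω hω => ?_
      simp only [zero_add, Set.mem_compl_iff, Set.mem_ofPred_eq, not_forall, not_lt] at hω
      obtain ⟨t, h1, h2, h3⟩ := hω
      obtain rfl : t = 1 := le_antisymm h2 h1
      exact h3
    | succ T ih =>
      set A := {ω | ∀ t, 1 ≤ t → t ≤ T + 1 → M t ω < c} with hAdef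
      set A' := {ω | ∀ t, 1 ≤ t → t ≤ T + 1 + 1 → M t ω < c} with hA'def
      have hA := (F.le _) _ (hmeas T)
      have hA' := (F.le _) _ (hmeas (T + 1))
      have hsub : A' ⊆ A := fun ω hω t h1 h2 => hω t h1 (by omega)
      refine le_trans ?_ ih
      refine le_trans ?_ (add_le_add le_rfl (hstep (T + 1) (by omega) A (hmeas T)))
      have hsplit : ∫⁻ ω in A, M (T + 1 + 1) ω ∂Pr =
          ∫⁻ ω in A', M (T + 1 + 1) ω ∂Pr + ∫⁻ ω in A \ A', M (T + 1 + 1) ω ∂Pr := by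
        rw [← lintegral_inter_add_sdiff _ A hA', Set.inter_eq_right.2 hsub]
      have hlow : c * Pr (A \ A') ≤ ∫⁻ ω in A \ A', M (T + 1 + 1) ω ∂Pr := by
        rw [← setLIntegral_const]
        refine setLIntegral_mono' (hA.diff hA') fun ω hω => ?_
        obtain ⟨h1, h2⟩ := hω
        simp only [hA'def, Set.mem_ofPred_eq, not_forall, not_lt] at h2
        obtain ⟨t, h3, h4, h5⟩ := h2
        have : t = T + 1 + 1 := by
          by_contra hne
          exact absurd (h1 t h3 (by omega)) (not_lt.2 h5)
        subst this
        exact h5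
      have hc : A'ᶜ = Aᶜ ∪ (A \ A') := by
        ext ω
        by_cases h1 : ω ∈ A <;> by_cases h2 : ω ∈ A' <;> simp [h1, h2]
        exact h1 (hsub h2)
      calc c * Pr A'ᶜ + ∫⁻ ω in A', M (T + 1 + 1) ω ∂Pr
          ≤ (c * Pr Aᶜ + c * Pr (A \ A')) + ∫⁻ ω in A', M (T + 1 + 1) ω ∂Pr := by
            rw [← mul_add, hc]
            gcongr
            exact measure_union_le _ _
        _ ≤ (c * Pr Aᶜ + ∫⁻ ω in A \ A', M (T + 1 + 1) ω ∂Pr) +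
              ∫⁻ ω in A', M (T + 1 + 1) ω ∂Pr := by gcongr
        _ = c * Pr Aᶜ + ∫⁻ ω in A, M (T + 1 + 1) ω ∂Pr := by rw [hsplit]; ring
  refine le_trans ?_ ((le_add_right le_rfl).trans (key T))
  gcongr
  rintro ω ⟨t, h1, h2, h3⟩
  simp only [Set.mem_compl_iff, Set.mem_ofPred_eq, not_forall, not_lt]
  exact ⟨t, h1, by omega, h3⟩

variable {ι : Type*} [Fintype ι] [DecidableEq ι]

lemma measurable_matrix_det {α : Type*} {m : MeasurableSpace α} {M : α → Matrix ι ι ℝ}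
    (h : ∀ i j, Measurable fun a => M a i j) : Measurable fun a => (M a).det := by
  simp only [Matrix.det_apply]
  refine Finset.measurable_sum _ fun p _ => ?_
  exact (Finset.measurable_prod _ fun i _ => h _ _).const_smul _

lemma measurable_matrix_inv {α : Type*} {m : MeasurableSpace α} {M : α → Matrix ι ι ℝ}
    (h : ∀ i j, Measurable fun a => M a i j) (i j : ι) : Measurable fun a => (M a)⁻¹ i j := by
  simp only [Matrix.inv_def, Ring.inverse_eq_inv', Matrix.smul_apply, Matrix.adjugate_apply,
    smul_eq_mul]
  refine (measurable_matrix_det h).inv.mul (measurable_matrix_det fun k l => ?_)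
  by_cases hk : k = j
  · subst hk; simp only [Matrix.updateRow_self]; exact measurable_const
  · simp only [Matrix.updateRow_ne hk]; exact h k l

lemma measurable_bilin {α : Type*} {m : MeasurableSpace α} {M : α → Matrix ι ι ℝ}
    (h : ∀ i j, Measurable fun a => M a i j) {u v : α → ι → ℝ} (hu : ∀ i, Measurable fun a => u a i)
    (hv : ∀ i, Measurable fun a => v a i) : Measurable fun a => u a ⬝ᵥ (M a *ᵥ v a) := by
  simp only [dotProduct, Matrix.mulVec]
  exact Finset.measurable_sum _ fun i _ => (hu i).mul
    (Finset.measurable_sum _ fun j _ => (h i j).mul (hv j))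

/-- The regularized Gram matrix of the regressors `z s`, `1 ≤ s < t`. -/
noncomputable def gram (c : ℝ) (z : ℕ → ι → ℝ) (t : ℕ) : Matrix ι ι ℝ :=
  c • (1 : Matrix ι ι ℝ) + ∑ s ∈ Finset.Ico 1 t, Matrix.vecMulVec (z s) (z s)

/-- The noise sum `∑_{1 ≤ s < t} w (s + 1) z s`. -/
noncomputable def noiseSum (z : ℕ → ι → ℝ) (w : ℕ → ℝ) (t : ℕ) : ι → ℝ :=
  ∑ s ∈ Finset.Ico 1 t, w (s + 1) • z s

lemma gram_succ (c : ℝ) (z : ℕ → ι → ℝ) {t : ℕ} (ht : 1 ≤ t) :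
    gram c z (t + 1) = gram c z t + Matrix.vecMulVec (z t) (z t) := by
  rw [gram, gram, Finset.sum_Ico_succ_top ht, add_assoc]

lemma noiseSum_succ (z : ℕ → ι → ℝ) (w : ℕ → ℝ) {t : ℕ} (ht : 1 ≤ t) :
    noiseSum z w (t + 1) = noiseSum z w t + w (t + 1) • z t := by
  rw [noiseSum, noiseSum, Finset.sum_Ico_succ_top ht]

lemma posSemidef_sum_vecMulVec (z : ℕ → ι → ℝ) (s : Finset ℕ) :
    (∑ i ∈ s, Matrix.vecMulVec (z i) (z i)).PosSemidef :=
  Matrix.posSemidef_sum _ fun i _ => posSemidef_vecMulVec (z i)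

lemma gram_posDef {c : ℝ} (hc : 0 < c) (z : ℕ → ι → ℝ) (t : ℕ) : (gram c z t).PosDef :=
  (Matrix.PosDef.one.smul hc).add_posSemidef (posSemidef_sum_vecMulVec z _)

/-- The exponential supermartingale of the self-normalized bound. -/
noncomputable def expProcess (c σ : ℝ) (z : ℕ → ι → ℝ) (w : ℕ → ℝ) (t : ℕ) : ℝ :=
  Real.exp (quad (gram c z t)⁻¹ (noiseSum z w t) / (2 * σ ^ 2)
    - 1 / 2 * Real.log ((gram c z t).det / c ^ Fintype.card ι))

/-- The factor gained in one step involves only the new noise `w (t + 1)` and quantities known at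
time `t`, which is the form that conditioning on the past requires. -/
lemma expProcess_succ {c σ : ℝ} (hc : 0 < c) (z : ℕ → ι → ℝ) (w : ℕ → ℝ) {t : ℕ} (ht : 1 ≤ t) :
    expProcess c σ z w (t + 1) = expProcess c σ z w t * Real.exp
      ((2 * (z t ⬝ᵥ ((gram c z t)⁻¹ *ᵥ noiseSum z w t)) * w (t + 1)
        + quad (gram c z t)⁻¹ (z t) * w (t + 1) ^ 2
        - (z t ⬝ᵥ ((gram c z t)⁻¹ *ᵥ noiseSum z w t)) ^ 2) /
          (1 + quad (gram c z t)⁻¹ (z t)) / (2 * σ ^ 2)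
        - 1 / 2 * Real.log (1 + quad (gram c z t)⁻¹ (z t))) := by
  have hV := gram_posDef hc z t
  have hq : 0 ≤ quad (gram c z t)⁻¹ (z t) := quad_nonneg hV.inv.posSemidef _
  rw [expProcess, expProcess, gram_succ c z ht, noiseSum_succ z w ht, quad_inv_add_rankOne hV,
    det_add_rankOne hV, mul_div_right_comm, Real.log_mul (by have := hV.det_pos; positivity)
    (by positivity), ← Real.exp_add]
  congr 1
  ring

/-- The one-step bound behind the supermartingale property. -/
lemma SubGaussianLaw.lintegral_expProcess_step_le {ρ : Measure ℝ} [IsProbabilityMeasure ρ] {σ : ℝ}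
    (h : SubGaussianLaw ρ σ) (hσ : 0 < σ) (a : ℝ) {q : ℝ} (hq : 0 ≤ q) :
    ∫⁻ y, ENNReal.ofReal (Real.exp ((2 * a * y + q * y ^ 2 - a ^ 2) / (1 + q) / (2 * σ ^ 2)
      - 1 / 2 * Real.log (1 + q))) ∂ρ ≤ 1 := by
  -- With `s² = q / (1 + q)` one has `1 - s² = 1 / (1 + q)`. The normalizing factor `√(1 + q)` is
  -- then compensated by the logarithm of the determinant increment.
  have hs : √(q / (1 + q)) ^ 2 = q / (1 + q) := Real.sq_sqrt (by positivity)
  have hs1 : 1 - q / (1 + q) = 1 / (1 + q) := by field_simp; ring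
  have h1 := h.lintegral_exp_quadratic_le hσ (a / (σ ^ 2 * (1 + q))) (√(q / (1 + q))) (by
    rw [hs, div_lt_one (by positivity)]; linarith)
  rw [hs, hs1] at h1
  set e := Real.exp (-(a ^ 2 / (2 * σ ^ 2 * (1 + q))) - 1 / 2 * Real.log (1 + q)) with he
  have h2 : ∀ y : ℝ, ENNReal.ofReal (Real.exp ((2 * a * y + q * y ^ 2 - a ^ 2) / (1 + q) /
      (2 * σ ^ 2) - 1 / 2 * Real.log (1 + q))) = ENNReal.ofReal e * ENNReal.ofReal
        (Real.exp (a / (σ ^ 2 * (1 + q)) * y + q / (1 + q) * y ^ 2 / (2 * σ ^ 2))) := by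
    intro y
    rw [← ENNReal.ofReal_mul (Real.exp_pos _).le, ← Real.exp_add]
    congr 2
    field_simp
    ring
  simp_rw [h2]
  rw [lintegral_const_mul _ (by fun_prop)]
  refine (mul_le_mul_right h1 _).trans ?_
  rw [← ENNReal.ofReal_mul (Real.exp_pos _).le, ← ENNReal.ofReal_one]
  refine ENNReal.ofReal_le_ofReal (le_of_eq ?_)
  have h3 : (√(1 / (1 + q)))⁻¹ = Real.exp (1 / 2 * Real.log (1 + q)) := by
    rw [one_div, Real.sqrt_inv, inv_inv, Real.sqrt_eq_rpow, Real.rpow_def_of_pos (by positivity)]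
    ring_nf
  rw [h3, ← Real.exp_add, ← Real.exp_add, Real.exp_eq_one_iff]
  field_simp
  ring

/-- The self-normalized tail bound for vector-valued martingales, uniformly in time. -/
lemma measure_selfNormalized_le (F : Filtration ℕ mΩ) {z : ℕ → Ω → ι → ℝ} {w : ℕ → Ω → ℝ}
    (hz : ∀ t, 1 ≤ t → ∀ i, Measurable[F t] fun ω => z t ω i)
    (hw : ∀ t, 1 ≤ t → Measurable[F (t + 1)] (w (t + 1))) {σ : ℝ} (hσ : 0 < σ)
    (hsub : ∀ t, 1 ≤ t → ∀ g : ℝ, Integrable (fun ω => Real.exp (g * w (t + 1) ω)) Pr ∧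
      Pr[fun ω => Real.exp (g * w (t + 1) ω) | F t] ≤ᵐ[Pr] fun _ => Real.exp (g ^ 2 * σ ^ 2 / 2))
    {c δ : ℝ} (hc : 0 < c) (hδ : 0 < δ) (T : ℕ) :
    Pr {ω | ∃ t, 1 ≤ t ∧ t ≤ T ∧
      σ ^ 2 * (Real.log ((gram c (fun s => z s ω) t).det / c ^ Fintype.card ι)
        + 2 * Real.log (1 / δ)) <
      quad (gram c (fun s => z s ω) t)⁻¹ (noiseSum (fun s => z s ω) (fun s => w s ω) t)} ≤
      ENNReal.ofReal δ := by
  have hgram : ∀ t, 1 ≤ t → ∀ i j, Measurable[F t] fun ω => gram c (fun s => z s ω) t i j := by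
    intro t ht i j
    simp only [gram, Matrix.add_apply, Matrix.sum_apply, Matrix.vecMulVec_apply]
    refine measurable_const.add (Finset.measurable_sum _ fun s hs => ?_)
    rw [Finset.mem_Ico] at hs
    exact ((hz s hs.1 i).mono (F.mono hs.2.le) le_rfl).mul
      ((hz s hs.1 j).mono (F.mono hs.2.le) le_rfl)
  have hnoise : ∀ t, 1 ≤ t → ∀ i, Measurable[F t] fun ω =>
      noiseSum (fun s => z s ω) (fun s => w s ω) t i := by
    intro t ht i
    simp only [noiseSum, Finset.sum_apply, Pi.smul_apply, smul_eq_mul]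
    refine Finset.measurable_sum _ fun s hs => ?_
    rw [Finset.mem_Ico] at hs
    exact ((hw s hs.1).mono (F.mono hs.2) le_rfl).mul ((hz s hs.1 i).mono (F.mono hs.2.le) le_rfl)
  have hM : ∀ t, 1 ≤ t → Measurable[F t] fun ω =>
      ENNReal.ofReal (expProcess c σ (fun s => z s ω) (fun s => w s ω) t) := by
    intro t ht
    refine ENNReal.measurable_ofReal.comp (Real.measurable_exp.comp ?_)
    refine ((measurable_bilin (measurable_matrix_inv (hgram t ht)) (hnoise t ht)
      (hnoise t ht)).div_const _).sub (measurable_const.mul (Real.measurable_log.comp ?_))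
    exact (measurable_matrix_det (hgram t ht)).div_const _
  have hstep : ∀ t, 1 ≤ t → ∀ B, MeasurableSet[F t] B →
      ∫⁻ ω in B, ENNReal.ofReal (expProcess c σ (fun s => z s ω) (fun s => w s ω) (t + 1)) ∂Pr ≤
      ∫⁻ ω in B, ENNReal.ofReal (expProcess c σ (fun s => z s ω) (fun s => w s ω) t) ∂Pr := by
    intro t ht B hB
    rw [← lintegral_indicator (F.le t _ hB), ← lintegral_indicator (F.le t _ hB)]
    have ha : Measurable[F t] fun ω => z t ω ⬝ᵥ ((gram c (fun s => z s ω) t)⁻¹ *ᵥ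
        noiseSum (fun s => z s ω) (fun s => w s ω) t) :=
      measurable_bilin (measurable_matrix_inv (hgram t ht)) (hz t ht) (hnoise t ht)
    have hq : Measurable[F t] fun ω => quad (gram c (fun s => z s ω) t)⁻¹ (z t ω) :=
      measurable_bilin (measurable_matrix_inv (hgram t ht)) (hz t ht) (hz t ht)
    -- The set `B` and the current value of the process belong to the frozen past; only the step
    -- factor depends on the new noise.
    have hfr := lintegral_le_of_condSubGaussian (Pr := Pr) (F.le t)
      (Y := w (t + 1)) ((hw t ht).mono (F.le _) le_rfl) (hsub t ht)
      (f := fun ω y => B.indicator (fun ω => ENNReal.ofReal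
        (expProcess c σ (fun s => z s ω) (fun s => w s ω) t)) ω * ENNReal.ofReal (Real.exp
          ((2 * (z t ω ⬝ᵥ ((gram c (fun s => z s ω) t)⁻¹ *ᵥ
            noiseSum (fun s => z s ω) (fun s => w s ω) t)) * y
          + quad (gram c (fun s => z s ω) t)⁻¹ (z t ω) * y ^ 2
          - (z t ω ⬝ᵥ ((gram c (fun s => z s ω) t)⁻¹ *ᵥ
            noiseSum (fun s => z s ω) (fun s => w s ω) t)) ^ 2) /
            (1 + quad (gram c (fun s => z s ω) t)⁻¹ (z t ω)) / (2 * σ ^ 2)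
          - 1 / 2 * Real.log (1 + quad (gram c (fun s => z s ω) t)⁻¹ (z t ω)))))
      (h := B.indicator (fun ω => ENNReal.ofReal
        (expProcess c σ (fun s => z s ω) (fun s => w s ω) t)))
      ?_ ?_
    · refine le_trans (lintegral_mono fun ω => ?_) hfr
      by_cases hω : ω ∈ B
      · simp only [Set.indicator_of_mem hω]
        rw [expProcess_succ hc _ _ ht, ENNReal.ofReal_mul (by rw [expProcess]; positivity)]
      · simp only [Set.indicator_of_notMem hω, zero_mul, le_refl]
    · refine Measurable.mul (((hM t ht).indicator hB).comp measurable_fst) ?_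
      have ha' := ha.comp (@measurable_fst Ω ℝ (F t) inferInstance)
      have hq' := hq.comp (@measurable_fst Ω ℝ (F t) inferInstance)
      have hy' := @measurable_snd Ω ℝ (F t) inferInstance
      refine ENNReal.measurable_ofReal.comp (Real.measurable_exp.comp ?_)
      refine ((((((ha'.const_mul 2).mul hy').add (hq'.mul (hy'.pow_const 2))).sub
        (ha'.pow_const 2)).div (hq'.const_add 1)).div_const _).sub
        (measurable_const.mul (Real.measurable_log.comp (hq'.const_add 1)))
    · intro ω ρ hρ hsubρ
      rw [lintegral_const_mul _ (by fun_prop)]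
      refine (mul_le_mul_right (hsubρ.lintegral_expProcess_step_le hσ _ ?_) _).trans
        (mul_one _).le
      exact quad_nonneg (gram_posDef hc _ t).inv.posSemidef _
  -- The process starts from the value one, so the probability of ever reaching `1 / δ` is at most
  -- `δ`.
  have hV := mul_measure_exists_le_le (Pr := Pr) F hM hstep (ENNReal.ofReal (1 / δ)) T
  have h1 : ∀ ω, ENNReal.ofReal (expProcess c σ (fun s => z s ω) (fun s => w s ω) 1) = 1 := by
    intro ω
    have : expProcess c σ (fun s => z s ω) (fun s => w s ω) 1 = 1 := by
      simp [expProcess, gram, noiseSum, quad, div_self (pow_pos hc (Fintype.card ι)).ne']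
    rw [this, ENNReal.ofReal_one]
  simp_rw [h1] at hV
  rw [lintegral_const, measure_univ, mul_one, ENNReal.ofReal_div_of_pos hδ, ENNReal.ofReal_one,
    one_div, ENNReal.inv_mul_le_iff (by simpa using hδ) ENNReal.ofReal_ne_top, mul_one] at hV
  refine (measure_mono ?_).trans hV
  rintro ω ⟨t, h2, h3, h4⟩
  refine ⟨t, h2, h3, ?_⟩
  rw [← ENNReal.ofReal_inv_of_pos hδ]
  refine ENNReal.ofReal_le_ofReal ?_
  rw [← Real.exp_log (inv_pos.2 hδ), expProcess, Real.exp_le_exp]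
  have h5 : Real.log ((gram c (fun s => z s ω) t).det / c ^ Fintype.card ι) + 2 * Real.log (1 / δ) ≤
      quad (gram c (fun s => z s ω) t)⁻¹ (noiseSum (fun s => z s ω) (fun s => w s ω) t) /
        σ ^ 2 := by
    rw [le_div_iff₀ (by positivity), mul_comm]; exact h4.le
  rw [one_div] at h5
  have h6 : quad (gram c (fun s => z s ω) t)⁻¹ (noiseSum (fun s => z s ω) (fun s => w s ω) t) /
        (2 * σ ^ 2) = 1 / 2 * (quad (gram c (fun s => z s ω) t)⁻¹
        (noiseSum (fun s => z s ω) (fun s => w s ω) t) / σ ^ 2) := by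
    field_simp
  rw [h6]
  linarith

end SelfNormalized

/-! ### Tails of the disturbances -/

section NoiseTails

open scoped ENNReal

variable {Ω : Type*} {mΩ : MeasurableSpace Ω} {Pr : Measure Ω} [IsProbabilityMeasure Pr]

/-- Tail bound for the squared norm of a vector with sub-Gaussian coordinates, which need not be
independent. -/
lemma measure_sum_sq_gt_le {ι : Type*} [Fintype ι] {y : ι → Ω → ℝ} (hy : ∀ i, Measurable (y i))
    {s : ι → ℝ} (hs : ∀ i, 0 < s i) (hsub : ∀ i, SubGaussianLaw (Pr.map (y i)) (s i)) {b l : ℝ}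
    (hb : ∑ i, s i ^ 2 ≤ b) (hl : 0 ≤ l) :
    Pr {ω | 5 * b * l < ∑ i, y i ω ^ 2} ≤ ENNReal.ofReal (9 / 4 * Real.exp (-(2 * l))) := by
  rcases isEmpty_or_nonempty ι with hι | hι
  · have : {ω | 5 * b * l < ∑ i, y i ω ^ 2} = ∅ := by
      refine Set.eq_empty_of_forall_notMem fun ω hω => ?_
      simp only [Finset.univ_eq_empty, Finset.sum_empty, Set.mem_ofPred_eq] at hω hb
      nlinarith [mul_nonneg hb hl]
    rw [this, measure_empty]; exact zero_le
  set Q := ∑ i, s i ^ 2 with hQ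
  have hQ0 : 0 < Q := Finset.sum_pos (fun i _ => pow_pos (hs i) 2) Finset.univ_nonempty
  -- The exponential moment of the square is taken at `s² = 4 / 5`, where its bound is `√5 ≤ 9 / 4`.
  have hexp : ∀ i, ∫⁻ ω, ENNReal.ofReal (Real.exp (2 * y i ω ^ 2 / (5 * s i ^ 2))) ∂Pr ≤
      ENNReal.ofReal (9 / 4) := by
    intro i
    have : IsProbabilityMeasure (Pr.map (y i)) :=
      Measure.isProbabilityMeasure_map (hy i).aemeasurable
    have h1 := (hsub i).lintegral_exp_quadratic_le (hs i) 0 (√(4 / 5)) (by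
      rw [Real.sq_sqrt (by norm_num)]; norm_num)
    rw [lintegral_map (by fun_prop) (hy i), Real.sq_sqrt (by norm_num)] at h1
    refine le_trans (le_of_eq ?_) (h1.trans (ENNReal.ofReal_le_ofReal ?_))
    · refine lintegral_congr fun ω => ?_
      congr 2
      have := hs i
      field_simp
      ring
    · have : (4 / 9 : ℝ) ≤ √(1 - 4 / 5) := Real.le_sqrt_of_sq_le (by norm_num)
      rw [show (s i ^ 2 * 0 ^ 2 / (2 * (1 - 4 / 5)) : ℝ) = 0 by ring, Real.exp_zero, mul_one]
      calc (√(1 - 4 / 5))⁻¹ ≤ (4 / 9 : ℝ)⁻¹ := inv_anti₀ (by norm_num) this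
        _ = 9 / 4 := by norm_num
  have hsum : ∫⁻ ω, ENNReal.ofReal (∑ i, s i ^ 2 / Q * Real.exp (2 * y i ω ^ 2 / (5 * s i ^ 2))) ∂Pr
      ≤ ENNReal.ofReal (9 / 4) := by
    calc ∫⁻ ω, ENNReal.ofReal (∑ i, s i ^ 2 / Q * Real.exp (2 * y i ω ^ 2 / (5 * s i ^ 2))) ∂Pr
        = ∫⁻ ω, ∑ i, ENNReal.ofReal (s i ^ 2 / Q) *
            ENNReal.ofReal (Real.exp (2 * y i ω ^ 2 / (5 * s i ^ 2))) ∂Pr := by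
          refine lintegral_congr fun ω => ?_
          rw [ENNReal.ofReal_sum_of_nonneg fun i _ => by positivity]
          exact Finset.sum_congr rfl fun i _ => ENNReal.ofReal_mul (by positivity)
      _ = ∑ i, ENNReal.ofReal (s i ^ 2 / Q) *
            ∫⁻ ω, ENNReal.ofReal (Real.exp (2 * y i ω ^ 2 / (5 * s i ^ 2))) ∂Pr := by
          rw [lintegral_finsetSum _ fun i _ => by have := hy i; fun_prop]
          exact Finset.sum_congr rfl fun i _ =>
            lintegral_const_mul _ (by have := hy i; fun_prop)
      _ ≤ ∑ i, ENNReal.ofReal (s i ^ 2 / Q) * ENNReal.ofReal (9 / 4) := by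
          gcongr with i; exact hexp i
      _ = ENNReal.ofReal (9 / 4) := by
          rw [← Finset.sum_mul, ← ENNReal.ofReal_sum_of_nonneg fun i _ => by positivity,
            ← Finset.sum_div, ← hQ, div_self hQ0.ne', ENNReal.ofReal_one, one_mul]
  -- Convexity of the exponential with weights `s i ^ 2 / Q` replaces independence: the weighted
  -- mean of the exponents is `2 / (5 Q)` times the sum of squares, which exceeds `2 l` on the event
  -- because `Q ≤ b`.
  have hincl : {ω | 5 * b * l < ∑ i, y i ω ^ 2} ⊆ {ω | ENNReal.ofReal (Real.exp (2 * l)) ≤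
      ENNReal.ofReal (∑ i, s i ^ 2 / Q * Real.exp (2 * y i ω ^ 2 / (5 * s i ^ 2)))} := by
    intro ω hω
    refine ENNReal.ofReal_le_ofReal ?_
    have h1 := convexOn_exp.map_sum_le (t := Finset.univ) (w := fun i => s i ^ 2 / Q)
      (p := fun i => 2 * y i ω ^ 2 / (5 * s i ^ 2)) (fun i _ => by positivity)
      (by rw [← Finset.sum_div, ← hQ, div_self hQ0.ne']) fun i _ => Set.mem_univ _
    simp only [smul_eq_mul] at h1
    refine le_trans (Real.exp_le_exp.2 ?_) h1
    have h2 : ∑ i, s i ^ 2 / Q * (2 * y i ω ^ 2 / (5 * s i ^ 2)) =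
        2 / (5 * Q) * ∑ i, y i ω ^ 2 := by
      rw [Finset.mul_sum]
      refine Finset.sum_congr rfl fun i _ => ?_
      have := hs i
      field_simp
    rw [h2, div_mul_eq_mul_div, le_div_iff₀ (by positivity)]
    have h3 : 5 * b * l < ∑ i, y i ω ^ 2 := hω
    nlinarith [mul_le_mul_of_nonneg_right hb hl]
  have hmark := mul_meas_ge_le_lintegral₀ (μ := Pr) (f := fun ω =>
    ENNReal.ofReal (∑ i, s i ^ 2 / Q * Real.exp (2 * y i ω ^ 2 / (5 * s i ^ 2))))
    (by
      refine (ENNReal.measurable_ofReal.comp (Finset.measurable_sum _ fun i _ => ?_)).aemeasurable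
      have := hy i
      fun_prop) (ENNReal.ofReal (Real.exp (2 * l)))
  have hfin := hmark.trans hsum
  refine (measure_mono hincl).trans ?_
  have h5 : ENNReal.ofReal (9 / 4 * Real.exp (-(2 * l))) =
      ENNReal.ofReal (9 / 4) / ENNReal.ofReal (Real.exp (2 * l)) := by
    rw [← ENNReal.ofReal_div_of_pos (Real.exp_pos _), Real.exp_neg]
    congr 1
  rw [h5, ENNReal.le_div_iff_mul_le (Or.inl (by simp [Real.exp_pos])) (Or.inl ENNReal.ofReal_ne_top),
    mul_comm]
  exact hfin

lemma lintegral_exp_dotProduct_gaussian_pi {ι : Type*} [Fintype ι] (v : NNReal) (b : ι → ℝ) :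
    ∫⁻ x, ENNReal.ofReal (Real.exp (b ⬝ᵥ x)) ∂(Measure.pi fun _ : ι => gaussianReal 0 v) =
      ENNReal.ofReal (Real.exp (v * sqNorm b / 2)) := by
  have h1 : ∀ x : ι → ℝ, Real.exp (b ⬝ᵥ x) = ∏ i, Real.exp (b i * x i) := fun x => by
    rw [dotProduct, Real.exp_sum]
  simp_rw [h1]
  rw [← ofReal_integral_eq_lintegral_ofReal
    (Integrable.fintype_prod (f := fun i x => Real.exp (b i * x)) fun i =>
      integrable_exp_mul_gaussianReal (b i))
    (Filter.Eventually.of_forall fun _ => Finset.prod_nonneg fun i _ => (Real.exp_pos _).le),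
    integral_fintype_prod_eq_prod (f := fun i x => Real.exp (b i * x))]
  congr 1
  rw [sqNorm_eq_sum, Finset.mul_sum, Finset.sum_div, Real.exp_sum]
  refine Finset.prod_congr rfl fun i _ => ?_
  have := congrFun (mgf_fun_id_gaussianReal (μ := 0) (v := v)) (b i)
  simp only [mgf] at this
  rw [this]; simp

/-- A linear form of a Gaussian vector of the past plus a conditionally sub-Gaussian variable. -/
lemma subGaussianLaw_map_add (F : Filtration ℕ mΩ) (t : ℕ) {ι : Type*} [Fintype ι]
    {η : Ω → ι → ℝ} (hη : Measurable[F t] η) {v : NNReal}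
    (hlaw : Pr.map η = Measure.pi fun _ => gaussianReal 0 v) {Y : Ω → ℝ} (hY : Measurable Y)
    {σ : ℝ} (hsub : ∀ g : ℝ, Integrable (fun ω => Real.exp (g * Y ω)) Pr ∧
      Pr[fun ω => Real.exp (g * Y ω) | F t] ≤ᵐ[Pr] fun _ => Real.exp (g ^ 2 * σ ^ 2 / 2))
    (b : ι → ℝ) {s : ℝ} (hs : σ ^ 2 + v * sqNorm b ≤ s ^ 2) :
    SubGaussianLaw (Pr.map fun ω => b ⬝ᵥ η ω + Y ω) s := by
  intro g
  have hη' : Measurable η := hη.mono (F.le t) le_rfl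
  have hb : Measurable fun x : ι → ℝ => b ⬝ᵥ x := by unfold dotProduct; fun_prop
  have hbη : Measurable fun ω => b ⬝ᵥ η ω := hb.comp hη'
  have hsum : Measurable fun ω => b ⬝ᵥ η ω + Y ω := hbη.add hY
  rw [lintegral_map (by fun_prop) hsum]
  have h1 := lintegral_le_of_condSubGaussian (Pr := Pr) (F.le t) hY hsub
    (f := fun ω y => ENNReal.ofReal (Real.exp ((g • b) ⬝ᵥ η ω)) * ENNReal.ofReal (Real.exp (g * y)))
    (h := fun ω => ENNReal.ofReal (Real.exp ((g • b) ⬝ᵥ η ω)) *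
      ENNReal.ofReal (Real.exp (g ^ 2 * σ ^ 2 / 2))) (by
        have hb' : Measurable fun x : ι → ℝ => (g • b) ⬝ᵥ x := by unfold dotProduct; fun_prop
        refine Measurable.mul (ENNReal.measurable_ofReal.comp (Real.measurable_exp.comp
          ((hb'.comp hη).comp measurable_fst)))
          (ENNReal.measurable_ofReal.comp (Real.measurable_exp.comp (measurable_snd.const_mul g))))
    (fun ω ρ _ hρ => by
      rw [lintegral_const_mul _ (by fun_prop)]
      exact mul_le_mul_right (hρ g) _)
  calc ∫⁻ ω, ENNReal.ofReal (Real.exp (g * (b ⬝ᵥ η ω + Y ω))) ∂Pr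
      = ∫⁻ ω, ENNReal.ofReal (Real.exp ((g • b) ⬝ᵥ η ω)) *
          ENNReal.ofReal (Real.exp (g * Y ω)) ∂Pr := by
        refine lintegral_congr fun ω => ?_
        rw [← ENNReal.ofReal_mul (Real.exp_pos _).le, ← Real.exp_add, smul_dotProduct, smul_eq_mul,
          mul_add]
    _ ≤ _ := h1
    _ = ENNReal.ofReal (Real.exp (v * sqNorm (g • b) / 2)) *
          ENNReal.ofReal (Real.exp (g ^ 2 * σ ^ 2 / 2)) := by
        have hb' : Measurable fun x : ι → ℝ => ENNReal.ofReal (Real.exp ((g • b) ⬝ᵥ x)) := by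
          unfold dotProduct; fun_prop
        rw [lintegral_mul_const' _ _ ENNReal.ofReal_ne_top,
          ← lintegral_exp_dotProduct_gaussian_pi, ← hlaw, lintegral_map hb' hη']
    _ ≤ _ := by
        rw [← ENNReal.ofReal_mul (Real.exp_pos _).le, ← Real.exp_add, sqNorm_smul]
        refine ENNReal.ofReal_le_ofReal (Real.exp_le_exp.2 ?_)
        nlinarith [mul_le_mul_of_nonneg_left hs (sq_nonneg g)]

lemma subGaussianLaw_map_coord {ι : Type*} [Fintype ι] [DecidableEq ι] {η : Ω → ι → ℝ}
    (hη : Measurable η) {v : NNReal} (hlaw : Pr.map η = Measure.pi fun _ => gaussianReal 0 v)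
    (i : ι) {s : ℝ} (hs : v ≤ s ^ 2) : SubGaussianLaw (Pr.map fun ω => η ω i) s := by
  intro g
  rw [lintegral_map (by fun_prop) (by fun_prop)]
  have h1 := lintegral_exp_dotProduct_gaussian_pi v (Pi.single i g : ι → ℝ)
  have hb' : Measurable fun x : ι → ℝ => ENNReal.ofReal (Real.exp (Pi.single i g ⬝ᵥ x)) := by
    unfold dotProduct; fun_prop
  rw [← hlaw, lintegral_map hb' hη] at h1
  simp only [single_dotProduct] at h1
  rw [h1]
  refine ENNReal.ofReal_le_ofReal (Real.exp_le_exp.2 ?_)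
  have : sqNorm (Pi.single i g : ι → ℝ) = g ^ 2 := by simp [sqNorm, sq]
  rw [this]
  nlinarith [mul_le_mul_of_nonneg_left hs (sq_nonneg g)]

end NoiseTails

/-! ### Elementary facts on the plant, and the confidence ellipsoid -/

section SetupFacts

variable {n m : ℕ} {S : Setup n m}

lemma Setup.Admissible.log_pos (hS : S.Admissible) {t : ℕ} (ht : 1 ≤ t) :
    0 < Real.log (t / S.δ) := by
  refine Real.log_pos ?_
  rw [one_lt_div hS.δ_pos]
  have : (1 : ℝ) ≤ t := by exact_mod_cast ht
  linarith [hS.δ_lt_one]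

lemma Setup.Admissible.lam_pos (hS : S.Admissible) {t : ℕ} (ht : 1 ≤ t) : 0 < S.lam t :=
  mul_pos hS.G_pos (hS.log_pos ht)

lemma Setup.Admissible.log_mono (hS : S.Admissible) {s t : ℕ} (hs : 1 ≤ s) (h : s ≤ t) :
    Real.log (s / S.δ) ≤ Real.log (t / S.δ) := by
  have h1 : (0 : ℝ) < s := by exact_mod_cast hs
  have h2 : (s : ℝ) ≤ t := by exact_mod_cast h
  have := hS.δ_pos
  exact Real.log_le_log (by positivity) (by gcongr)

lemma Setup.Admissible.lam_mono (hS : S.Admissible) {s t : ℕ} (hs : 1 ≤ s) (h : s ≤ t) :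
    S.lam s ≤ S.lam t :=
  mul_le_mul_of_nonneg_left (hS.log_mono hs h) hS.G_pos.le

lemma Setup.Admissible.κ_sq (hS : S.Admissible) :
    S.κ ^ 2 = 2 * S.ν / (S.α₀ * S.σw ^ 2) := by
  have := hS.ν_pos; have := hS.α₀_pos; have := hS.σw_pos
  exact Real.sq_sqrt (by positivity)

lemma Setup.Admissible.κ_pos (hS : S.Admissible) : 0 < S.κ := by
  have := hS.ν_pos; have := hS.α₀_pos; have := hS.σw_pos
  exact Real.sqrt_pos.2 (by positivity)

lemma V_eq_gram (X : Traj n m) (t : ℕ) : V S X t = gram (S.lam t) (z X) t := rfl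

lemma V_posDef (hS : S.Admissible) (X : Traj n m) {t : ℕ} (ht : 1 ≤ t) : (V S X t).PosDef :=
  gram_posDef (hS.lam_pos ht) _ _

lemma Theta_transpose_mulVec (x : Fin n → ℝ) (u : Fin m → ℝ) :
    S.Thetaᵀ *ᵥ (Sum.elim x u) = S.A *ᵥ x + S.B *ᵥ u := by
  rw [Setup.Theta, Matrix.transpose_fromRows, Matrix.transpose_transpose, Matrix.transpose_transpose,
    Matrix.fromCols_mulVec_sumElim]

lemma norm_transpose_eq {a b : ℕ} (M : Matrix (Fin a ⊕ Fin b) (Fin a) ℝ) : ‖Mᵀ‖ = ‖M‖ := by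
  rw [← Matrix.conjTranspose_eq_transpose_of_trivial, Matrix.l2_opNorm_conjTranspose]

lemma Setup.Admissible.sqNorm_Theta_le (hS : S.Admissible) (v : Fin n ⊕ Fin m → ℝ) :
    sqNorm (S.Thetaᵀ *ᵥ v) ≤ S.ϑ ^ 2 * sqNorm v := by
  refine (sqNorm_mulVec_le _ _).trans (mul_le_mul_of_nonneg_right ?_ (sqNorm_nonneg v))
  rw [norm_transpose_eq]
  exact pow_le_pow_left₀ (norm_nonneg _) hS.Theta_le 2

lemma sqNorm_sumElim {a b : ℕ} (x : Fin a → ℝ) (u : Fin b → ℝ) :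
    sqNorm (Sum.elim x u) = sqNorm x + sqNorm u := by
  simp [sqNorm_eq_sum]

lemma Setup.Admissible.sqNorm_B_le (hS : S.Admissible) (v : Fin m → ℝ) :
    sqNorm (S.B *ᵥ v) ≤ S.ϑ ^ 2 * sqNorm v := by
  have := hS.sqNorm_Theta_le (Sum.elim 0 v)
  rwa [Theta_transpose_mulVec, Matrix.mulVec_zero, zero_add, sqNorm_sumElim,
    show sqNorm (0 : Fin n → ℝ) = 0 by simp [sqNorm], zero_add] at this

lemma Setup.Admissible.sum_sqNorm_B_le (hS : S.Admissible) :
    ∑ i, sqNorm (S.B i) ≤ m * S.ϑ ^ 2 := by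
  have h1 : ∑ i, sqNorm (S.B i) = ∑ j, sqNorm (S.B *ᵥ Pi.single j 1) := by
    simp only [sqNorm_eq_sum, Matrix.mulVec_single_one, Matrix.col_apply]
    exact Finset.sum_comm
  rw [h1]
  calc ∑ j, sqNorm (S.B *ᵥ Pi.single j 1) ≤ ∑ _j : Fin m, S.ϑ ^ 2 :=
        Finset.sum_le_sum fun j _ => (hS.sqNorm_B_le _).trans (by simp [sqNorm])
    _ = m * S.ϑ ^ 2 := by simp

lemma trace_conj_eq_sum {a b : Type*} [Fintype a] [Fintype b] (N : Matrix a b ℝ)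
    (M : Matrix a a ℝ) : (Nᵀ * M * N).trace = ∑ j, quad M (Nᵀ j) := by
  rw [Matrix.trace]
  refine Finset.sum_congr rfl fun j _ => ?_
  rw [Matrix.diag_apply, Matrix.mul_assoc]
  rfl

/-- The noise sum of coordinate `j` along a trajectory. -/
noncomputable def trajNoise (X : Traj n m) (j : Fin n) (t : ℕ) : Fin n ⊕ Fin m → ℝ :=
  noiseSum (z X) (fun s => X.w s j) t

/-- Inserting the dynamics into the normal equations splits the error into a martingale part and a
bias due to the regularization. Working column by column lets the bound for scalar noise be used for
each coordinate. -/
lemma thetaHat_sub_theta_col (hS : S.Admissible) {X : Traj n m}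
    (hdyn : ∀ t, 1 ≤ t → X.x (t + 1) = S.A *ᵥ X.x t + S.B *ᵥ X.u t + X.w (t + 1)) {t : ℕ}
    (ht : 1 ≤ t) (j : Fin n) :
    (S.Theta - ThetaHat S X t)ᵀ j = -((V S X t)⁻¹ *ᵥ
      (trajNoise X j t + S.lam t • (S.Theta0 - S.Theta)ᵀ j)) := by
  have hu : IsUnit (V S X t).det := (V_posDef hS X ht).det_pos.ne'.isUnit
  have hx : ∀ s ∈ Finset.Ico 1 t, X.x (s + 1) j = z X s ⬝ᵥ S.Thetaᵀ j + X.w (s + 1) j := by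
    intro s hs
    have h1 := congrFun (Theta_transpose_mulVec (S := S) (X.x s) (X.u s)) j
    rw [hdyn s (Finset.mem_Ico.1 hs).1]
    simp only [Pi.add_apply] at h1 ⊢
    rw [← h1, dotProduct_comm]
    rfl
  have hcol : (∑ s ∈ Finset.Ico 1 t, Matrix.vecMulVec (z X s) (X.x (s + 1))
      + S.lam t • S.Theta0)ᵀ j = V S X t *ᵥ S.Thetaᵀ j +
        (trajNoise X j t + S.lam t • (S.Theta0 - S.Theta)ᵀ j) := by
    rw [V, Matrix.add_mulVec, Matrix.smul_mulVec, Matrix.one_mulVec, Matrix.sum_mulVec]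
    ext i
    simp only [Matrix.transpose_apply, Matrix.add_apply, Matrix.sum_apply, Matrix.vecMulVec_apply,
      Matrix.smul_apply, smul_eq_mul, Pi.add_apply, Pi.smul_apply, Finset.sum_apply,
      Matrix.vecMulVec_mulVec, trajNoise, noiseSum, Matrix.sub_apply,
      MulOpposite.smul_eq_mul_unop, MulOpposite.unop_op]
    rw [Finset.sum_congr rfl fun s hs => by rw [hx s hs, mul_add], Finset.sum_add_distrib]
    have : ∑ s ∈ Finset.Ico 1 t, z X s i * X.w (s + 1) j =
      ∑ s ∈ Finset.Ico 1 t, X.w (s + 1) j * z X s i :=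
      Finset.sum_congr rfl fun s _ => mul_comm _ _
    rw [this]
    ring
  have hhat : (ThetaHat S X t)ᵀ j = (V S X t)⁻¹ *ᵥ (∑ s ∈ Finset.Ico 1 t,
      Matrix.vecMulVec (z X s) (X.x (s + 1)) + S.lam t • S.Theta0)ᵀ j := rfl
  have : (S.Theta - ThetaHat S X t)ᵀ j = S.Thetaᵀ j - (ThetaHat S X t)ᵀ j := rfl
  rw [this, hhat, hcol, Matrix.mulVec_add, Matrix.mulVec_mulVec, Matrix.nonsing_inv_mul _ hu,
    Matrix.one_mulVec, sub_add_cancel_left]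

/-- The confidence ellipsoid follows from the bounds for the noise sums. -/
lemma trace_conf_le (hS : S.Admissible) {X : Traj n m}
    (hdyn : ∀ t, 1 ≤ t → X.x (t + 1) = S.A *ᵥ X.x t + S.B *ᵥ X.u t + X.w (t + 1)) {t : ℕ}
    (ht : 1 ≤ t) {l : ℝ}
    (h : ∀ j, quad (V S X t)⁻¹ (trajNoise X j t) ≤ 2 * S.σ ^ 2 * l) :
    ((S.Theta - ThetaHat S X t)ᵀ * V S X t * (S.Theta - ThetaHat S X t)).trace ≤
      (S.σ * √(2 * n * l) + √(S.lam t) * S.ε) ^ 2 := by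
  have hV := V_posDef hS X ht
  have hVi := hV.inv.posSemidef
  have hlam := hS.lam_pos ht
  set p : Fin n → ℝ := fun j => quad (V S X t)⁻¹ (trajNoise X j t) with hp
  set q : Fin n → ℝ := fun j => quad (V S X t)⁻¹ (S.lam t • (S.Theta0 - S.Theta)ᵀ j) with hq
  have hp0 : ∀ j, 0 ≤ p j := fun j => quad_nonneg hVi _
  have hq0 : ∀ j, 0 ≤ q j := fun j => quad_nonneg hVi _
  have h1 : ((S.Theta - ThetaHat S X t)ᵀ * V S X t * (S.Theta - ThetaHat S X t)).trace ≤
      ∑ j, (√(p j) + √(q j)) ^ 2 := by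
    rw [trace_conj_eq_sum]
    refine Finset.sum_le_sum fun j _ => ?_
    rw [thetaHat_sub_theta_col hS hdyn ht j, ← neg_one_smul ℝ, quad_smul_vec, quad_inv hV]
    have h2 := sqrt_quad_add_le hVi (trajNoise X j t) (S.lam t • (S.Theta0 - S.Theta)ᵀ j)
    have h3 := quad_nonneg hVi (trajNoise X j t + S.lam t • (S.Theta0 - S.Theta)ᵀ j)
    rw [neg_one_sq, one_mul]
    calc _ = √(quad (V S X t)⁻¹ (trajNoise X j t + S.lam t • (S.Theta0 - S.Theta)ᵀ j)) ^ 2 :=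
          (Real.sq_sqrt h3).symm
      _ ≤ _ := pow_le_pow_left₀ (Real.sqrt_nonneg _) h2 2
  have hpsum : ∑ j, p j ≤ S.σ ^ 2 * (2 * n * l) := by
    calc ∑ j, p j ≤ ∑ _j : Fin n, 2 * S.σ ^ 2 * l := Finset.sum_le_sum fun j _ => h j
      _ = _ := by simp; ring
  have hqsum : ∑ j, q j ≤ S.lam t * S.ε ^ 2 := by
    have h4 : ∀ j, q j ≤ S.lam t * quad 1 ((S.Theta - S.Theta0)ᵀ j) := by
      intro j
      rw [hq]
      simp only [quad_smul_vec, quad_one]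
      have h5 := quad_inv_le_of_smul_le hV hlam (fun v => by
        rw [V, quad_add, quad_smul, quad_one]
        linarith [quad_nonneg (posSemidef_sum_vecMulVec (z X) (Finset.Ico 1 t)) v])
        ((S.Theta0 - S.Theta)ᵀ j)
      have h6 : sqNorm ((S.Theta0 - S.Theta)ᵀ j) = sqNorm ((S.Theta - S.Theta0)ᵀ j) := by
        have : (S.Theta0 - S.Theta)ᵀ j = (-1 : ℝ) • (S.Theta - S.Theta0)ᵀ j := by
          ext i; simp
        rw [this, sqNorm_smul]; ring
      rw [h6, le_div_iff₀ hlam] at h5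
      nlinarith
    have h7 := hS.Theta0_close
    have h8 := trace_conj_eq_sum (S.Theta - S.Theta0) 1
    rw [Matrix.mul_one] at h8
    rw [h8] at h7
    calc ∑ j, q j ≤ ∑ j, S.lam t * quad 1 ((S.Theta - S.Theta0)ᵀ j) :=
          Finset.sum_le_sum fun j _ => h4 j
      _ = S.lam t * ∑ j, quad 1 ((S.Theta - S.Theta0)ᵀ j) := by rw [Finset.mul_sum]
      _ ≤ _ := mul_le_mul_of_nonneg_left h7 hlam.le
  have hcs : ∑ j, √(p j) * √(q j) ≤ √(∑ j, p j) * √(∑ j, q j) := by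
    have := Real.sum_mul_le_sqrt_mul_sqrt Finset.univ (fun j => √(p j)) (fun j => √(q j))
    simpa only [Real.sq_sqrt (hp0 _), Real.sq_sqrt (hq0 _)] using this
  have hP0 : 0 ≤ ∑ j, p j := Finset.sum_nonneg fun j _ => hp0 j
  have hQ0 : 0 ≤ ∑ j, q j := Finset.sum_nonneg fun j _ => hq0 j
  -- Minkowski's inequality in `ℓ²` keeps the martingale part and the bias in separate roots, as in
  -- the definition of `r`.
  have hmink : ∑ j, (√(p j) + √(q j)) ^ 2 ≤ (√(∑ j, p j) + √(∑ j, q j)) ^ 2 := by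
    have : ∑ j, (√(p j) + √(q j)) ^ 2 = ∑ j, p j + 2 * ∑ j, √(p j) * √(q j) + ∑ j, q j := by
      rw [Finset.mul_sum, ← Finset.sum_add_distrib, ← Finset.sum_add_distrib]
      refine Finset.sum_congr rfl fun j _ => ?_
      rw [add_sq, Real.sq_sqrt (hp0 j), Real.sq_sqrt (hq0 j)]; ring
    rw [this, add_sq, Real.sq_sqrt hP0, Real.sq_sqrt hQ0]
    linarith
  refine h1.trans (hmink.trans (pow_le_pow_left₀ (by positivity) ?_ 2))
  refine add_le_add ?_ ?_
  · calc √(∑ j, p j) ≤ √(S.σ ^ 2 * (2 * n * l)) := Real.sqrt_le_sqrt hpsum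
      _ = _ := by rw [Real.sqrt_mul (sq_nonneg _), Real.sqrt_sq hS.σ_pos.le]
  · calc √(∑ j, q j) ≤ √(S.lam t * S.ε ^ 2) := Real.sqrt_le_sqrt hqsum
      _ = _ := by rw [Real.sqrt_mul hlam.le, Real.sqrt_sq hS.ε_nonneg]

/-- Comparison of regularizations that differ by a factor of at most two. -/
lemma det_ratio_gram_le {ι : Type*} [Fintype ι] [DecidableEq ι] {c c' : ℝ} (hc : 0 < c)
    (hcc : c ≤ c') (hcc' : c' ≤ 2 * c) (z : ℕ → ι → ℝ) (t : ℕ) :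
    (gram c z t).det / c ^ Fintype.card ι ≤
      ((gram c' z t).det / c' ^ Fintype.card ι) ^ 2 := by
  obtain ⟨d, hd, hdet⟩ := det_smul_one_add (posSemidef_sum_vecMulVec z (Finset.Ico 1 t))
  have hc' : 0 < c' := hc.trans_le hcc
  have h1 : ∀ e : ℝ, 0 < e → (gram e z t).det / e ^ Fintype.card ι = ∏ i, (1 + d i / e) := by
    intro e he
    rw [gram, hdet, ← Finset.card_univ, ← Finset.prod_const, ← Finset.prod_div_distrib]
    refine Finset.prod_congr rfl fun i _ => ?_
    field_simp
  rw [h1 c hc, h1 c' hc', ← Finset.prod_pow]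
  refine Finset.prod_le_prod (fun i _ => by have := hd i; positivity) fun i _ => ?_
  -- Then `1 + d/c ≤ 1 + 2 d/c' ≤ (1 + d/c')²` in each factor.
  have h2 : d i / c ≤ 2 * (d i / c') := by
    rw [← mul_div_assoc, div_le_div_iff₀ hc hc']
    nlinarith [hd i]
  nlinarith [sq_nonneg (d i / c')]

lemma one_le_det_ratio_gram {ι : Type*} [Fintype ι] [DecidableEq ι] {c : ℝ} (hc : 0 < c)
    (z : ℕ → ι → ℝ) (t : ℕ) : 1 ≤ (gram c z t).det / c ^ Fintype.card ι := by
  obtain ⟨d, hd, hdet⟩ := det_smul_one_add (posSemidef_sum_vecMulVec z (Finset.Ico 1 t))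
  rw [gram, hdet, ← Finset.card_univ, ← Finset.prod_const, ← Finset.prod_div_distrib]
  refine one_le_prod_of_one_le _ fun i => ?_
  rw [le_div_iff₀ hc]; linarith [hd i]

lemma det_lam_smul (t : ℕ) : (S.lam t • (1 : Matrix (Fin n ⊕ Fin m) (Fin n ⊕ Fin m) ℝ)).det =
    S.lam t ^ Fintype.card (Fin n ⊕ Fin m) := by
  rw [Matrix.det_smul, Matrix.det_one, mul_one]

/-- The martingale bound is available for a fixed regularization `c` only. Passing from `c` to `λ_t
∈ [c, 2c]` at most doubles the logarithm of the determinant ratio, and `r` has room for this, since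
it contains that logarithm with twice the weight of the martingale bound. The level `δ / n` leaves a
union over the `n` coordinates. -/
lemma trace_conf_le_r (hn : 0 < n) (hS : S.Admissible) {X : Traj n m}
    (hdyn : ∀ t, 1 ≤ t → X.x (t + 1) = S.A *ᵥ X.x t + S.B *ᵥ X.u t + X.w (t + 1)) {t : ℕ}
    (ht : 1 ≤ t) {c : ℝ} (hc : 0 < c) (hcl : c ≤ S.lam t) (hlc : S.lam t ≤ 2 * c)
    (h : ∀ j, quad (gram c (z X) t)⁻¹ (trajNoise X j t) ≤
      S.σ ^ 2 * (Real.log ((gram c (z X) t).det / c ^ Fintype.card (Fin n ⊕ Fin m))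
        + 2 * Real.log (1 / (S.δ / n)))) :
    ((S.Theta - ThetaHat S X t)ᵀ * V S X t * (S.Theta - ThetaHat S X t)).trace ≤ r S X t := by
  have hδ := hS.δ_pos
  have hn' : (1 : ℝ) ≤ n := by exact_mod_cast hn
  have hlam := hS.lam_pos ht
  set ρ := (V S X t).det / S.lam t ^ Fintype.card (Fin n ⊕ Fin m) with hρ
  have hρ1 : 1 ≤ ρ := one_le_det_ratio_gram hlam (z X) t
  have hl : Real.log (n * (V S X t).det / (S.δ * (S.lam t • (1 : Matrix (Fin n ⊕ Fin m)
      (Fin n ⊕ Fin m) ℝ)).det)) = Real.log (1 / (S.δ / n)) + Real.log ρ := by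
    rw [det_lam_smul, ← Real.log_mul (by positivity) (by positivity), hρ]
    congr 1
    field_simp
  have hl1 : 0 ≤ Real.log (1 / (S.δ / n)) := Real.log_nonneg (by
    rw [one_div_div, le_div_iff₀ hδ]; nlinarith [hS.δ_lt_one])
  have hl2 : 0 ≤ Real.log ρ := Real.log_nonneg hρ1
  rw [r, hl]
  refine trace_conf_le hS hdyn ht fun j => ?_
  have h1 : quad (V S X t)⁻¹ (trajNoise X j t) ≤ quad (gram c (z X) t)⁻¹ (trajNoise X j t) := by
    have := quad_inv_le_of_le (gram_posDef hc (z X) t) (V_posDef hS X ht) (c := 1) (fun v => by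
      rw [V_eq_gram, gram, gram, one_mul, quad_add, quad_add, quad_smul, quad_smul, quad_one]
      nlinarith [sqNorm_nonneg v]) (trajNoise X j t)
    rwa [one_mul] at this
  refine h1.trans ((h j).trans ?_)
  have h2 : Real.log ((gram c (z X) t).det / c ^ Fintype.card (Fin n ⊕ Fin m)) ≤
      2 * Real.log ρ := by
    have h3 := det_ratio_gram_le hc hcl hlc (z X) t
    have h4 := Real.log_le_log (lt_of_lt_of_le one_pos (one_le_det_ratio_gram hc (z X) t)) h3
    rwa [Real.log_pow] at h4
  have := sq_nonneg S.σ
  nlinarith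

end SetupFacts

/-! ### Probability of the good event -/

section FailureProbability

variable {n m : ℕ} {S : Setup n m}

lemma Setup.Admissible.etaVar_toNNReal_le (hS : S.Admissible) {t : ℕ} (ht : 1 ≤ t) :
    ((S.etaVar t).toNNReal : ℝ) ≤ 2 * S.σ ^ 2 * S.κ ^ 2 := by
  have ht' : (0 : ℝ) < t := by exact_mod_cast ht
  have h1 : S.etaVar t ≤ 2 * S.σ ^ 2 * S.κ ^ 2 := by
    rw [Setup.etaVar, div_le_iff₀ (Real.sqrt_pos.2 ht')]
    exact mul_le_mul_of_nonneg_left (hS.φ_bound t ht) (by positivity)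
  rw [Real.coe_toNNReal']
  exact max_le h1 (by positivity)

lemma exp_neg_two_log_div {δ : ℝ} (hδ : 0 < δ) {t : ℕ} (ht : 1 ≤ t) :
    Real.exp (-(2 * Real.log (t / δ))) = δ ^ 2 / (t : ℝ) ^ 2 := by
  have ht' : (0 : ℝ) < t := by exact_mod_cast ht
  have : -(2 * Real.log (t / δ)) = Real.log (δ ^ 2 / (t : ℝ) ^ 2) := by
    rw [← div_pow, Real.log_pow, ← inv_div, Real.log_inv]; push_cast; ring
  rw [this, Real.exp_log (by positivity)]

lemma sum_inv_sq_le (T : ℕ) : ∑ t ∈ Finset.Icc 1 T, 1 / (t : ℝ) ^ 2 ≤ 2 := by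
  have : ∀ T : ℕ, ∑ t ∈ Finset.Icc 1 (T + 1), 1 / (t : ℝ) ^ 2 ≤ 2 - 1 / ((T : ℝ) + 1) := by
    intro T
    induction T with
    | zero => simp; norm_num
    | succ T ih =>
      rw [Finset.sum_Icc_succ_top (by omega)]
      have h1 : 1 / ((T + 1 + 1 : ℕ) : ℝ) ^ 2 ≤ 1 / ((T : ℝ) + 1) - 1 / ((T : ℝ) + 1 + 1) := by
        push_cast
        rw [div_sub_div _ _ (by positivity) (by positivity), div_le_div_iff₀ (by positivity)
          (by positivity)]
        nlinarith [(Nat.cast_nonneg T : (0 : ℝ) ≤ T)]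
      push_cast at h1 ⊢
      linarith
  rcases T with _ | T
  · simp
  · refine (this T).trans ?_
    have : 0 ≤ 1 / ((T : ℝ) + 1) := by positivity
    linarith

variable {Ω : Type u} [mΩ : MeasurableSpace Ω] {Pr : Measure Ω} [IsProbabilityMeasure Pr]
  {X : Ω → Traj n m}

/-- The good event fails with probability at most a multiple of `δ`. -/
lemma measure_not_good_le (hn : 0 < n) (hS : S.Admissible) (hX : StochasticModel S Pr X)
    (hdyn : ∀ᵐ ω ∂Pr, ∀ t, 1 ≤ t →
      (X ω).x (t + 1) = S.A *ᵥ (X ω).x t + S.B *ᵥ (X ω).u t + (X ω).w (t + 1))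
    {T : ℕ} (hT : 1 ≤ T) :
    Pr {ω | ¬ Good S (X ω) T} ≤ ENNReal.ofReal (failProb S.δ T) := by
  obtain ⟨F, hx, hu, hη, hw, -, -, hsub, hlaw, -, -⟩ := hX
  have hδ := hS.δ_pos
  have hσ := hS.σ_pos
  have hκ := hS.κ_pos
  have hn' : (0 : ℝ) < n := by exact_mod_cast hn
  have hL : 0 < Real.log (1 / S.δ) := by simpa using hS.log_pos (le_refl 1)
  have hLT := hS.log_pos hT
  have hLL : Real.log (1 / S.δ) ≤ Real.log (T / S.δ) := by simpa using hS.log_mono (le_refl 1) hT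
  have hlam1 : S.lam 1 = S.G * Real.log (1 / S.δ) := by simp [Setup.lam]
  have hlam1_pos := hS.lam_pos (le_refl 1)
  -- The levels `2 ^ k * λ_1` with `k ≤ N` form a grid such that every `λ_s` with `s ≤ T` lies
  -- within a factor of two above one of them.
  set N := ⌊Real.logb 2 (Real.log (T / S.δ) / Real.log (1 / S.δ))⌋₊ with hN
  have hlogb : 0 ≤ Real.logb 2 (Real.log (T / S.δ) / Real.log (1 / S.δ)) :=
    Real.logb_nonneg (by norm_num) (by rwa [one_le_div hL])
  have hwm : ∀ t, 1 ≤ t → ∀ j, Measurable[F (t + 1)] fun ω => (X ω).w (t + 1) j := fun t ht j =>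
    (measurable_pi_apply j).comp (hw t ht)
  -- the events
  set E₁ : ℕ → Fin n → Set Ω := fun k j => {ω | ∃ t, 1 ≤ t ∧ t ≤ T ∧
      S.σ ^ 2 * (Real.log ((gram (2 ^ k * S.lam 1) (fun s => z (X ω) s) t).det /
        (2 ^ k * S.lam 1) ^ Fintype.card (Fin n ⊕ Fin m)) + 2 * Real.log (1 / (S.δ / n))) <
      quad (gram (2 ^ k * S.lam 1) (fun s => z (X ω) s) t)⁻¹
        (noiseSum (fun s => z (X ω) s) (fun s => (X ω).w s j) t)} with hE₁
  set E₂ : ℕ → Set Ω := fun s => {ω | 5 * (2 * S.σ ^ 2 * (n + m * S.κ ^ 2 * S.ϑ ^ 2)) *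
      Real.log (s / S.δ) < ∑ i, (S.B i ⬝ᵥ (X ω).η s + (X ω).w (s + 1) i) ^ 2} with hE₂
  set E₃ : ℕ → Set Ω := fun s => {ω | 5 * (2 * S.κ ^ 2 * S.σ ^ 2 * m) *
      Real.log (s / S.δ) < ∑ i, ((X ω).η s i) ^ 2} with hE₃
  have h1 : ∀ k j, Pr (E₁ k j) ≤ ENNReal.ofReal (S.δ / n) := by
    intro k j
    refine measure_selfNormalized_le F (z := fun s ω => z (X ω) s) (w := fun s ω => (X ω).w s j)
      ?_ (fun t ht => hwm t ht j) hσ (fun t ht g => hsub t ht g j) (by positivity) (by positivity) T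
    intro t ht i
    rcases i with i | i
    · exact (measurable_pi_apply i).comp (hx t ht)
    · exact (measurable_pi_apply i).comp (hu t ht)
  have h2 : ∀ s, 1 ≤ s → Pr (E₂ s) ≤ ENNReal.ofReal (9 / 4 * (S.δ ^ 2 / (s : ℝ) ^ 2)) := by
    intro s hs
    rw [← exp_neg_two_log_div hδ hs]
    have hη' := (hη s hs).mono (F.le s) le_rfl
    have hw' := fun i => (hwm s hs i).mono (F.le _) le_rfl
    have hBη : ∀ i, Measurable fun ω => S.B i ⬝ᵥ (X ω).η s := fun i => by
      have hb : Measurable fun x : Fin m → ℝ => S.B i ⬝ᵥ x := by unfold dotProduct; fun_prop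
      exact hb.comp hη'
    -- Coordinate `i` of the disturbance has variance proxy `σ² + 2σ²κ² |B_i|²`: the noise and the
    -- `i`-th row of `B` acting on the Gaussian perturbation. The sum over `i` is controlled by `∑
    -- |B_i|² ≤ m ϑ²`.
    refine measure_sum_sq_gt_le (fun i => (hBη i).add (hw' i))
      (s := fun i => √(S.σ ^ 2 + 2 * S.σ ^ 2 * S.κ ^ 2 * sqNorm (S.B i)))
      (fun i => Real.sqrt_pos.2 (by have := sqNorm_nonneg (S.B i); positivity)) (fun i => ?_) ?_
      (hS.log_pos hs).le
    · refine subGaussianLaw_map_add F s (hη s hs) (hlaw s hs) (hw' i) (fun g => hsub s hs g i) _ ?_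
      rw [Real.sq_sqrt (by have := sqNorm_nonneg (S.B i); positivity)]
      have := mul_le_mul_of_nonneg_right (hS.etaVar_toNNReal_le hs) (sqNorm_nonneg (S.B i))
      linarith
    · have h3 : ∀ i, √(S.σ ^ 2 + 2 * S.σ ^ 2 * S.κ ^ 2 * sqNorm (S.B i)) ^ 2 =
          S.σ ^ 2 + 2 * S.σ ^ 2 * S.κ ^ 2 * sqNorm (S.B i) := fun i =>
        Real.sq_sqrt (by have := sqNorm_nonneg (S.B i); positivity)
      simp only [h3, Finset.sum_add_distrib, ← Finset.mul_sum, Finset.sum_const, Finset.card_univ,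
        Fintype.card_fin, nsmul_eq_mul]
      have h4 := mul_le_mul_of_nonneg_left hS.sum_sqNorm_B_le
        (show 0 ≤ 2 * S.σ ^ 2 * S.κ ^ 2 by positivity)
      have h5 : 0 ≤ (n : ℝ) * S.σ ^ 2 := by positivity
      nlinarith
  have h3 : ∀ s, 1 ≤ s → Pr (E₃ s) ≤ ENNReal.ofReal (9 / 4 * (S.δ ^ 2 / (s : ℝ) ^ 2)) := by
    intro s hs
    rw [← exp_neg_two_log_div hδ hs]
    have hη' := (hη s hs).mono (F.le s) le_rfl
    refine measure_sum_sq_gt_le (fun i => (measurable_pi_apply i).comp hη')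
      (s := fun _ => √(2 * S.σ ^ 2 * S.κ ^ 2)) (fun i => Real.sqrt_pos.2 (by positivity))
      (fun i => ?_) ?_ (hS.log_pos hs).le
    · refine subGaussianLaw_map_coord hη' (hlaw s hs) i ?_
      rw [Real.sq_sqrt (by positivity)]
      exact hS.etaVar_toNNReal_le hs
    · rw [Finset.sum_const, Finset.card_univ, Fintype.card_fin, Real.sq_sqrt (by positivity),
        nsmul_eq_mul]
      exact le_of_eq (by ring)
  have hincl : {ω | ¬ Good S (X ω) T} ⊆
      {ω | ¬ ∀ t, 1 ≤ t →
        (X ω).x (t + 1) = S.A *ᵥ (X ω).x t + S.B *ᵥ (X ω).u t + (X ω).w (t + 1)} ∪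
      ((⋃ k ∈ Finset.range (N + 1), ⋃ j ∈ (Finset.univ : Finset (Fin n)), E₁ k j) ∪
        ⋃ s ∈ Finset.Icc 1 T, (E₂ s ∪ E₃ s)) := by
    intro ω hω
    by_contra hcon
    simp only [Set.mem_union, Set.mem_iUnion, not_or, not_exists, Set.mem_ofPred_eq, not_not,
      Finset.mem_range, Finset.mem_Icc, Finset.mem_univ, true_imp_iff] at hcon
    obtain ⟨hd, hc1, hc2⟩ := hcon
    refine hω fun s hs hsT => ⟨?_, ?_, ?_⟩
    · have hl1 : S.lam 1 ≤ S.lam s := hS.lam_mono le_rfl hs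
      have hge : 1 ≤ S.lam s / S.lam 1 := (one_le_div hlam1_pos).2 hl1
      obtain ⟨k, hk1, hk2⟩ := exists_nat_pow_near hge one_lt_two
      rw [le_div_iff₀ hlam1_pos] at hk1
      rw [div_lt_iff₀ hlam1_pos] at hk2
      have hkN : k < N + 1 := by
        rw [Nat.lt_succ_iff]
        refine Nat.le_floor ?_
        rw [Real.le_logb_iff_rpow_le (by norm_num) (by positivity), Real.rpow_natCast,
          le_div_iff₀ hL]
        have h4 : S.lam s ≤ S.lam T := hS.lam_mono hs hsT
        have h5 : 2 ^ k * S.lam 1 ≤ S.lam T := hk1.trans h4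
        rw [hlam1, Setup.lam] at h5
        have hG := hS.G_pos
        refine le_of_mul_le_mul_left ?_ hG
        linarith
      refine trace_conf_le_r hn hS hd hs (c := 2 ^ k * S.lam 1) (by positivity) hk1
        (by rw [pow_succ] at hk2; linarith) fun j => ?_
      by_contra hlt
      exact hc1 k hkN j ⟨s, hs, hsT, not_le.1 hlt⟩
    · have h4 := (hc2 s ⟨hs, hsT⟩).1
      by_contra hlt
      refine h4 ?_
      rw [not_le, sqNorm_eq_sum] at hlt
      refine lt_of_le_of_lt (le_of_eq ?_) hlt
      ring
    · have h4 := (hc2 s ⟨hs, hsT⟩).2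
      by_contra hlt
      refine h4 ?_
      rw [not_le, sqNorm_eq_sum] at hlt
      refine lt_of_le_of_lt (le_of_eq ?_) hlt
      ring
  refine (measure_mono hincl).trans ((measure_union_le _ _).trans ?_)
  have h0 : Pr {ω | ¬ ∀ t, 1 ≤ t →
      (X ω).x (t + 1) = S.A *ᵥ (X ω).x t + S.B *ᵥ (X ω).u t + (X ω).w (t + 1)} = 0 := hdyn
  rw [h0, zero_add]
  refine (measure_union_le _ _).trans ?_
  -- The budget: the grid uses at most `N + 1` times `δ`, and the two families of tails use at most
  -- `(9/2) δ² ∑ 1/s² ≤ 9 δ²`, well below the remaining `19 δ`.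
  have hfail : failProb S.δ T = (1 + Real.logb 2 (Real.log (T / S.δ) / Real.log (1 / S.δ))) * S.δ
      + 19 * S.δ := by rw [failProb]; ring
  rw [hfail, ENNReal.ofReal_add (by positivity) (by positivity)]
  refine add_le_add ?_ ?_
  · calc Pr (⋃ k ∈ Finset.range (N + 1), ⋃ j ∈ (Finset.univ : Finset (Fin n)), E₁ k j)
        ≤ ∑ k ∈ Finset.range (N + 1), ∑ j : Fin n, Pr (E₁ k j) :=
          (measure_biUnion_finset_le _ _).trans
            (Finset.sum_le_sum fun k _ => measure_biUnion_finset_le _ _)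
      _ ≤ ∑ k ∈ Finset.range (N + 1), ∑ j : Fin n, ENNReal.ofReal (S.δ / n) := by
          gcongr with k _ j _; exact h1 k j
      _ = ENNReal.ofReal (((N + 1 : ℕ) : ℝ) * S.δ) := by
          simp only [Finset.sum_const, Finset.card_univ, Fintype.card_fin, Finset.card_range]
          rw [← ENNReal.ofReal_nsmul, ← ENNReal.ofReal_nsmul, nsmul_eq_mul, nsmul_eq_mul,
            mul_div_cancel₀ _ hn'.ne']
      _ ≤ _ := by
          refine ENNReal.ofReal_le_ofReal (mul_le_mul_of_nonneg_right ?_ hδ.le)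
          push_cast
          linarith [Nat.floor_le hlogb]
  · calc Pr (⋃ s ∈ Finset.Icc 1 T, (E₂ s ∪ E₃ s))
        ≤ ∑ s ∈ Finset.Icc 1 T, Pr (E₂ s ∪ E₃ s) := measure_biUnion_finset_le _ _
      _ ≤ ∑ s ∈ Finset.Icc 1 T, ENNReal.ofReal (9 / 2 * S.δ ^ 2 * (1 / (s : ℝ) ^ 2)) := by
          refine Finset.sum_le_sum fun s hs => ?_
          have hs1 := (Finset.mem_Icc.1 hs).1
          refine (measure_union_le _ _).trans ((add_le_add (h2 s hs1) (h3 s hs1)).trans ?_)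
          rw [← ENNReal.ofReal_add (by positivity) (by positivity)]
          refine ENNReal.ofReal_le_ofReal (le_of_eq ?_)
          ring
      _ = ENNReal.ofReal (9 / 2 * S.δ ^ 2 * ∑ s ∈ Finset.Icc 1 T, 1 / (s : ℝ) ^ 2) := by
          rw [← ENNReal.ofReal_sum_of_nonneg fun s _ => by positivity, Finset.mul_sum]
      _ ≤ _ := by
          refine ENNReal.ofReal_le_ofReal ?_
          have h4 := mul_le_mul_of_nonneg_left (sum_inv_sq_le T)
            (show 0 ≤ 9 / 2 * S.δ ^ 2 by positivity)
          nlinarith [hS.δ_lt_one]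

end FailureProbability

/-! ### Consistent estimates, the Riccati equation and the relaxed dual program -/

section Programs

variable {n m : ℕ} {S : Setup n m}

/-- The estimate `Th` is consistent with the plant: replacing one by the other in a quadratic form
costs at most the relaxation term of the programs. -/
def Consistent (S : Setup n m) (Th : Matrix (Fin n ⊕ Fin m) (Fin n) ℝ)
    (V : Matrix (Fin n ⊕ Fin m) (Fin n ⊕ Fin m) ℝ) (μ : ℝ) : Prop :=
  ∀ P : Matrix (Fin n) (Fin n) ℝ, P.PosSemidef → ∀ v,
    |quad P (S.Thetaᵀ *ᵥ v) - quad P (Thᵀ *ᵥ v)| ≤ μ * P.trace * quad V⁻¹ v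

/-- Write `Thᵀ v = a + d` with `a = Θᵀ v` and `q = quad V⁻¹ v`. The ellipsoid gives `|d|² ≤ ρ q`,
while `|a|² ≤ ϑ² |v|² ≤ ϑ² ‖V‖ q`. The square of `d` and the cross term of `a` and `d` account for
the two summands of the relaxation parameter. -/
lemma consistent_of_trace_le (hS : S.Admissible) {Th : Matrix (Fin n ⊕ Fin m) (Fin n) ℝ}
    {V : Matrix (Fin n ⊕ Fin m) (Fin n ⊕ Fin m) ℝ} (hV : V.PosDef) {ρ : ℝ} (hρ : 0 ≤ ρ)
    (h : ((S.Theta - Th)ᵀ * V * (S.Theta - Th)).trace ≤ ρ) :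
    Consistent S Th V (ρ + 2 * S.ϑ * √ρ * √‖V‖) := by
  intro P hP v
  set q := quad V⁻¹ v with hq
  have hq0 : 0 ≤ q := quad_nonneg hV.inv.posSemidef v
  have htr : 0 ≤ P.trace := hP.trace_nonneg
  set a := S.Thetaᵀ *ᵥ v with ha
  set d := Thᵀ *ᵥ v - S.Thetaᵀ *ᵥ v with hd
  have hsum : Thᵀ *ᵥ v = a + d := by rw [hd, ha]; abel
  have hd_sq : sqNorm d ≤ ρ * q := by
    have h1 : sqNorm d = ∑ j, ((S.Theta - Th)ᵀ j ⬝ᵥ v) ^ 2 := by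
      rw [sqNorm_eq_sum]
      refine Finset.sum_congr rfl fun j _ => ?_
      have : d j = -((S.Theta - Th)ᵀ j ⬝ᵥ v) := by
        rw [hd, ← Matrix.sub_mulVec, ← neg_dotProduct, Matrix.mulVec]
        congr 1
        ext i; simp
      rw [this, neg_sq]
    rw [h1]
    calc ∑ j, ((S.Theta - Th)ᵀ j ⬝ᵥ v) ^ 2 ≤ ∑ j, quad V ((S.Theta - Th)ᵀ j) * q :=
          Finset.sum_le_sum fun j _ => dotProduct_sq_le_quad_inv hV _ _
      _ = ((S.Theta - Th)ᵀ * V * (S.Theta - Th)).trace * q := by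
          rw [← Finset.sum_mul, trace_conj_eq_sum]
      _ ≤ ρ * q := mul_le_mul_of_nonneg_right h hq0
  have hv_sq : sqNorm v ≤ ‖V‖ * q := by
    rcases (sqNorm_nonneg v).eq_or_lt with h0 | h0
    · rw [← h0]; positivity
    · have h1 := dotProduct_sq_le_quad_inv hV v v
      have h2 := quad_le_norm V v
      have h3 : sqNorm v * sqNorm v ≤ sqNorm v * (‖V‖ * q) := by
        calc sqNorm v * sqNorm v = (v ⬝ᵥ v) ^ 2 := by rw [sqNorm, sq]
          _ ≤ quad V v * q := h1
          _ ≤ ‖V‖ * sqNorm v * q := mul_le_mul_of_nonneg_right h2 hq0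
          _ = _ := by ring
      exact le_of_mul_le_mul_left h3 h0
  have ha_sq : sqNorm a ≤ S.ϑ ^ 2 * (‖V‖ * q) :=
    (hS.sqNorm_Theta_le v).trans (mul_le_mul_of_nonneg_left hv_sq (sq_nonneg _))
  have hcross : |a ⬝ᵥ (P *ᵥ d)| ≤ P.trace * (S.ϑ * √ρ * √‖V‖ * q) := by
    have hϑ := hS.ϑ_pos
    refine abs_le_of_sq_le_sq ?_ (by positivity)
    calc (a ⬝ᵥ (P *ᵥ d)) ^ 2 ≤ quad P a * quad P d := quad_cauchy hP a d
      _ ≤ (P.trace * sqNorm a) * (P.trace * sqNorm d) :=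
          mul_le_mul (quad_le_trace hP a) (quad_le_trace hP d) (quad_nonneg hP d)
            (mul_nonneg htr (sqNorm_nonneg a))
      _ ≤ (P.trace * (S.ϑ ^ 2 * (‖V‖ * q))) * (P.trace * (ρ * q)) := by
          gcongr
          exact mul_nonneg htr (sqNorm_nonneg d)
      _ = (P.trace * (S.ϑ * √ρ * √‖V‖ * q)) ^ 2 := by
          simp only [mul_pow, Real.sq_sqrt hρ, Real.sq_sqrt (norm_nonneg V)]; ring
  have hdd : quad P d ≤ P.trace * (ρ * q) :=
    (quad_le_trace hP d).trans (mul_le_mul_of_nonneg_left hd_sq htr)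
  have hdd0 := quad_nonneg hP d
  rw [hsum, quad_add_vec (transpose_eq_of_posSemidef hP)]
  rw [abs_le] at hcross ⊢
  constructor <;> nlinarith

lemma Setup.Admissible.Q_symm (hS : S.Admissible) : S.Qᵀ = S.Q := by
  have := transpose_eq_of_posSemidef hS.Q_lower
  rwa [Matrix.transpose_sub, Matrix.transpose_smul, Matrix.transpose_one, sub_left_inj] at this

lemma Setup.Admissible.R_symm (hS : S.Admissible) : S.Rᵀ = S.R := by
  have := transpose_eq_of_posSemidef hS.R_lower
  rwa [Matrix.transpose_sub, Matrix.transpose_smul, Matrix.transpose_one, sub_left_inj] at this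

lemma Setup.Admissible.le_quad_Q (hS : S.Admissible) (x : Fin n → ℝ) :
    S.α₀ * sqNorm x ≤ quad S.Q x := by
  have := quad_nonneg hS.Q_lower x
  rw [quad_sub, quad_smul, quad_one] at this
  linarith

lemma Setup.Admissible.le_quad_R (hS : S.Admissible) (x : Fin m → ℝ) :
    S.α₀ * sqNorm x ≤ quad S.R x := by
  have := quad_nonneg hS.R_lower x
  rw [quad_sub, quad_smul, quad_one] at this
  linarith

lemma Setup.Admissible.quad_Q_le (hS : S.Admissible) (x : Fin n → ℝ) :
    quad S.Q x ≤ S.α₁ * sqNorm x := by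
  have := quad_nonneg hS.Q_upper x
  rw [quad_sub, quad_smul, quad_one] at this
  linarith

lemma Setup.Admissible.quad_R_le (hS : S.Admissible) (x : Fin m → ℝ) :
    quad S.R x ≤ S.α₁ * sqNorm x := by
  have := quad_nonneg hS.R_upper x
  rw [quad_sub, quad_smul, quad_one] at this
  linarith

/-! ### The Riccati equation -/

/-- Completion of the square for the solution of the Riccati equation. -/
lemma Setup.Admissible.riccati_identity (hS : S.Admissible) :
    ∃ K : Matrix (Fin m) (Fin n) ℝ, ∃ M : Matrix (Fin m) (Fin m) ℝ, M.PosSemidef ∧ ∀ x u,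
      quad S.Q x + quad S.R u + quad S.Pstar (S.A *ᵥ x + S.B *ᵥ u) =
        quad S.Pstar x + quad M (u - K *ᵥ x) := by
  obtain ⟨hP, hR⟩ := hS.riccati
  set P := S.Pstar
  have hPt := transpose_eq_of_posSemidef hP
  set M := S.Bᵀ * P * S.B + S.R with hM
  have hRpd : S.R.PosDef := by
    have h1 : S.R = S.α₀ • (1 : Matrix (Fin m) (Fin m) ℝ) + (S.R - S.α₀ • 1) := by abel
    rw [h1]
    exact (Matrix.PosDef.one.smul hS.α₀_pos).add_posSemidef hS.R_lower
  have hMpd : M.PosDef := Matrix.PosDef.posSemidef_add (posSemidef_conj hP S.B) hRpd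
  have hMu : IsUnit M.det := hMpd.det_pos.ne'.isUnit
  refine ⟨-(M⁻¹ * (S.Bᵀ * P * S.A)), M, hMpd.posSemidef, fun x u => ?_⟩
  set g := (S.Bᵀ * P * S.A) *ᵥ x with hg
  have h1 : u - -(M⁻¹ * (S.Bᵀ * P * S.A)) *ᵥ x = u + M⁻¹ *ᵥ g := by
    rw [Matrix.neg_mulVec, sub_neg_eq_add, hg, Matrix.mulVec_mulVec]
  have h2 : quad M (u + M⁻¹ *ᵥ g) = quad M u + 2 * (u ⬝ᵥ g) + quad M⁻¹ g := by
    rw [quad_add_vec (transpose_eq_of_posSemidef hMpd.posSemidef), quad_inv hMpd,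
      Matrix.mulVec_mulVec, Matrix.mul_nonsing_inv _ hMu, Matrix.one_mulVec]
  have h3 : quad M u = quad P (S.B *ᵥ u) + quad S.R u := by
    rw [hM, quad_add, quad_conj]
  have h4 : quad P (S.A *ᵥ x + S.B *ᵥ u) = quad P (S.A *ᵥ x) + 2 * (u ⬝ᵥ g) + quad P (S.B *ᵥ u) := by
    rw [add_comm (S.A *ᵥ x), quad_add_vec hPt, hg]
    have : (S.B *ᵥ u) ⬝ᵥ (P *ᵥ (S.A *ᵥ x)) = u ⬝ᵥ ((S.Bᵀ * P * S.A) *ᵥ x) := by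
      rw [← Matrix.mulVec_mulVec, ← Matrix.mulVec_mulVec, Matrix.mulVec_transpose,
        dotProduct_comm u, ← Matrix.dotProduct_mulVec, dotProduct_comm]
    rw [this]; ring
  have h5 : quad P x = quad S.Q x + quad P (S.A *ᵥ x) - quad M⁻¹ g := by
    have h6 : S.Aᵀ * P * S.B * M⁻¹ * S.Bᵀ * P * S.A =
        (S.Bᵀ * P * S.A)ᵀ * M⁻¹ * (S.Bᵀ * P * S.A) := by
      simp only [Matrix.transpose_mul, Matrix.transpose_transpose, hPt, Matrix.mul_assoc]
    conv_lhs => rw [hR]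
    rw [h6, quad_sub, quad_add, quad_conj, quad_conj]
  rw [h1, h2, h3, h4, h5]; ring

lemma Setup.Admissible.le_quad_Pstar (hS : S.Admissible) (x : Fin n → ℝ) :
    S.α₀ * sqNorm x ≤ quad S.Pstar x := by
  obtain ⟨K, M, hM, h⟩ := hS.riccati_identity
  have h1 := h x (K *ᵥ x)
  rw [sub_self, show quad M 0 = 0 by simp [quad], add_zero] at h1
  have h2 := hS.le_quad_Q x
  have h3 := hS.le_quad_R (K *ᵥ x)
  have h4 := mul_nonneg hS.α₀_pos.le (sqNorm_nonneg (K *ᵥ x))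
  have h5 := quad_nonneg hS.riccati.1 (S.A *ᵥ x + S.B *ᵥ (K *ᵥ x))
  linarith

/-- Dynamic programming: the completed square in `riccati_identity` is nonnegative for every input.
-/
lemma Setup.Admissible.quad_Pstar_le (hS : S.Admissible) (x : Fin n → ℝ) (u : Fin m → ℝ) :
    quad S.Pstar x ≤ quad S.Q x + quad S.R u + quad S.Pstar (S.A *ᵥ x + S.B *ᵥ u) := by
  obtain ⟨K, M, hM, h⟩ := hS.riccati_identity
  rw [h x u]
  linarith [quad_nonneg hM (u - K *ᵥ x)]

lemma trace_mul_W (P : Matrix (Fin n) (Fin n) ℝ) : (Pᵀ * S.W).trace = S.σw ^ 2 * P.trace := by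
  rw [Setup.W, Matrix.mul_smul, Matrix.mul_one, Matrix.trace_smul, Matrix.trace_transpose,
    smul_eq_mul]

lemma Setup.Admissible.trace_Pstar_le (hS : S.Admissible) :
    S.Pstar.trace ≤ S.ν / S.σw ^ 2 := by
  have h := hS.Jstar_le
  rw [Setup.Jstar, trace_mul_W] at h
  rw [le_div_iff₀ (pow_pos hS.σw_pos 2)]; linarith

lemma Setup.Admissible.trace_Pstar_ge (hS : S.Admissible) : n * S.α₀ ≤ S.Pstar.trace := by
  have := trace_le_of_quad_le (M := S.α₀ • (1 : Matrix (Fin n) (Fin n) ℝ)) (N := S.Pstar) fun v => by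
    rw [quad_smul, quad_one]; exact hS.le_quad_Pstar v
  rw [Matrix.trace_smul, Matrix.trace_one, Fintype.card_fin, smul_eq_mul] at this
  linarith

/-- This follows from `n α₀ ≤ tr P_* ≤ ν / σw² = α₀ κ² / 2`. It makes `1 - 1/κ²` an admissible
contraction factor and the powers of `κ` in `(**)` large. -/
lemma Setup.Admissible.two_le_κ_sq (hn : 0 < n) (hS : S.Admissible) : 2 ≤ S.κ ^ 2 := by
  have h1 := hS.trace_Pstar_ge.trans hS.trace_Pstar_le
  have hn' : (1 : ℝ) ≤ n := by exact_mod_cast hn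
  have hα := hS.α₀_pos
  have hσ : 0 < S.σw ^ 2 := pow_pos hS.σw_pos 2
  rw [hS.κ_sq, le_div_iff₀ (by positivity)]
  rw [le_div_iff₀ hσ] at h1
  nlinarith [mul_pos hα hσ]

/-- A function that does not decrease along a contraction and is dominated by the contracted
potential is nonpositive. -/
lemma nonpos_of_le_comp {E : Type*} {f : E → E} {L D : E → ℝ} {ρ d : ℝ} (hρ0 : 0 ≤ ρ) (hρ : ρ < 1)
    (hL : ∀ x, L (f x) ≤ ρ * L x) (hD : ∀ x, D x ≤ D (f x)) (hd : 0 ≤ d)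
    (hDL : ∀ x, D x ≤ d * L x) (x : E) : D x ≤ 0 := by
  -- Along the orbit `D x ≤ D (f^[k] x) ≤ d ρ^k L x`, and the right-hand side tends to zero.
  have h1 : ∀ k : ℕ, D x ≤ D (f^[k] x) ∧ L (f^[k] x) ≤ ρ ^ k * L x := by
    intro k
    induction k with
    | zero => simp
    | succ k ih =>
      rw [Function.iterate_succ_apply']
      refine ⟨ih.1.trans (hD _), (hL _).trans ?_⟩
      rw [pow_succ', mul_assoc]
      exact mul_le_mul_of_nonneg_left ih.2 hρ0
  have h2 : Filter.Tendsto (fun k : ℕ => d * (ρ ^ k * L x)) Filter.atTop (nhds 0) := by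
    simpa using ((tendsto_pow_atTop_nhds_zero_of_lt_one hρ0 hρ).mul_const (L x)).const_mul d
  exact ge_of_tendsto' h2 fun k => (h1 k).1.trans ((hDL _).trans
    (mul_le_mul_of_nonneg_left (h1 k).2 hd))

/-! ### Duality -/

/-- The slack of the relaxed dual program. -/
noncomputable def dualSlack (S : Setup n m) (Th : Matrix (Fin n ⊕ Fin m) (Fin n) ℝ)
    (V : Matrix (Fin n ⊕ Fin m) (Fin n ⊕ Fin m) ℝ) (μ : ℝ) (P : Matrix (Fin n) (Fin n) ℝ) :
    Matrix (Fin n ⊕ Fin m) (Fin n ⊕ Fin m) ℝ :=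
  Matrix.fromBlocks (S.Q - P) 0 0 S.R + Th * P * Thᵀ - (μ * P.trace) • V⁻¹

lemma quad_fromBlocks_diag {a b : ℕ} (M : Matrix (Fin a) (Fin a) ℝ) (N : Matrix (Fin b) (Fin b) ℝ)
    (x : Fin a → ℝ) (u : Fin b → ℝ) :
    quad (Matrix.fromBlocks M 0 0 N) (Sum.elim x u) = quad M x + quad N u := by
  simp [quad, Matrix.fromBlocks_mulVec]

lemma quad_dualSlack (Th : Matrix (Fin n ⊕ Fin m) (Fin n) ℝ)
    (V : Matrix (Fin n ⊕ Fin m) (Fin n ⊕ Fin m) ℝ) (μ : ℝ) (P : Matrix (Fin n) (Fin n) ℝ)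
    (x : Fin n → ℝ) (u : Fin m → ℝ) :
    quad (dualSlack S Th V μ P) (Sum.elim x u) = quad S.Q x - quad P x + quad S.R u +
      quad P (Thᵀ *ᵥ Sum.elim x u) - μ * P.trace * quad V⁻¹ (Sum.elim x u) := by
  rw [dualSlack, quad_sub, quad_add, quad_smul, quad_conj', quad_fromBlocks_diag, quad_sub]

/-- The relaxation term in the dual constraint pays for replacing the estimate by the plant. What
remains is the dynamic programming inequality of the true plant, for every input. -/
lemma quad_le_of_dualFeasible {Th : Matrix (Fin n ⊕ Fin m) (Fin n) ℝ}
    {V : Matrix (Fin n ⊕ Fin m) (Fin n ⊕ Fin m) ℝ} {μ : ℝ} (hc : Consistent S Th V μ)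
    {P : Matrix (Fin n) (Fin n) ℝ} (hP : S.DualFeasible Th V μ P) (x : Fin n → ℝ) (u : Fin m → ℝ) :
    quad P x ≤ quad S.Q x + quad S.R u + quad P (S.A *ᵥ x + S.B *ᵥ u) := by
  have h1 : 0 ≤ quad (dualSlack S Th V μ P) (Sum.elim x u) := quad_nonneg hP.2 _
  rw [quad_dualSlack] at h1
  have h2 := (abs_le.1 (hc P hP.1 (Sum.elim x u))).1
  rw [Theta_transpose_mulVec] at h2
  linarith

/-- Every feasible point of the relaxed dual program is dominated by the Riccati solution. -/
lemma quad_le_quad_Pstar (hn : 0 < n) (hS : S.Admissible)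
    {Th : Matrix (Fin n ⊕ Fin m) (Fin n) ℝ}
    {V : Matrix (Fin n ⊕ Fin m) (Fin n ⊕ Fin m) ℝ} {μ : ℝ} (hc : Consistent S Th V μ)
    {P : Matrix (Fin n) (Fin n) ℝ} (hP : S.DualFeasible Th V μ P) (x : Fin n → ℝ) :
    quad P x ≤ quad S.Pstar x := by
  obtain ⟨K, M, hM, h⟩ := hS.riccati_identity
  have hα := hS.α₀_pos
  have hn' : (1 : ℝ) ≤ n := by exact_mod_cast hn
  have htr : S.α₀ ≤ S.Pstar.trace := le_trans (by nlinarith) hS.trace_Pstar_ge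
  have htr0 : 0 < S.Pstar.trace := hα.trans_le htr
  have h0 : ∀ x, quad S.Q x + quad S.R (K *ᵥ x) + quad S.Pstar (S.A *ᵥ x + S.B *ᵥ (K *ᵥ x)) =
      quad S.Pstar x := fun x => by
    rw [h x (K *ᵥ x), sub_self, show quad M 0 = 0 by simp [quad], add_zero]
  -- Iterate the optimal closed loop. Along it `P_*` drops by at least `α₀ |x|² ≥ (α₀ / tr P_*) quad
  -- P_* x`, and `P - P_*` does not decrease, since the stage costs cancel.
  have := nonpos_of_le_comp (f := fun x => S.A *ᵥ x + S.B *ᵥ (K *ᵥ x)) (L := quad S.Pstar)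
    (D := fun x => quad P x - quad S.Pstar x) (ρ := 1 - S.α₀ / S.Pstar.trace)
    (d := P.trace / S.α₀) (by rw [sub_nonneg, div_le_one htr0]; exact htr)
    (by have : 0 < S.α₀ / S.Pstar.trace := by positivity
        linarith)
    (fun x => by
      have h1 := h0 x
      have h2 := hS.le_quad_Q x
      have h3 := hS.le_quad_R (K *ᵥ x)
      have h4 := mul_nonneg hα.le (sqNorm_nonneg (K *ᵥ x))
      have h5 := quad_le_trace hS.riccati.1 x
      have h6 : S.α₀ / S.Pstar.trace * quad S.Pstar x ≤ S.α₀ * sqNorm x := by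
        rw [div_mul_eq_mul_div, div_le_iff₀ htr0]; nlinarith
      linarith)
    (fun x => by
      have h1 := h0 x
      have h2 := quad_le_of_dualFeasible hc hP x (K *ᵥ x)
      linarith)
    (div_nonneg hP.1.trace_nonneg hα.le)
    (fun x => by
      have h1 := quad_le_trace hP.1 x
      have h2 := hS.le_quad_Pstar x
      have h3 := quad_nonneg hS.riccati.1 x
      have h4 : P.trace * sqNorm x ≤ P.trace / S.α₀ * quad S.Pstar x := by
        rw [div_mul_eq_mul_div, le_div_iff₀ hα]; nlinarith [hP.1.trace_nonneg]
      linarith) x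
  simpa using this

lemma trace_le_of_dualFeasible (hn : 0 < n) (hS : S.Admissible)
    {Th : Matrix (Fin n ⊕ Fin m) (Fin n) ℝ}
    {V : Matrix (Fin n ⊕ Fin m) (Fin n ⊕ Fin m) ℝ} {μ : ℝ} (hc : Consistent S Th V μ)
    {P : Matrix (Fin n) (Fin n) ℝ} (hP : S.DualFeasible Th V μ P) :
    P.trace ≤ S.Pstar.trace :=
  trace_le_of_quad_le (quad_le_quad_Pstar hn hS hc hP)

lemma isClosed_posSemidef {ι : Type*} [Fintype ι] [DecidableEq ι] :
    IsClosed {M : Matrix ι ι ℝ | M.PosSemidef} := by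
  simp only [posSemidef_iff_quad, Set.ofPred_and, Set.ofPred_forall]
  refine (isClosed_eq (by fun_prop) (by fun_prop)).inter (isClosed_iInter fun v => ?_)
  exact isClosed_le continuous_const (by unfold quad; fun_prop)

lemma dualFeasible_zero (hS : S.Admissible) (Th : Matrix (Fin n ⊕ Fin m) (Fin n) ℝ)
    (V : Matrix (Fin n ⊕ Fin m) (Fin n ⊕ Fin m) ℝ) (μ : ℝ) : S.DualFeasible Th V μ 0 := by
  refine ⟨Matrix.PosSemidef.zero, posSemidef_iff_quad.2 ⟨?_, fun v => ?_⟩⟩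
  · simp [Matrix.fromBlocks_transpose, hS.Q_symm, hS.R_symm]
  · have h := quad_dualSlack (S := S) Th V μ 0 (v ∘ Sum.inl) (v ∘ Sum.inr)
    rw [Sum.elim_comp_inl_inr] at h
    change 0 ≤ quad (dualSlack S Th V μ 0) v
    rw [h]
    have h1 := hS.le_quad_Q (v ∘ Sum.inl)
    have h2 := hS.le_quad_R (v ∘ Sum.inr)
    have h3 := mul_nonneg hS.α₀_pos.le (sqNorm_nonneg (v ∘ Sum.inl))
    have h4 := mul_nonneg hS.α₀_pos.le (sqNorm_nonneg (v ∘ Sum.inr))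
    simp only [quad, Matrix.zero_mulVec, dotProduct_zero, Matrix.trace_zero, mul_zero, zero_mul] at *
    linarith

/-- Compactness: the feasible set is closed, contains `0`, and is bounded because each of its points
has trace at most `tr P_*`. -/
lemma exists_dualOptimal (hn : 0 < n) (hS : S.Admissible)
    {Th : Matrix (Fin n ⊕ Fin m) (Fin n) ℝ}
    {V : Matrix (Fin n ⊕ Fin m) (Fin n ⊕ Fin m) ℝ} {μ : ℝ} (hc : Consistent S Th V μ) :
    ∃ P, S.DualOptimal Th V μ P := by
  have hclosed : IsClosed {P | S.DualFeasible Th V μ P} := by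
    have h1 : Continuous fun P : Matrix (Fin n) (Fin n) ℝ =>
        Matrix.fromBlocks (S.Q - P) 0 0 S.R + Th * P * Thᵀ - (μ * P.trace) • V⁻¹ := by
      have : Continuous fun P : Matrix (Fin n) (Fin n) ℝ => Matrix.fromBlocks (S.Q - P) 0 0 S.R :=
        Continuous.matrix_fromBlocks (by fun_prop) continuous_const continuous_const continuous_const
      fun_prop
    exact isClosed_posSemidef.inter (isClosed_posSemidef.preimage h1)
  have hbdd : Bornology.IsBounded {P | S.DualFeasible Th V μ P} := by
    refine (Metric.isBounded_closedBall (x := 0) (r := S.Pstar.trace)).subset fun P hP => ?_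
    rw [mem_closedBall_zero_iff]
    refine norm_le_of_quad_le hP.1 (fun v => (quad_le_trace hP.1 v).trans ?_)
      hS.riccati.1.trace_nonneg
    exact mul_le_mul_of_nonneg_right (trace_le_of_dualFeasible hn hS hc hP) (sqNorm_nonneg v)
  have : ProperSpace (Matrix (Fin n) (Fin n) ℝ) := FiniteDimensional.proper ℝ _
  obtain ⟨P, hP, hmax⟩ := (Metric.isCompact_of_isClosed_isBounded hclosed hbdd).exists_isMaxOn
    ⟨0, dualFeasible_zero hS Th V μ⟩
    (f := fun P : Matrix (Fin n) (Fin n) ℝ => (Pᵀ * S.W).trace) (by fun_prop)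
  exact ⟨P, hP, fun P' hP' => hmax hP'⟩

end Programs

/-! ### Strong duality and complementary slackness of the relaxed programs -/

section Duality

variable {n m : ℕ} {S : Setup n m}

/-- The slack of the relaxed primal program. -/
noncomputable def primalSlack (S : Setup n m) (Th : Matrix (Fin n ⊕ Fin m) (Fin n) ℝ)
    (V : Matrix (Fin n ⊕ Fin m) (Fin n ⊕ Fin m) ℝ) (μ : ℝ)
    (Sig : Matrix (Fin n ⊕ Fin m) (Fin n ⊕ Fin m) ℝ) : Matrix (Fin n) (Fin n) ℝ :=
  Sig.toBlocks₁₁ - (Thᵀ * Sig * Th + S.W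
    - (μ * (Sigᵀ * V⁻¹).trace) • (1 : Matrix (Fin n) (Fin n) ℝ))

lemma trace_mul_fromBlocks_diag {a b : ℕ} (T : Matrix (Fin a ⊕ Fin b) (Fin a ⊕ Fin b) ℝ)
    (M : Matrix (Fin a) (Fin a) ℝ) (N : Matrix (Fin b) (Fin b) ℝ) :
    (T * Matrix.fromBlocks M 0 0 N).trace = (T.toBlocks₁₁ * M).trace + (T.toBlocks₂₂ * N).trace := by
  conv_lhs => rw [← Matrix.fromBlocks_toBlocks T]
  rw [Matrix.fromBlocks_multiply]
  simp [Matrix.trace, Fintype.sum_sum_type]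

lemma costMat_transpose (hS : S.Admissible) : S.costMatᵀ = S.costMat := by
  simp [Setup.costMat, Matrix.fromBlocks_transpose, hS.Q_symm, hS.R_symm]

/-- The trace pairing of the two programs. -/
lemma duality_identity {Th : Matrix (Fin n ⊕ Fin m) (Fin n) ℝ}
    {V : Matrix (Fin n ⊕ Fin m) (Fin n ⊕ Fin m) ℝ} {μ : ℝ}
    {Sig : Matrix (Fin n ⊕ Fin m) (Fin n ⊕ Fin m) ℝ} (hSig : Sigᵀ = Sig)
    (P : Matrix (Fin n) (Fin n) ℝ) :
    (Sig * dualSlack S Th V μ P).trace + (P * primalSlack S Th V μ Sig).trace =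
      (Sig * S.costMat).trace - S.σw ^ 2 * P.trace := by
  have h1 : (Sig * (Th * P * Thᵀ)).trace = (P * (Thᵀ * Sig * Th)).trace := by
    rw [← Matrix.mul_assoc, ← Matrix.mul_assoc, Matrix.trace_mul_comm _ Thᵀ, ← Matrix.mul_assoc,
      ← Matrix.mul_assoc, Matrix.trace_mul_comm _ P]
  rw [dualSlack, primalSlack, hSig, Setup.W, Setup.costMat]
  simp only [Matrix.mul_add, Matrix.mul_sub, Matrix.trace_add, Matrix.trace_sub, Matrix.mul_smul,
    Matrix.trace_smul, Matrix.mul_one, smul_eq_mul, trace_mul_fromBlocks_diag, h1]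
  rw [Matrix.trace_mul_comm P Sig.toBlocks₁₁]
  ring

lemma trace_costMat (hS : S.Admissible) {Sig : Matrix (Fin n ⊕ Fin m) (Fin n ⊕ Fin m) ℝ} :
    (S.costMatᵀ * Sig).trace = (Sig * S.costMat).trace := by
  rw [costMat_transpose hS, Matrix.trace_mul_comm]

lemma weak_duality (hS : S.Admissible) {Th : Matrix (Fin n ⊕ Fin m) (Fin n) ℝ}
    {V : Matrix (Fin n ⊕ Fin m) (Fin n ⊕ Fin m) ℝ} {μ : ℝ}
    {Sig : Matrix (Fin n ⊕ Fin m) (Fin n ⊕ Fin m) ℝ} (hSig : S.PrimalFeasible Th V μ Sig)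
    {P : Matrix (Fin n) (Fin n) ℝ} (hP : S.DualFeasible Th V μ P) :
    S.σw ^ 2 * P.trace ≤ (S.costMatᵀ * Sig).trace := by
  have h := duality_identity (S := S) (Th := Th) (V := V) (μ := μ)
    (transpose_eq_of_posSemidef hSig.1) P
  have h1 := trace_mul_nonneg hSig.1 (N := dualSlack S Th V μ P) (quad_nonneg hP.2)
  have h2 := trace_mul_nonneg hP.1 (N := primalSlack S Th V μ Sig) (quad_nonneg hSig.2)
  rw [trace_costMat hS]
  linarith

/-- The set to be separated from a point in the proof of strong duality. The positive margin `c`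
makes the matrix inequality strict, hence stable under small perturbations in the spectral norm. -/
lemma isOpen_strictlyBelow {ι E : Type*} [Fintype ι] [DecidableEq ι] (C : Set E)
    (Z : E → Matrix ι ι ℝ) (o : E → ℝ) :
    IsOpen {p : Matrix ι ι ℝ × ℝ | ∃ e ∈ C, ∃ c : ℝ, 0 < c ∧
      (∀ v, c * sqNorm v ≤ quad (Z e - p.1) v) ∧ p.2 < o e} := by
  rw [Metric.isOpen_iff]
  rintro ⟨Y, v⟩ ⟨e, he, c, hc, hY, hv⟩
  refine ⟨min (c / 2) (o e - v), lt_min (by positivity) (by simpa using hv), ?_⟩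
  rintro ⟨Y', v'⟩ hp
  rw [Metric.mem_ball, Prod.dist_eq, max_lt_iff, dist_eq_norm, Real.dist_eq] at hp
  obtain ⟨hp1, hp2⟩ := hp
  refine ⟨e, he, c / 2, by positivity, fun u => ?_, ?_⟩
  · have h1 := quad_le_norm (Y' - Y) u
    have h2 := hY u
    have h3 := mul_le_mul_of_nonneg_right (hp1.trans_le (min_le_left _ _)).le (sqNorm_nonneg u)
    simp only [quad_sub] at *
    linarith
  · have h1 := hp2.trans_le (min_le_right _ _)
    have h2 := (abs_lt.1 h1).2
    simp only at *
    linarith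

/-- A linear functional on matrices is represented, on symmetric matrices, by a symmetric
matrix through the trace pairing. -/
lemma exists_trace_representation {ι : Type*} [Fintype ι] [DecidableEq ι]
    (g : Matrix ι ι ℝ →ₗ[ℝ] ℝ) :
    ∃ F : Matrix ι ι ℝ, Fᵀ = F ∧ ∀ Y : Matrix ι ι ℝ, Yᵀ = Y → g Y = (F * Y).trace := by
  set E : Matrix ι ι ℝ := Matrix.of fun i j => g (Matrix.single i j 1) with hE
  refine ⟨(1 / 2 : ℝ) • (E + Eᵀ), by simp [add_comm], fun Y hY => ?_⟩
  have h1 : g Y = ∑ i, ∑ j, Y i j * E i j := by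
    conv_lhs => rw [Matrix.matrix_eq_sum_single Y]
    simp only [map_sum]
    refine Finset.sum_congr rfl fun i _ => Finset.sum_congr rfl fun j _ => ?_
    have : Matrix.single i j (Y i j) = Y i j • Matrix.single i j (1 : ℝ) := by
      rw [Matrix.smul_single, smul_eq_mul, mul_one]
    rw [this, map_smul, smul_eq_mul, hE, Matrix.of_apply]
  have h2 : (Eᵀ * Y).trace = ∑ i, ∑ j, Y i j * E i j := by
    rw [Finset.sum_comm]
    simp only [Matrix.trace, Matrix.diag, Matrix.mul_apply, Matrix.transpose_apply]
    exact Finset.sum_congr rfl fun i _ => Finset.sum_congr rfl fun j _ => mul_comm _ _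
  have h3 : (E * Y).trace = (Eᵀ * Y).trace := by
    rw [← Matrix.trace_transpose, Matrix.transpose_mul, hY, Matrix.trace_mul_comm]
  rw [Matrix.smul_mul, Matrix.add_mul, Matrix.trace_smul, Matrix.trace_add, h3, h1, h2, smul_eq_mul]
  ring

lemma dualSlack_transpose (hS : S.Admissible) {Th : Matrix (Fin n ⊕ Fin m) (Fin n) ℝ}
    {V : Matrix (Fin n ⊕ Fin m) (Fin n ⊕ Fin m) ℝ} (hV : V.PosDef) {μ : ℝ}
    {P : Matrix (Fin n) (Fin n) ℝ} (hP : Pᵀ = P) :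
    (dualSlack S Th V μ P)ᵀ = dualSlack S Th V μ P := by
  simp [dualSlack, Matrix.fromBlocks_transpose, hS.Q_symm, hS.R_symm, hP, Matrix.transpose_mul,
    Matrix.mul_assoc, Matrix.transpose_nonsing_inv, transpose_eq_of_posSemidef hV.posSemidef]

lemma dualSlack_add_smul {Th : Matrix (Fin n ⊕ Fin m) (Fin n) ℝ}
    {V : Matrix (Fin n ⊕ Fin m) (Fin n ⊕ Fin m) ℝ} {μ a b : ℝ} (hab : a + b = 1)
    (P P' : Matrix (Fin n) (Fin n) ℝ) :
    dualSlack S Th V μ (a • P + b • P') = a • dualSlack S Th V μ P + b • dualSlack S Th V μ P' := by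
  have h1 : Matrix.fromBlocks (S.Q - (a • P + b • P')) 0 0 S.R =
      a • Matrix.fromBlocks (S.Q - P) 0 0 S.R + b • Matrix.fromBlocks (S.Q - P') 0 0 S.R := by
    rw [Matrix.fromBlocks_smul, Matrix.fromBlocks_smul, Matrix.fromBlocks_add]
    congr 1
    · rw [smul_sub, smul_sub, sub_add_sub_comm, ← add_smul, hab, one_smul]
    · simp
    · simp
    · rw [← add_smul, hab, one_smul]
  simp only [dualSlack, h1, Matrix.trace_add, Matrix.trace_smul, Matrix.mul_add, Matrix.add_mul,
    Matrix.mul_smul, Matrix.smul_mul, smul_add, smul_sub, smul_eq_mul, smul_smul, mul_add, add_smul]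
  rw [show μ * (a * P.trace) = a * (μ * P.trace) by ring,
    show μ * (b * P'.trace) = b * (μ * P'.trace) by ring]
  abel

/-- Strong duality: the value of the relaxed dual program is attained by the primal one. -/
lemma exists_primalFeasible_le (hS : S.Admissible) {Th : Matrix (Fin n ⊕ Fin m) (Fin n) ℝ}
    {V : Matrix (Fin n ⊕ Fin m) (Fin n ⊕ Fin m) ℝ} (hV : V.PosDef) {μ : ℝ}
    {P₀ : Matrix (Fin n) (Fin n) ℝ} (hP₀ : S.DualOptimal Th V μ P₀) :
    ∃ Sig, S.PrimalFeasible Th V μ Sig ∧ (S.costMatᵀ * Sig).trace ≤ S.σw ^ 2 * P₀.trace := by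
  set p := S.σw ^ 2 * P₀.trace with hp
  set Z := dualSlack S Th V μ with hZ
  -- Pairs lying strictly below the slack and the objective of some semidefinite `P`. Optimality of
  -- `P₀` says exactly that `(0, p)` is not such a pair, and the separating functional is the
  -- Lagrange multiplier.
  set U : Set (Matrix (Fin n ⊕ Fin m) (Fin n ⊕ Fin m) ℝ × ℝ) :=
    {q | ∃ P ∈ {P : Matrix (Fin n) (Fin n) ℝ | P.PosSemidef}, ∃ c : ℝ, 0 < c ∧
      (∀ v, c * sqNorm v ≤ quad (Z P - q.1) v) ∧ q.2 < S.σw ^ 2 * P.trace} with hU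
  have hopen : IsOpen U := isOpen_strictlyBelow _ _ _
  have hconv : Convex ℝ U := by
    rintro ⟨Y, v⟩ ⟨P, hP, c, hc, hY, hv⟩ ⟨Y', v'⟩ ⟨P', hP', c', hc', hY', hv'⟩ a b ha hb hab
    refine ⟨a • P + b • P', (hP.smul ha).add (hP'.smul hb), a * c + b * c', ?_, fun u => ?_, ?_⟩
    · rcases ha.eq_or_lt with h0 | h0
      · have hb1 : b = 1 := by linarith
        rw [← h0, hb1]; linarith
      · nlinarith [mul_pos h0 hc, mul_nonneg hb hc'.le]
    · have h1 := mul_le_mul_of_nonneg_left (hY u) ha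
      have h2 := mul_le_mul_of_nonneg_left (hY' u) hb
      rw [hZ, dualSlack_add_smul hab]
      simp only [quad_sub, quad_add, quad_smul, Prod.fst_add, Prod.smul_fst] at *
      linarith
    · have e1 : (a • P + b • P').trace = a * P.trace + b * P'.trace := by
        simp [Matrix.trace_add, Matrix.trace_smul]
      have e2 : (a • (Y, v) + b • (Y', v')).2 = a * v + b * v' := by simp
      rw [e1, e2]
      simp only at hv hv'
      rcases ha.eq_or_lt with h0 | h0
      · have hb1 : b = 1 := by linarith
        rw [← h0, hb1]; linarith
      · have h1 := mul_lt_mul_of_pos_left hv h0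
        have h2 := mul_le_mul_of_nonneg_left hv'.le hb
        linarith
  have hnot : ((0 : Matrix (Fin n ⊕ Fin m) (Fin n ⊕ Fin m) ℝ), p) ∉ U := by
    rintro ⟨P, hP, c, hc, hY, hv⟩
    have hfeas : S.DualFeasible Th V μ P := by
      refine ⟨hP, posSemidef_iff_quad.2 ⟨dualSlack_transpose hS hV
        (transpose_eq_of_posSemidef hP), fun u => ?_⟩⟩
      have := hY u
      rw [sub_zero] at this
      exact (mul_nonneg hc.le (sqNorm_nonneg u)).trans this
    have := hP₀.2 P hfeas
    rw [trace_mul_W, trace_mul_W] at this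
    simp only at hv
    linarith
  obtain ⟨f, hf⟩ := geometric_hahn_banach_open_point hconv hopen hnot
  set s := f (0, 1) with hs
  set g : Matrix (Fin n ⊕ Fin m) (Fin n ⊕ Fin m) ℝ →ₗ[ℝ] ℝ :=
    f.toLinearMap ∘ₗ LinearMap.inl ℝ _ ℝ with hg
  have hfg : ∀ Y v, f (Y, v) = g Y + v * s := by
    intro Y v
    have : ((Y, v) : Matrix (Fin n ⊕ Fin m) (Fin n ⊕ Fin m) ℝ × ℝ) = (Y, 0) + v • (0, 1) := by
      simp
    rw [this, map_add, map_smul]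
    rfl
  have hlt : ∀ q ∈ U, g q.1 + q.2 * s < p * s := by
    intro q hq
    have := hf q hq
    rw [hfg 0 p, map_zero, zero_add] at this
    rwa [← hfg]
  have hα := hS.α₀_pos
  -- Slater's condition: `P = 0` has slack `diag (Q, R) ⪰ α₀ I`, so all pairs `(-N, v)` with `N ⪰ 0`
  -- and `v < 0` lie in `U`.
  have hZ0 : ∀ v, S.α₀ * sqNorm v ≤ quad (Z 0) v := by
    intro v
    have h := quad_dualSlack (S := S) Th V μ 0 (v ∘ Sum.inl) (v ∘ Sum.inr)
    have h5 := sqNorm_sumElim (v ∘ Sum.inl) (v ∘ Sum.inr)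
    rw [Sum.elim_comp_inl_inr] at h h5
    have h1 := hS.le_quad_Q (v ∘ Sum.inl)
    have h2 := hS.le_quad_R (v ∘ Sum.inr)
    have h3 : ∀ x : Fin n → ℝ, quad (0 : Matrix (Fin n) (Fin n) ℝ) x = 0 := fun x => by simp [quad]
    rw [h3, h3, Matrix.trace_zero] at h
    rw [hZ, h, h5]
    linarith
  have hmem : ∀ N : Matrix (Fin n ⊕ Fin m) (Fin n ⊕ Fin m) ℝ, N.PosSemidef → ∀ v, v < 0 →
      (-N, v) ∈ U := by
    intro N hN v hv
    refine ⟨0, Matrix.PosSemidef.zero, S.α₀, hα, fun u => ?_, by simpa using hv⟩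
    simp only [sub_neg_eq_add, quad_add]
    linarith [hZ0 u, quad_nonneg hN u]
  -- The functional is not vertical: were `s ≤ 0`, very negative objective values would violate the
  -- separation.
  have hs0 : 0 < s := by
    by_contra! hneg
    have h1 := hlt _ (hmem 0 Matrix.PosSemidef.zero (-1 - |p|) (by linarith [abs_nonneg p]))
    simp only [neg_zero, map_zero, zero_add] at h1
    nlinarith [neg_abs_le p]
  -- If `g N < 0`, a large multiple of `-N` would push the functional above its bound on `U`.
  have hgN : ∀ N : Matrix (Fin n ⊕ Fin m) (Fin n ⊕ Fin m) ℝ, N.PosSemidef → 0 ≤ g N := by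
    intro N hN
    by_contra! hneg
    have hc : 0 ≤ |p * s + s| / (-g N) := div_nonneg (abs_nonneg _) (by linarith)
    have h1 := hlt _ (hmem ((|p * s + s| / (-g N)) • N) (hN.smul hc) (-1) (by norm_num))
    simp only [map_neg, map_smul, smul_eq_mul] at h1
    have h2 : |p * s + s| / (-g N) * g N = -|p * s + s| := by
      rw [div_neg, neg_mul, div_mul_cancel₀ _ hneg.ne]
    rw [h2] at h1
    linarith [le_abs_self (p * s + s)]
  -- Let the strictness margin `c` tend to zero.
  have hmain : ∀ P : Matrix (Fin n) (Fin n) ℝ, P.PosSemidef →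
      g (Z P) + S.σw ^ 2 * P.trace * s ≤ p * s := by
    intro P hP
    have h1 : ∀ c : ℝ, 0 < c → g (Z P) + S.σw ^ 2 * P.trace * s ≤ p * s + c * (g 1 + s) := by
      intro c hc
      have h2 := hlt (Z P - c • 1, S.σw ^ 2 * P.trace - c)
        ⟨P, hP, c, hc, fun u => by simp [quad_smul, quad_one], by simpa using hc⟩
      simp only [map_sub, map_smul, smul_eq_mul] at h2
      linarith
    have hg1 : 0 ≤ g 1 := hgN 1 Matrix.PosSemidef.one
    refine le_of_forall_pos_le_add fun e he => ?_
    have h3 := h1 (e / (g 1 + s)) (by positivity)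
    rwa [div_mul_cancel₀ _ (by positivity)] at h3
  -- Normalizing the multiplier so that the objective has weight one gives the primal candidate `s⁻¹
  -- • F`.
  obtain ⟨F, hFt, hF⟩ := exists_trace_representation g
  have hSigt : (s⁻¹ • F)ᵀ = s⁻¹ • F := by rw [Matrix.transpose_smul, hFt]
  have hSigg : ∀ Y, Yᵀ = Y → ((s⁻¹ • F) * Y).trace = s⁻¹ * g Y := fun Y hY => by
    rw [Matrix.smul_mul, Matrix.trace_smul, smul_eq_mul, hF Y hY]
  have hSigP : (s⁻¹ • F).PosSemidef := by
    refine posSemidef_iff_quad.2 ⟨hSigt, fun v => ?_⟩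
    have h1 := hSigg (Matrix.vecMulVec v v) (by simp [Matrix.transpose_vecMulVec])
    have h2 := hgN _ (posSemidef_vecMulVec v)
    rw [Matrix.trace_mul_comm, Matrix.vecMulVec_mul, Matrix.trace_vecMulVec] at h1
    rw [quad, Matrix.dotProduct_mulVec, dotProduct_comm, h1]
    positivity
  -- The Lagrangian is at most `p` for every `P ⪰ 0`. Large multiples of `v vᵀ` then force the
  -- primal slack to be semidefinite, and `P = 0` bounds the cost.
  have hle : ∀ P : Matrix (Fin n) (Fin n) ℝ, P.PosSemidef →
      ((s⁻¹ • F) * S.costMat).trace - (P * primalSlack S Th V μ (s⁻¹ • F)).trace ≤ p := by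
    intro P hP
    have h1 := duality_identity (S := S) (Th := Th) (V := V) (μ := μ) hSigt P
    have h2 := hSigg (Z P) (dualSlack_transpose hS hV (transpose_eq_of_posSemidef hP))
    have h3 := hmain P hP
    have h4 : s⁻¹ * g (Z P) + S.σw ^ 2 * P.trace ≤ p := by
      rw [inv_mul_eq_div]
      rw [← le_sub_iff_add_le, div_le_iff₀ hs0]
      linarith
    linarith
  refine ⟨s⁻¹ • F, ⟨hSigP, posSemidef_iff_quad.2 ⟨?_, fun v => ?_⟩⟩, ?_⟩
  · have h1 : (s⁻¹ • F).toBlocks₁₁ᵀ = (s⁻¹ • F).toBlocks₁₁ := by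
      ext i j
      exact congrFun (congrFun hSigt (Sum.inl i)) (Sum.inl j)
    rw [Matrix.transpose_sub, Matrix.transpose_sub, Matrix.transpose_add, h1, Matrix.transpose_mul,
      Matrix.transpose_mul, hSigt, Matrix.transpose_transpose, Matrix.mul_assoc, Setup.W,
      Matrix.transpose_smul, Matrix.transpose_smul, Matrix.transpose_one]
  · change 0 ≤ quad (primalSlack S Th V μ (s⁻¹ • F)) v
    by_contra! hneg
    set x := quad (primalSlack S Th V μ (s⁻¹ • F)) v with hx
    set k := ((s⁻¹ • F) * S.costMat).trace with hk
    have hc : 0 ≤ (|p - k| + 1) / (-x) := div_nonneg (by positivity) (by linarith)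
    have h1 := hle (((|p - k| + 1) / (-x)) • Matrix.vecMulVec v v)
      ((posSemidef_vecMulVec v).smul hc)
    have h2 : (Matrix.vecMulVec v v * primalSlack S Th V μ (s⁻¹ • F)).trace = x := by
      rw [Matrix.vecMulVec_mul, Matrix.trace_vecMulVec, hx, quad, Matrix.dotProduct_mulVec,
        dotProduct_comm]
    rw [Matrix.smul_mul, Matrix.trace_smul, h2, smul_eq_mul] at h1
    have h3 : (|p - k| + 1) / (-x) * x = -(|p - k| + 1) := by
      rw [div_neg, neg_mul, div_mul_cancel₀ _ hneg.ne]
    rw [h3] at h1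
    linarith [le_abs_self (p - k)]
  · rw [trace_costMat hS]
    have := hle 0 Matrix.PosSemidef.zero
    simpa using this

/-- What the two programs provide at an update time with a consistent estimate. -/
lemma policy_optimality (hn : 0 < n) (hS : S.Admissible)
    {Th : Matrix (Fin n ⊕ Fin m) (Fin n) ℝ}
    {V : Matrix (Fin n ⊕ Fin m) (Fin n ⊕ Fin m) ℝ} (hV : V.PosDef) {μ : ℝ}
    (hc : Consistent S Th V μ) {Sig : Matrix (Fin n ⊕ Fin m) (Fin n ⊕ Fin m) ℝ}
    {P : Matrix (Fin n) (Fin n) ℝ}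
    (hSig : (∃ Sig, S.PrimalOptimal Th V μ Sig) → S.PrimalOptimal Th V μ Sig)
    (hP : (∃ P, S.DualOptimal Th V μ P) → S.DualOptimal Th V μ P) :
    S.PrimalFeasible Th V μ Sig ∧ S.DualFeasible Th V μ P ∧
      dualSlack S Th V μ P * Sig = 0 ∧ (S.costMatᵀ * Sig).trace ≤ S.σw ^ 2 * P.trace := by
  have hP' := hP (exists_dualOptimal hn hS hc)
  obtain ⟨Sig₀, h1, h2⟩ := exists_primalFeasible_le hS hV hP'
  have hSig' := hSig ⟨Sig₀, h1, fun Sig' h' => h2.trans (weak_duality hS h' hP'.1)⟩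
  have h3 : (S.costMatᵀ * Sig).trace ≤ S.σw ^ 2 * P.trace := (hSig'.2 Sig₀ h1).trans h2
  refine ⟨hSig'.1, hP'.1, ?_, h3⟩
  -- The two nonnegative trace pairings add up to the duality gap, which is not positive; so both
  -- vanish.
  have h := duality_identity (S := S) (Th := Th) (V := V) (μ := μ)
    (transpose_eq_of_posSemidef hSig'.1.1) P
  have h4 := trace_mul_nonneg hSig'.1.1 (N := dualSlack S Th V μ P) (quad_nonneg hP'.1.2)
  have h5 := trace_mul_nonneg hP'.1.1 (N := primalSlack S Th V μ Sig) (quad_nonneg hSig'.1.2)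
  rw [trace_costMat hS] at h3
  exact mul_eq_zero_of_trace_mul_eq_zero hSig'.1.1 hP'.1.2 (by linarith)

end Duality

/-! ### Properties of the computed gain -/

section Policy

variable {n m : ℕ} {S : Setup n m}

lemma Setup.Admissible.nu_div_eq (hS : S.Admissible) : S.ν / S.σw ^ 2 = S.α₀ * S.κ ^ 2 / 2 := by
  have := hS.α₀_pos; have := hS.σw_pos
  rw [hS.κ_sq]; field_simp

/-- Feasibility gives `Σ_xx ⪰ W - μ tr (Σ V⁻¹) I`. The cost bound yields `tr Σ ≤ ν / α₀`, and with
the smallness of `μ ‖V⁻¹‖` the relaxation takes at most half of `W`. Hence the inverse defining the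
gain is a genuine one. -/
lemma posDef_toBlocks₁₁ (hn : 0 < n) (hS : S.Admissible)
    {Th : Matrix (Fin n ⊕ Fin m) (Fin n) ℝ}
    {V : Matrix (Fin n ⊕ Fin m) (Fin n ⊕ Fin m) ℝ} {μ : ℝ} (hμ0 : 0 ≤ μ)
    (hμ : μ * ‖V⁻¹‖ ≤ 1 / (16 * S.κ ^ 10))
    {Sig : Matrix (Fin n ⊕ Fin m) (Fin n ⊕ Fin m) ℝ} (hSig : S.PrimalFeasible Th V μ Sig)
    (hcost : (S.costMatᵀ * Sig).trace ≤ S.ν) : Sig.toBlocks₁₁.PosDef := by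
  have hα := hS.α₀_pos
  have hσ : 0 < S.σw ^ 2 := pow_pos hS.σw_pos 2
  have hκ2 := hS.two_le_κ_sq hn
  have htr0 := hSig.1.trace_nonneg
  have htr : S.α₀ * Sig.trace ≤ S.ν := by
    have h1 := trace_mul_mono (M := S.α₀ • 1) (N := S.costMat) hSig.1 fun v => by
      have h := quad_fromBlocks_diag S.Q S.R (v ∘ Sum.inl) (v ∘ Sum.inr)
      have h5 := sqNorm_sumElim (v ∘ Sum.inl) (v ∘ Sum.inr)
      rw [Sum.elim_comp_inl_inr] at h h5
      rw [quad_smul, quad_one, Setup.costMat, h, h5]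
      linarith [hS.le_quad_Q (v ∘ Sum.inl), hS.le_quad_R (v ∘ Sum.inr)]
    rw [Matrix.mul_smul, Matrix.mul_one, Matrix.trace_smul, smul_eq_mul] at h1
    rw [trace_costMat hS] at hcost
    linarith
  have hrel : μ * (Sigᵀ * V⁻¹).trace ≤ S.σw ^ 2 / 2 := by
    rw [transpose_eq_of_posSemidef hSig.1]
    have h1 := trace_mul_mono (M := V⁻¹) (N := ‖V⁻¹‖ • 1) hSig.1 fun v => by
      rw [quad_smul, quad_one]; exact quad_le_norm _ v
    rw [Matrix.mul_smul, Matrix.mul_one, Matrix.trace_smul, smul_eq_mul] at h1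
    have h2 : μ * (Sig * V⁻¹).trace ≤ 1 / (16 * S.κ ^ 10) * Sig.trace := by
      calc μ * (Sig * V⁻¹).trace ≤ μ * (‖V⁻¹‖ * Sig.trace) := mul_le_mul_of_nonneg_left h1 hμ0
        _ = μ * ‖V⁻¹‖ * Sig.trace := by ring
        _ ≤ _ := mul_le_mul_of_nonneg_right hμ htr0
    have h3 : Sig.trace ≤ S.κ ^ 2 / 2 * S.σw ^ 2 := by
      have h4 := hS.nu_div_eq
      rw [div_eq_iff hσ.ne'] at h4
      rw [h4] at htr
      have : S.α₀ * Sig.trace ≤ S.α₀ * (S.κ ^ 2 / 2 * S.σw ^ 2) := by linarith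
      exact le_of_mul_le_mul_left this hα
    have h5 : 1 / (16 * S.κ ^ 10) * (S.κ ^ 2 / 2 * S.σw ^ 2) ≤ S.σw ^ 2 / 2 := by
      have hκ0 := hS.κ_pos
      have h6 : (1 : ℝ) ≤ S.κ ^ 8 := by
        have : S.κ ^ 8 = (S.κ ^ 2) ^ 4 := by ring
        rw [this]; exact one_le_pow₀ (by linarith)
      have h7 : 1 / (16 * S.κ ^ 10) * (S.κ ^ 2 / 2 * S.σw ^ 2) = S.σw ^ 2 / (32 * S.κ ^ 8) := by
        field_simp; ring
      rw [h7, div_le_div_iff₀ (by positivity) (by norm_num)]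
      nlinarith
    have h8 : 0 ≤ 1 / (16 * S.κ ^ 10) := by have := hS.κ_pos; positivity
    exact h2.trans ((mul_le_mul_of_nonneg_left h3 h8).trans h5)
  have hsymm : Sig.toBlocks₁₁ᵀ = Sig.toBlocks₁₁ := by
    ext i j
    exact congrFun (congrFun (transpose_eq_of_posSemidef hSig.1) (Sum.inl i)) (Sum.inl j)
  have hdecomp : Sig.toBlocks₁₁ = (S.σw ^ 2 / 2) • (1 : Matrix (Fin n) (Fin n) ℝ) +
      (Sig.toBlocks₁₁ - (S.σw ^ 2 / 2) • 1) := by abel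
  rw [hdecomp]
  refine (Matrix.PosDef.one.smul (by positivity)).add_posSemidef
    (posSemidef_iff_quad.2 ⟨by simp [hsymm], fun v => ?_⟩)
  have h1 := quad_nonneg hSig.2 v
  have h2 := quad_nonneg (posSemidef_conj hSig.1 Th) v
  have h3 := sqNorm_nonneg v
  rw [quad_sub, quad_sub, quad_add, quad_smul, quad_one, Setup.W, quad_smul, quad_one] at h1
  rw [quad_sub, quad_smul, quad_one]
  nlinarith

/-- `(x, K x)` is the image under `Σ` of `(Σ_xx⁻¹ x, 0)`, so it is killed by every `Z` with `Z Σ =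
0`. -/
lemma dualSlack_mulVec_gain {Z Sig : Matrix (Fin n ⊕ Fin m) (Fin n ⊕ Fin m) ℝ} (h : Z * Sig = 0)
    (hpd : Sig.toBlocks₁₁.PosDef) (x : Fin n → ℝ) :
    Z *ᵥ (Sum.elim x ((Sig.toBlocks₂₁ * Sig.toBlocks₁₁⁻¹) *ᵥ x)) = 0 := by
  have hu : IsUnit Sig.toBlocks₁₁.det := hpd.det_pos.ne'.isUnit
  have hy (y : Fin n → ℝ) : Sig *ᵥ Sum.elim y 0 =
      Sum.elim (Sig.toBlocks₁₁ *ᵥ y) (Sig.toBlocks₂₁ *ᵥ y) := by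
    conv_lhs => rw [← Matrix.fromBlocks_toBlocks Sig]
    rw [Matrix.fromBlocks_mulVec, Sum.elim_comp_inl, Sum.elim_comp_inr, Matrix.mulVec_zero,
      Matrix.mulVec_zero, add_zero, add_zero]
  have h1 : Sig *ᵥ Sum.elim (Sig.toBlocks₁₁⁻¹ *ᵥ x) 0 =
      Sum.elim x ((Sig.toBlocks₂₁ * Sig.toBlocks₁₁⁻¹) *ᵥ x) := by
    rw [hy, Matrix.mulVec_mulVec, Matrix.mulVec_mulVec, Matrix.mul_nonsing_inv _ hu,
      Matrix.one_mulVec]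
  rw [← h1, Matrix.mulVec_mulVec, h, Matrix.zero_mulVec]

/-- The one-step inequality behind the regret decomposition. -/
lemma cost_le_of_complementary {Th : Matrix (Fin n ⊕ Fin m) (Fin n) ℝ}
    {V : Matrix (Fin n ⊕ Fin m) (Fin n ⊕ Fin m) ℝ} {μ : ℝ}
    (hc : Consistent S Th V μ) {P : Matrix (Fin n) (Fin n) ℝ} (hP : S.DualFeasible Th V μ P)
    {x : Fin n → ℝ} {y : Fin m → ℝ} (hy : dualSlack S Th V μ P *ᵥ Sum.elim x y = 0)
    (η : Fin m → ℝ) :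
    quad S.Q x + quad S.R (y + η) ≤ quad P x - quad P (S.A *ᵥ x + S.B *ᵥ (y + η)) +
      2 * μ * P.trace * quad V⁻¹ (Sum.elim x (y + η)) + quad (S.R + S.Bᵀ * P * S.B) η := by
  have h1 : Sum.elim x (y + η) = Sum.elim x y + Sum.elim (0 : Fin n → ℝ) η := by
    rw [← Sum.elim_add_add, add_zero]
  -- Since the slack annihilates `(x, y)`, only the perturbation contributes to its form.
  -- Consistency is then used twice: at `(x, y + η)` it doubles the relaxation term, and at `(0, η)`
  -- its error is absorbed by the negative relaxation term there.
  have h2 : quad (dualSlack S Th V μ P) (Sum.elim x (y + η)) =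
      quad (dualSlack S Th V μ P) (Sum.elim 0 η) := by
    have hsym : (dualSlack S Th V μ P)ᵀ = dualSlack S Th V μ P := transpose_eq_of_posSemidef hP.2
    rw [h1, quad_add_vec hsym, dot_mulVec_comm hsym, hy]
    simp [quad, hy]
  rw [quad_dualSlack, quad_dualSlack] at h2
  have h3 := (abs_le.1 (hc P hP.1 (Sum.elim x (y + η)))).2
  have h4 := (abs_le.1 (hc P hP.1 (Sum.elim 0 η))).1
  rw [Theta_transpose_mulVec] at h3 h4
  rw [Matrix.mulVec_zero, zero_add] at h4
  have h5 : quad S.Q 0 = 0 := by simp [quad]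
  have h6 : quad P 0 = 0 := by simp [quad]
  rw [quad_add, quad_conj]
  linarith

/-- Uniform stability and boundedness of the gains computed from accurate estimates, with the
Riccati solution as common Lyapunov function. -/
lemma gain_stable (hn : 0 < n) (hS : S.Admissible) {Th : Matrix (Fin n ⊕ Fin m) (Fin n) ℝ}
    {V : Matrix (Fin n ⊕ Fin m) (Fin n ⊕ Fin m) ℝ} {μ : ℝ} (hμ0 : 0 ≤ μ)
    (hμ : μ * ‖V⁻¹‖ ≤ 1 / (16 * S.κ ^ 10))
    (hc : Consistent S Th V μ) {P : Matrix (Fin n) (Fin n) ℝ} (hP : S.DualFeasible Th V μ P)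
    {K : Matrix (Fin m) (Fin n) ℝ}
    (hK : ∀ x, dualSlack S Th V μ P *ᵥ Sum.elim x (K *ᵥ x) = 0) (x : Fin n → ℝ) :
    quad S.Pstar (S.A *ᵥ x + S.B *ᵥ (K *ᵥ x)) ≤ (1 - 1 / S.κ ^ 2) * quad S.Pstar x ∧
      sqNorm (K *ᵥ x) ≤ S.κ ^ 2 * sqNorm x := by
  have hα := hS.α₀_pos
  have hκ2 := hS.two_le_κ_sq hn
  have hκ0 := hS.κ_pos
  have hn' : (1 : ℝ) ≤ n := by exact_mod_cast hn
  -- The relative size of the relaxation: `(**)` together with `tr P ≤ α₀ κ² / 2` gives `2 μ tr P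
  -- ‖V⁻¹‖ ≤ α₀ θ`.
  set θ := 1 / (16 * S.κ ^ 8) with hθ
  have hκ8 : 16 ≤ S.κ ^ 8 := by
    have h1 : S.κ ^ 8 = (S.κ ^ 2) ^ 4 := by ring
    rw [h1]
    calc (16 : ℝ) = 2 ^ 4 := by norm_num
      _ ≤ _ := pow_le_pow_left₀ (by norm_num) hκ2 4
  have hθ0 : 0 < θ := by positivity
  have hθ1 : θ ≤ 1 / 2 := by
    rw [hθ, div_le_div_iff₀ (by positivity) (by norm_num)]; linarith
  have hθκ : 2 * θ ≤ 1 / S.κ ^ 2 := by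
    rw [hθ, mul_one_div, div_le_div_iff₀ (by positivity) (by positivity)]
    have h1 : S.κ ^ 8 = (S.κ ^ 2) * (S.κ ^ 2) ^ 3 := by ring
    have h2 : (1 : ℝ) ≤ (S.κ ^ 2) ^ 3 := one_le_pow₀ (by linarith)
    rw [h1]
    nlinarith [pow_pos hκ0 2]
  have htrP : P.trace ≤ S.α₀ * S.κ ^ 2 / 2 := by
    rw [← hS.nu_div_eq]
    exact (trace_le_of_dualFeasible hn hS hc hP).trans hS.trace_Pstar_le
  have htrPs : S.Pstar.trace ≤ S.α₀ * S.κ ^ 2 / 2 := by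
    rw [← hS.nu_div_eq]; exact hS.trace_Pstar_le
  have htrP0 := hP.1.trace_nonneg
  have hrel : 2 * μ * P.trace * ‖V⁻¹‖ ≤ S.α₀ * θ := by
    have h1 : μ * ‖V⁻¹‖ * P.trace ≤ 1 / (16 * S.κ ^ 10) * (S.α₀ * S.κ ^ 2 / 2) :=
      mul_le_mul hμ htrP htrP0 (by positivity)
    have h2 : 2 * (1 / (16 * S.κ ^ 10) * (S.α₀ * S.κ ^ 2 / 2)) = S.α₀ * θ := by
      rw [hθ]; field_simp
    linarith
  set f : (Fin n → ℝ) → (Fin n → ℝ) := fun x => S.A *ᵥ x + S.B *ᵥ (K *ᵥ x) with hf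
  -- the perturbed Lyapunov inequality for `P`
  have hA : ∀ x, quad S.Q x + quad S.R (K *ᵥ x) ≤ quad P x - quad P (f x) +
      S.α₀ * θ * (sqNorm x + sqNorm (K *ᵥ x)) := by
    intro x
    have h1 := cost_le_of_complementary hc hP (hK x) 0
    rw [add_zero, show quad (S.R + S.Bᵀ * P * S.B) 0 = 0 by simp [quad], add_zero] at h1
    have h2 := quad_le_norm V⁻¹ (Sum.elim x (K *ᵥ x))
    rw [sqNorm_sumElim] at h2
    have h3 : 2 * μ * P.trace * quad V⁻¹ (Sum.elim x (K *ᵥ x)) ≤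
        2 * μ * P.trace * (‖V⁻¹‖ * (sqNorm x + sqNorm (K *ᵥ x))) :=
      mul_le_mul_of_nonneg_left h2 (by positivity)
    have h4 := mul_le_mul_of_nonneg_right hrel
      (add_nonneg (sqNorm_nonneg x) (sqNorm_nonneg (K *ᵥ x)))
    simp only [hf]
    linarith
  have hB : ∀ x, S.α₀ * (1 - θ) * (sqNorm x + sqNorm (K *ᵥ x)) ≤ quad P x - quad P (f x) := by
    intro x
    linarith [hA x, hS.le_quad_Q x, hS.le_quad_R (K *ᵥ x)]
  have hcpos : 0 < S.α₀ * (1 - θ) := mul_pos hα (by linarith)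
  have hPlow : ∀ x, S.α₀ * (1 - θ) * sqNorm x ≤ quad P x := by
    intro x
    have h1 := hB x
    have h2 := quad_nonneg hP.1 (f x)
    have h3 := mul_nonneg hcpos.le (sqNorm_nonneg (K *ᵥ x))
    linarith
  have htrlow : S.α₀ * (1 - θ) ≤ P.trace := by
    have h1 := trace_le_of_quad_le (M := (S.α₀ * (1 - θ)) • (1 : Matrix (Fin n) (Fin n) ℝ))
      (N := P) fun v => by rw [quad_smul, quad_one]; exact hPlow v
    rw [Matrix.trace_smul, Matrix.trace_one, Fintype.card_fin, smul_eq_mul] at h1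
    nlinarith
  have htrpos : 0 < P.trace := hcpos.trans_le htrlow
  -- comparison of the Riccati solution with `P`
  have hcomp : ∀ x, quad S.Pstar x ≤ 1 / (1 - θ) * quad P x := by
    intro x
    -- Here the computed closed loop is iterated and `P` itself is the contracted potential. The
    -- factor `1 / (1 - θ)` is the one for which the extra decrease of `P`, at least `α₀ (1 - θ)
    -- (|x|² + |K x|²)` times `θ / (1 - θ)`, pays for the relaxation error.
    have := nonpos_of_le_comp (f := f) (L := quad P)
      (D := fun x => quad S.Pstar x - 1 / (1 - θ) * quad P x)
      (ρ := 1 - S.α₀ * (1 - θ) / P.trace) (d := S.Pstar.trace / (S.α₀ * (1 - θ)))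
      (by rw [sub_nonneg, div_le_one htrpos]; exact htrlow)
      (by have : 0 < S.α₀ * (1 - θ) / P.trace := by positivity
          linarith)
      (fun x => by
        have h1 := hB x
        have h3 := mul_nonneg hcpos.le (sqNorm_nonneg (K *ᵥ x))
        have h5 := quad_le_trace hP.1 x
        have h6 : S.α₀ * (1 - θ) / P.trace * quad P x ≤ S.α₀ * (1 - θ) * sqNorm x := by
          rw [div_mul_eq_mul_div, div_le_iff₀ htrpos]; nlinarith
        linarith)
      (fun x => by
        have h1 := hS.quad_Pstar_le x (K *ᵥ x)
        have h2 := hA x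
        have h3 := hB x
        have h4 : S.α₀ * θ * (sqNorm x + sqNorm (K *ᵥ x)) ≤
            (1 / (1 - θ) - 1) * (quad P x - quad P (f x)) := by
          have h5 : 1 / (1 - θ) - 1 = θ / (1 - θ) := by
            have : 1 - θ ≠ 0 := by linarith
            field_simp; ring
          rw [h5, div_mul_eq_mul_div, le_div_iff₀ (by linarith)]
          nlinarith
        have h6 : quad S.Pstar (S.A *ᵥ x + S.B *ᵥ (K *ᵥ x)) = quad S.Pstar (f x) := rfl
        rw [h6] at h1
        linarith)
      (div_nonneg hS.riccati.1.trace_nonneg hcpos.le)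
      (fun x => by
        have h1 := quad_le_trace hS.riccati.1 x
        have h2 := hPlow x
        have h3 := quad_nonneg hP.1 x
        have h4 : S.Pstar.trace * sqNorm x ≤ S.Pstar.trace / (S.α₀ * (1 - θ)) * quad P x := by
          rw [div_mul_eq_mul_div, le_div_iff₀ hcpos]; nlinarith [hS.riccati.1.trace_nonneg]
        have h5 : 0 ≤ 1 / (1 - θ) * quad P x :=
          mul_nonneg (div_nonneg zero_le_one (by linarith)) h3
        linarith) x
    simpa using this
  constructor
  -- The chain is `P_*(f x) ≤ P(f x)/(1-θ) ≤ P_*(x)/(1-θ) - α₀|x|²`. The last term is at least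
  -- `(2/κ²) P_*(x)`, and `1/(1-θ) ≤ 1 + 2θ ≤ 1 + 1/κ²`.
  · have h1 := hcomp (f x)
    have h2 := hB x
    have h3 := quad_le_quad_Pstar hn hS hc hP x
    have h4 := quad_le_trace hS.riccati.1 x
    have h5 : 0 < 1 - θ := by linarith
    have h6 := mul_nonneg hcpos.le (sqNorm_nonneg (K *ᵥ x))
    have h7 : 1 / (1 - θ) * quad P (f x) ≤ 1 / (1 - θ) * quad S.Pstar x - S.α₀ * sqNorm x := by
      have : 1 / (1 - θ) * quad P (f x) ≤
          1 / (1 - θ) * (quad S.Pstar x - S.α₀ * (1 - θ) * sqNorm x) :=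
        mul_le_mul_of_nonneg_left (by linarith) (by positivity)
      refine this.trans (le_of_eq ?_)
      field_simp
    have h8 : 2 / S.κ ^ 2 * quad S.Pstar x ≤ S.α₀ * sqNorm x := by
      rw [div_mul_eq_mul_div, div_le_iff₀ (by positivity)]
      nlinarith [mul_le_mul_of_nonneg_right htrPs (sqNorm_nonneg x)]
    have h9 : 1 / (1 - θ) ≤ 1 + 2 * θ := by
      rw [div_le_iff₀ h5]; nlinarith
    have h10 := quad_nonneg hS.riccati.1 x
    have h11 := mul_le_mul_of_nonneg_right (h9.trans (add_le_add le_rfl hθκ)) h10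
    have h12 : 2 / S.κ ^ 2 = 1 / S.κ ^ 2 + 1 / S.κ ^ 2 := by ring
    rw [h12] at h8
    change quad S.Pstar (f x) ≤ _
    linarith
  -- The control effort is paid by the decrease of `P`: `α₀ (1 - θ) |K x|² ≤ quad P x ≤ (α₀ κ² / 2)
  -- |x|²`, and `1 - θ ≥ 1/2`.
  · have h1 := hB x
    have h2 := quad_nonneg hP.1 (f x)
    have h3 := quad_le_trace hP.1 x
    have h4 := mul_le_mul_of_nonneg_right htrP (sqNorm_nonneg x)
    have h5 := mul_nonneg hcpos.le (sqNorm_nonneg x)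
    have h6 : S.α₀ * (1 / 2) * sqNorm (K *ᵥ x) ≤ S.α₀ * (1 - θ) * sqNorm (K *ᵥ x) :=
      mul_le_mul_of_nonneg_right (mul_le_mul_of_nonneg_left (by linarith) hα.le) (sqNorm_nonneg _)
    have h7 : S.α₀ * sqNorm (K *ᵥ x) ≤ S.α₀ * (S.κ ^ 2 * sqNorm x) := by nlinarith
    exact le_of_mul_le_mul_left h7 hα

end Policy

/-! ### Update times and the growth of the determinant -/

section UpdateTimes

variable {n m : ℕ} (S : Setup n m) (X : Traj n m) (b : ℕ → ℝ)

lemma tau_succ {t : ℕ} (ht : 1 ≤ t) :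
    (tau S X b (t + 1) = t + 1 ∧
      (1 + b (tau S X b t)) * (V S X (tau S X b t)).det < (V S X (t + 1)).det) ∨
    (tau S X b (t + 1) = tau S X b t ∧
      (V S X (t + 1)).det ≤ (1 + b (tau S X b t)) * (V S X (tau S X b t)).det) := by
  obtain ⟨s, rfl⟩ := Nat.exists_eq_add_of_le' ht
  rw [show s + 1 + 1 = s + 2 from rfl, tau]
  split_ifs with h
  · exact Or.inl ⟨rfl, h⟩
  · exact Or.inr ⟨rfl, not_lt.1 h⟩

lemma tau_one : tau S X b 1 = 1 := rfl

lemma one_le_tau_and_le {t : ℕ} (ht : 1 ≤ t) : 1 ≤ tau S X b t ∧ tau S X b t ≤ t := by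
  induction t, ht using Nat.le_induction with
  | base => exact ⟨le_rfl, le_rfl⟩
  | succ t ht ih =>
    rcases tau_succ S X b ht with ⟨h, -⟩ | ⟨h, -⟩ <;> rw [h]
    · exact ⟨by omega, le_rfl⟩
    · exact ⟨ih.1, ih.2.trans (Nat.le_succ t)⟩

lemma tau_tau {t : ℕ} (ht : 1 ≤ t) : tau S X b (tau S X b t) = tau S X b t := by
  induction t, ht using Nat.le_induction with
  | base => rfl
  | succ t ht ih =>
    rcases tau_succ S X b ht with ⟨h, -⟩ | ⟨h, -⟩
    · rw [h, h]
    · rw [h, ih]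

variable {S X b}

lemma V_succ {t : ℕ} (ht : 1 ≤ t) (v : Fin n ⊕ Fin m → ℝ) :
    quad (V S X (t + 1)) v =
      quad (V S X t) v + (S.lam (t + 1) - S.lam t) * sqNorm v + (z X t ⬝ᵥ v) ^ 2 := by
  rw [V, V, Finset.sum_Ico_succ_top ht, quad_add, quad_add, quad_add, quad_smul, quad_smul,
    quad_one, quad_vecMulVec]
  ring

lemma quad_V_mono (hS : S.Admissible) {s t : ℕ} (hs : 1 ≤ s) (h : s ≤ t)
    (v : Fin n ⊕ Fin m → ℝ) : quad (V S X s) v ≤ quad (V S X t) v := by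
  induction t, h using Nat.le_induction with
  | base => exact le_rfl
  | succ t ht ih =>
    rw [V_succ (hs.trans ht)]
    have := mul_nonneg (sub_nonneg.2 (hS.lam_mono (hs.trans ht) (Nat.le_succ t))) (sqNorm_nonneg v)
    linarith [sq_nonneg (z X t ⬝ᵥ v)]

lemma V_transpose (hS : S.Admissible) {t : ℕ} (ht : 1 ≤ t) : (V S X t)ᵀ = V S X t :=
  transpose_eq_of_posSemidef (V_posDef hS X ht).posSemidef

lemma det_V_mono (hS : S.Admissible) {s t : ℕ} (hs : 1 ≤ s) (h : s ≤ t) :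
    (V S X s).det ≤ (V S X t).det :=
  (det_le_det_and_quad_le (V_posDef hS X hs) (V_transpose hS (hs.trans h))
    (quad_V_mono hS hs h)).1

lemma le_quad_V {t : ℕ} (v : Fin n ⊕ Fin m → ℝ) :
    S.lam t * sqNorm v ≤ quad (V S X t) v := by
  rw [V, quad_add, quad_smul, quad_one, quad_sum]
  have : 0 ≤ ∑ s ∈ Finset.Ico 1 t, quad (Matrix.vecMulVec (z X s) (z X s)) v :=
    Finset.sum_nonneg fun s _ => quad_nonneg (posSemidef_vecMulVec _) v
  linarith

lemma quad_V_le {t : ℕ} {c : ℝ} (hc : ∀ s, 1 ≤ s → s < t → sqNorm (z X s) ≤ c)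
    (v : Fin n ⊕ Fin m → ℝ) : quad (V S X t) v ≤ (S.lam t + t * |c|) * sqNorm v := by
  rw [V, quad_add, quad_smul, quad_one, quad_sum, add_mul]
  have h : ∑ s ∈ Finset.Ico 1 t, quad (Matrix.vecMulVec (z X s) (z X s)) v ≤
      ∑ s ∈ Finset.Ico 1 t, |c| * sqNorm v := Finset.sum_le_sum fun s hs => by
    rw [Finset.mem_Ico] at hs
    rw [quad_vecMulVec, ← sq]
    exact (dotProduct_sq_le _ _).trans (mul_le_mul_of_nonneg_right
      ((hc s hs.1 hs.2).trans (le_abs_self c)) (sqNorm_nonneg v))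
  rw [Finset.sum_const, Nat.card_Ico, nsmul_eq_mul] at h
  have h2 : ((t - 1 : ℕ) : ℝ) ≤ t := by exact_mod_cast Nat.sub_le t 1
  have := mul_le_mul_of_nonneg_right h2 (mul_nonneg (abs_nonneg c) (sqNorm_nonneg v))
  linarith

lemma lam_pow_le_det_V (hS : S.Admissible) {t : ℕ} (ht : 1 ≤ t) :
    S.lam t ^ Fintype.card (Fin n ⊕ Fin m) ≤ (V S X t).det := by
  have h := one_le_det_ratio_gram (hS.lam_pos ht) (z X) t
  rw [← V_eq_gram, le_div_iff₀ (pow_pos (hS.lam_pos ht) _), one_mul] at h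
  exact h

lemma det_V_le_tau (hS : S.Admissible) (hb : ∀ τ, 1 ≤ τ → 0 ≤ b τ) {t : ℕ} (ht : 1 ≤ t) :
    (V S X t).det ≤ (1 + b (tau S X b t)) * (V S X (tau S X b t)).det := by
  have key : ∀ s, 1 ≤ s → (V S X s).det ≤ (1 + b s) * (V S X s).det := fun s hs => by
    nlinarith [(V_posDef hS X hs).det_pos, hb s hs]
  rcases Nat.lt_or_ge 1 t with h | h
  · obtain ⟨s, rfl⟩ : ∃ s, t = s + 1 := ⟨t - 1, by omega⟩
    rcases tau_succ S X b (t := s) (by omega) with ⟨h, -⟩ | ⟨h, h'⟩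
    · rw [h]; exact key _ ht
    · rw [h]; exact h'
  · obtain rfl : t = 1 := by omega
    exact key 1 le_rfl

/-- As long as no update is triggered, the determinant ratio is at most `1 + β_τ`, hence `V_t ⪯ (1 +
β_τ) V_τ` by `det_le_det_and_quad_le`. This is the origin of the factor `1 + β` in `R₄`. -/
lemma quad_V_inv_tau_le (hS : S.Admissible) (hb : ∀ τ, 1 ≤ τ → 0 ≤ b τ) {t : ℕ} (ht : 1 ≤ t)
    (v : Fin n ⊕ Fin m → ℝ) :
    quad (V S X (tau S X b t))⁻¹ v ≤ (1 + b (tau S X b t)) * quad (V S X t)⁻¹ v := by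
  obtain ⟨h1, h2⟩ := one_le_tau_and_le S X b ht
  have hpos := (V_posDef hS X h1).det_pos
  refine quad_inv_le_of_le (V_posDef hS X ht) (V_posDef hS X h1) (fun v => ?_) v
  have h3 := (det_le_det_and_quad_le (V_posDef hS X h1) (V_transpose hS ht)
    (quad_V_mono hS h1 h2)).2 v
  have h4 := mul_le_mul_of_nonneg_right (det_V_le_tau (X := X) hS hb ht)
    (quad_nonneg (V_posDef hS X h1).posSemidef v)
  refine le_of_mul_le_mul_left (h3.trans (h4.trans (le_of_eq ?_))) hpos
  ring

/-- Only an inequality, because the regularization grows along with the rank-one update. -/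
lemma det_V_mul_le_det_V_succ (hS : S.Admissible) {t : ℕ} (ht : 1 ≤ t) :
    (V S X t).det * (1 + quad (V S X t)⁻¹ (z X t)) ≤ (V S X (t + 1)).det := by
  rw [← det_add_rankOne (V_posDef hS X ht)]
  refine (det_le_det_and_quad_le (posDef_add_rankOne (V_posDef hS X ht) _)
    (V_transpose hS (by omega)) fun v => ?_).1
  rw [V_succ ht, quad_add, quad_vecMulVec, ← sq]
  linarith [mul_nonneg (sub_nonneg.2 (hS.lam_mono ht (Nat.le_succ t))) (sqNorm_nonneg v)]

/-- The number of policy updates up to time `T`, the first computation included. -/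
noncomputable def numUpdates (S : Setup n m) (X : Traj n m) (b : ℕ → ℝ) (T : ℕ) : ℕ :=
  ((Finset.Icc 1 T).filter fun t => tau S X b t = t).card

lemma numUpdates_one : numUpdates S X b 1 = 1 := by
  simp [numUpdates, tau_one, Finset.filter_singleton]

lemma numUpdates_succ (T : ℕ) : numUpdates S X b (T + 1) =
    numUpdates S X b T + if tau S X b (T + 1) = T + 1 then 1 else 0 := by
  rw [numUpdates, numUpdates, ← Finset.insert_Icc_right_eq_Icc_add_one (by omega),
    Finset.filter_insert]
  split_ifs with h
  · rw [Finset.card_insert_of_notMem]; simp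
  · rfl

lemma numUpdates_le_tau {T : ℕ} (hT : 1 ≤ T) : numUpdates S X b T ≤ tau S X b T := by
  induction T, hT using Nat.le_induction with
  | base => rw [numUpdates_one, tau_one]
  | succ t ht ih =>
    have := one_le_tau_and_le S X b ht
    rw [numUpdates_succ]
    rcases tau_succ S X b ht with ⟨h, -⟩ | ⟨h, -⟩
    · rw [h, if_pos rfl]; omega
    · rw [h, if_neg (by omega)]; omega

/-- Every update multiplies the determinant by at least `1 + b τ`. -/
lemma numUpdates_mul_le (hS : S.Admissible) {T τ₀ : ℕ} {c : ℝ} (hc : 0 ≤ c)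
    (h : ∀ τ, 1 ≤ τ → τ₀ ≤ τ → τ ≤ T → 0 ≤ b τ ∧ c ≤ Real.log (1 + b τ)) (hT : 1 ≤ T) :
    numUpdates S X b T * c ≤ (τ₀ + 1) * c +
      (Real.log (V S X T).det - Real.log (V S X 1).det) := by
  -- The induction tracks the determinant at the last update time, since each update compares it
  -- with the previous one.
  have key : ∀ t, 1 ≤ t → t ≤ T → numUpdates S X b t * c ≤ (τ₀ + 1) * c +
      (Real.log (V S X (tau S X b t)).det - Real.log (V S X 1).det) := by
    intro t ht
    induction t, ht using Nat.le_induction with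
    | base =>
      intro _
      rw [numUpdates_one, tau_one, Nat.cast_one, sub_self, add_zero]
      nlinarith [mul_nonneg (Nat.cast_nonneg (α := ℝ) τ₀) hc]
    | succ t ht ih =>
      intro hT'
      have h1 := one_le_tau_and_le S X b ht
      have hpos := (V_posDef hS X h1.1).det_pos
      rw [numUpdates_succ]
      rcases tau_succ S X b ht with ⟨h2, h3⟩ | ⟨h2, -⟩
      · rw [h2, if_pos rfl]
        -- No lower threshold is assumed for updates replacing a policy of time before `τ₀`. Their
        -- number is bounded directly, because at most `τ(t)` updates have occurred by time `t`.
        rcases Nat.lt_or_ge (tau S X b t) τ₀ with h4 | h4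
        · have h5 : numUpdates S X b t + 1 ≤ τ₀ := (Nat.succ_le_succ (numUpdates_le_tau ht)).trans h4
          have h6 : ((numUpdates S X b t + 1 : ℕ) : ℝ) ≤ τ₀ + 1 := by
            exact_mod_cast h5.trans (Nat.le_succ _)
          have h7 := Real.log_le_log (V_posDef hS X le_rfl).det_pos
            (det_V_mono (X := X) hS le_rfl (show 1 ≤ t + 1 by omega))
          nlinarith
        · obtain ⟨h5, h6⟩ := h _ h1.1 h4 (h1.2.trans (by omega))
          have h7 := Real.log_le_log (by positivity) h3.le
          rw [Real.log_mul (by positivity) hpos.ne'] at h7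
          have := ih (by omega)
          push_cast
          linarith
      · rw [h2, if_neg (by omega), add_zero]
        exact ih (by omega)
  have h1 := one_le_tau_and_le S X b hT
  have h2 := Real.log_le_log (V_posDef hS X h1.1).det_pos (det_V_mono (X := X) hS h1.1 h1.2)
  linarith [key T hT le_rfl]

end UpdateTimes

/-! ### Consequences of the good event for a run -/

section Good

variable {n m : ℕ} {S : Setup n m} {X : Traj n m} {b : ℕ → ℝ}

lemma Good.mono {s t : ℕ} (h : Good S X t) (hst : s ≤ t) : Good S X s :=
  fun r h1 h2 => h r h1 (h2.trans hst)

lemma goodSum_of_good {T : ℕ} (h : Good S X T) (f : ℕ → ℝ) :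
    goodSum S X T f = ∑ t ∈ Finset.Icc 1 T, f t :=
  Finset.sum_congr rfl fun t ht =>
    Set.indicator_of_mem (show t ∈ {s | Good S X s} from h.mono (Finset.mem_Icc.1 ht).2) f

lemma goodSum_succ_of_not_good {T : ℕ} (h : ¬ Good S X (T + 1)) (f : ℕ → ℝ) :
    goodSum S X (T + 1) f = goodSum S X T f := by
  rw [goodSum, goodSum, Finset.sum_Icc_succ_top (by omega), Set.indicator_of_notMem
    (show T + 1 ∉ {s | Good S X s} from h), add_zero]

lemma goodSum_zero (f : ℕ → ℝ) : goodSum S X 0 f = 0 := by simp [goodSum]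

lemma r_nonneg (t : ℕ) : 0 ≤ r S X t := sq_nonneg _

lemma mu_nonneg (hS : S.Admissible) (t : ℕ) : 0 ≤ mu S X t := by
  have := hS.ϑ_pos
  have := r_nonneg (S := S) (X := X) t
  rw [mu]; positivity

lemma Good.consistent (hS : S.Admissible) {t : ℕ} (h : Good S X t) (ht : 1 ≤ t) :
    Consistent S (ThetaHat S X t) (V S X t) (mu S X t) :=
  consistent_of_trace_le hS (V_posDef hS X ht) (r_nonneg t) (h t ht le_rfl).1

lemma IsRun.policy_optimality (hn : 0 < n) (hS : S.Admissible) (hX : IsRun S X b) {t : ℕ}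
    (ht : 1 ≤ t) (h : Good S X t) :
    Consistent S (ThetaHat S X (tau S X b t)) (V S X (tau S X b t)) (mu S X (tau S X b t)) ∧
    S.PrimalFeasible (ThetaHat S X (tau S X b t)) (V S X (tau S X b t)) (mu S X (tau S X b t))
      (X.Sig (tau S X b t)) ∧
    S.DualFeasible (ThetaHat S X (tau S X b t)) (V S X (tau S X b t)) (mu S X (tau S X b t))
      (PP S X b t) ∧
    dualSlack S (ThetaHat S X (tau S X b t)) (V S X (tau S X b t)) (mu S X (tau S X b t))
      (PP S X b t) * X.Sig (tau S X b t) = 0 ∧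
    (S.costMatᵀ * X.Sig (tau S X b t)).trace ≤ S.σw ^ 2 * (PP S X b t).trace := by
  obtain ⟨h1, h2⟩ := one_le_tau_and_le S X b ht
  have hc := (h.mono h2).consistent hS h1
  have htt := tau_tau S X b ht
  exact ⟨hc, ASLO.policy_optimality hn hS (V_posDef hS X h1) hc (hX.primal _ h1 htt)
    (hX.dual _ h1 htt)⟩

lemma IsRun.posSemidef_PP (hn : 0 < n) (hS : S.Admissible) (hX : IsRun S X b) {t : ℕ}
    (ht : 1 ≤ t) (h : Good S X t) : (PP S X b t).PosSemidef :=
  (hX.policy_optimality hn hS ht h).2.2.1.1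

lemma IsRun.trace_PP_le (hn : 0 < n) (hS : S.Admissible) (hX : IsRun S X b) {t : ℕ}
    (ht : 1 ≤ t) (h : Good S X t) : (PP S X b t).trace ≤ S.Pstar.trace := by
  obtain ⟨h1, -, h2, -⟩ := hX.policy_optimality hn hS ht h
  exact trace_le_of_dualFeasible hn hS h1 h2

lemma IsRun.dualSlack_gain (hn : 0 < n) (hS : S.Admissible) (hX : IsRun S X b) {t₀ : ℕ}
    (hcond : Cond0 S X t₀) {t : ℕ} (ht : 1 ≤ t) (h : Good S X t) (hτ : t₀ ≤ tau S X b t)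
    (x : Fin n → ℝ) :
    dualSlack S (ThetaHat S X (tau S X b t)) (V S X (tau S X b t)) (mu S X (tau S X b t))
      (PP S X b t) *ᵥ Sum.elim x (K S X b t *ᵥ x) = 0 := by
  obtain ⟨h1, h2, h3, h4, h5⟩ := hX.policy_optimality hn hS ht h
  have hσ : 0 < S.σw ^ 2 := pow_pos hS.σw_pos 2
  refine dualSlack_mulVec_gain h4 (posDef_toBlocks₁₁ hn hS (mu_nonneg hS _) (hcond _ hτ) h2
    (h5.trans ?_)) x
  have h6 := (hX.trace_PP_le hn hS ht h).trans hS.trace_Pstar_le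
  rw [le_div_iff₀ hσ] at h6
  linarith

lemma IsRun.gain_stable (hn : 0 < n) (hS : S.Admissible) (hX : IsRun S X b) {t₀ : ℕ}
    (hcond : Cond0 S X t₀) {t : ℕ} (ht : 1 ≤ t) (h : Good S X t) (hτ : t₀ ≤ tau S X b t)
    (x : Fin n → ℝ) :
    quad S.Pstar (S.A *ᵥ x + S.B *ᵥ (K S X b t *ᵥ x)) ≤ (1 - 1 / S.κ ^ 2) * quad S.Pstar x ∧
      sqNorm (K S X b t *ᵥ x) ≤ S.κ ^ 2 * sqNorm x := by
  obtain ⟨h1, h2, h3, h4, h5⟩ := hX.policy_optimality hn hS ht h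
  exact ASLO.gain_stable hn hS (mu_nonneg hS _) (hcond _ hτ) h1 h3
    (hX.dualSlack_gain hn hS hcond ht h hτ) x

/-- A policy computed before `t₀` may still be in force later. Its gain coincides with the one at
its update time, which the bound on the initial data covers. -/
lemma sqNorm_K_le_of_tau_lt {t₀ : ℕ} {D : ℝ} (hinit : InitBound S X b t₀ D) {t : ℕ} (ht : 1 ≤ t)
    (hτ : tau S X b t < t₀) (x : Fin n → ℝ) :
    sqNorm (K S X b t *ᵥ x) ≤ D ^ 2 * sqNorm x := by
  have h1 := hinit.2 _ (one_le_tau_and_le S X b ht).1 hτ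
  have h2 : K S X b (tau S X b t) = K S X b t := by rw [K, K, tau_tau S X b ht]
  rw [h2] at h1
  exact (sqNorm_mulVec_le _ _).trans (mul_le_mul_of_nonneg_right
    (pow_le_pow_left₀ (norm_nonneg _) h1 2) (sqNorm_nonneg x))

lemma IsRun.sqNorm_K_le (hn : 0 < n) (hS : S.Admissible) (hX : IsRun S X b) {t₀ : ℕ} {D : ℝ}
    (hcond : Cond0 S X t₀) (hinit : InitBound S X b t₀ D) {t : ℕ} (ht : 1 ≤ t) (h : Good S X t)
    (x : Fin n → ℝ) : sqNorm (K S X b t *ᵥ x) ≤ (D ^ 2 + S.κ ^ 2) * sqNorm x := by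
  have h0 := sqNorm_nonneg x
  rcases Nat.lt_or_ge (tau S X b t) t₀ with hτ | hτ
  · nlinarith [sqNorm_K_le_of_tau_lt hinit ht hτ x, mul_nonneg (sq_nonneg S.κ) h0]
  · nlinarith [(hX.gain_stable hn hS hcond ht h hτ x).2, mul_nonneg (sq_nonneg D) h0]

/-- The regret of one step, for a policy computed from an accurate estimate. -/
lemma IsRun.step_regret_le (hn : 0 < n) (hS : S.Admissible) (hX : IsRun S X b)
    (hb : ∀ τ, 1 ≤ τ → 0 ≤ b τ) {t₀ : ℕ}
    (hcond : Cond0 S X t₀) {t : ℕ} (ht : 1 ≤ t) (h : Good S X t) (hτ : t₀ ≤ tau S X b t) :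
    quad S.Q (X.x t) + quad S.R (X.u t) - S.Jstar ≤
      quad (PP S X b t) (X.x t) - quad (PP S X b t) (S.A *ᵥ X.x t + S.B *ᵥ X.u t) -
        S.σw ^ 2 * (PP S X b t).trace +
      2 * S.ν / S.σw ^ 2 * ((1 + b (tau S X b t)) * mu S X (tau S X b t) *
        quad (V S X t)⁻¹ (z X t)) + quad (S.R + S.Bᵀ * PP S X b t * S.B) (X.η t) := by
  obtain ⟨h1, h2, h3, h4, h5⟩ := hX.policy_optimality hn hS ht h
  have h6 := cost_le_of_complementary h1 h3 (hX.dualSlack_gain hn hS hcond ht h hτ (X.x t)) (X.η t)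
  rw [← hX.input t ht] at h6
  have hμ := mu_nonneg (S := S) (X := X) hS (tau S X b t)
  have hσ : 0 < S.σw ^ 2 := pow_pos hS.σw_pos 2
  have htr := hX.trace_PP_le hn hS ht h
  -- Optimism: the trace of `P` is at most that of `P_*`, so the value of the relaxed program does
  -- not exceed `J_*`.
  have hJ : S.σw ^ 2 * (PP S X b t).trace ≤ S.Jstar := by
    rw [Setup.Jstar, trace_mul_W]; exact mul_le_mul_of_nonneg_left htr hσ.le
  have hq : 0 ≤ quad (V S X (tau S X b t))⁻¹ (z X t) :=
    quad_nonneg (V_posDef hS X (one_le_tau_and_le S X b ht).1).inv.posSemidef _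
  have h7 : 2 * mu S X (tau S X b t) * (PP S X b t).trace *
      quad (V S X (tau S X b t))⁻¹ (z X t) ≤
      2 * mu S X (tau S X b t) * (S.ν / S.σw ^ 2) *
        ((1 + b (tau S X b t)) * quad (V S X t)⁻¹ (z X t)) :=
    mul_le_mul (mul_le_mul_of_nonneg_left (htr.trans hS.trace_Pstar_le) (by positivity))
      (quad_V_inv_tau_le hS hb ht _) hq
      (mul_nonneg (by positivity) (div_nonneg hS.ν_pos.le hσ.le))
  have h8 : 2 * mu S X (tau S X b t) * (S.ν / S.σw ^ 2) *
        ((1 + b (tau S X b t)) * quad (V S X t)⁻¹ (z X t)) =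
      2 * S.ν / S.σw ^ 2 * ((1 + b (tau S X b t)) * mu S X (tau S X b t) *
        quad (V S X t)⁻¹ (z X t)) := by ring
  have h9 : Sum.elim (X.x t) (X.u t) = z X t := rfl
  rw [h9] at h6
  linarith

end Good

/-! ### The logarithmic scale -/

section LogTerm

variable {n m : ℕ} {S : Setup n m}

/-- `1 + log (t/δ)`. -/
noncomputable def logTerm (S : Setup n m) (t : ℕ) : ℝ := 1 + Real.log (t / S.δ)

lemma log_le_logTerm (t : ℕ) : Real.log (t / S.δ) ≤ logTerm S t := by rw [logTerm]; linarith

lemma one_le_logTerm (hS : S.Admissible) {t : ℕ} (ht : 1 ≤ t) : 1 ≤ logTerm S t := by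
  have := hS.log_pos ht
  rw [logTerm]; linarith

lemma logTerm_mono (hS : S.Admissible) {s t : ℕ} (hs : 1 ≤ s) (h : s ≤ t) :
    logTerm S s ≤ logTerm S t := add_le_add le_rfl (hS.log_mono hs h)

lemma log_natCast_le_logTerm (hS : S.Admissible) {t : ℕ} (ht : 1 ≤ t) :
    Real.log t ≤ logTerm S t := by
  have h1 : (0 : ℝ) < t := by exact_mod_cast ht
  rw [logTerm, Real.log_div h1.ne' hS.δ_pos.ne']
  linarith [Real.log_neg hS.δ_pos hS.δ_lt_one]

lemma logTerm_succ_le (hS : S.Admissible) {t : ℕ} (ht : 1 ≤ t) :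
    logTerm S (t + 1) ≤ 2 * logTerm S t := by
  have h1 : (1 : ℝ) ≤ t := by exact_mod_cast ht
  have h2 := hS.log_pos ht
  have h3 : Real.log ((t + 1 : ℕ) / S.δ) ≤ Real.log 2 + Real.log (t / S.δ) := by
    have := hS.δ_pos
    rw [← Real.log_mul (by norm_num) (by positivity)]
    refine Real.log_le_log (by positivity) ?_
    rw [← mul_div_assoc]
    refine div_le_div_of_nonneg_right ?_ hS.δ_pos.le
    push_cast; linarith
  have h4 := Real.log_two_lt_d9
  rw [logTerm, logTerm]
  linarith

end LogTerm

/-- A run of the algorithm for which the gains are accurate from time `t₀` on, the data up to time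
`t₀` are bounded, and the update thresholds lie between `0` and `β₁`. -/
structure TameRun {n m : ℕ} (S : Setup n m) (t₀ : ℕ) (D β₁ : ℝ) (X : Traj n m) (b : ℕ → ℝ) :
    Prop where
  run : IsRun S X b
  nonneg : ∀ τ, 1 ≤ τ → 0 ≤ b τ
  le : ∀ τ, 1 ≤ τ → b τ ≤ β₁
  cond : Cond0 S X t₀
  init : InitBound S X b t₀ D

/-! ### Logarithmic bounds for the states and the quantities derived from them -/

section StateBounds

variable {n m : ℕ} {S : Setup n m} {t₀ : ℕ} {D β₁ : ℝ} {X : Traj n m} {b : ℕ → ℝ}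

lemma sqNorm_disturbance_le {t : ℕ} (hg : Good S X t) (ht : 1 ≤ t) :
    sqNorm (S.B *ᵥ X.η t + X.w (t + 1)) ≤
      10 * S.σ ^ 2 * (n + m * S.κ ^ 2 * S.ϑ ^ 2) * logTerm S t :=
  (hg t ht le_rfl).2.1.trans (mul_le_mul_of_nonneg_left (log_le_logTerm t) (by positivity))

lemma sqNorm_perturbation_le {t : ℕ} (hg : Good S X t) (ht : 1 ≤ t) :
    sqNorm (X.η t) ≤ 10 * S.κ ^ 2 * S.σ ^ 2 * m * logTerm S t :=
  (hg t ht le_rfl).2.2.trans (mul_le_mul_of_nonneg_left (log_le_logTerm t) (by positivity))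

lemma IsRun.x_succ (hX : IsRun S X b) {t : ℕ} (ht : 1 ≤ t) :
    X.x (t + 1) = (S.A *ᵥ X.x t + S.B *ᵥ (K S X b t *ᵥ X.x t)) +
      (S.B *ᵥ X.η t + X.w (t + 1)) := by
  rw [hX.dyn t ht, hX.input t ht, Matrix.mulVec_add]
  abel

/-- A crude one-step estimate that needs bounded gains only. It also covers the initial phase, in
which the closed loop may be unstable. -/
lemma exists_growth_bound (hn : 0 < n) (hS : S.Admissible) (t₀ : ℕ) (D β₁ : ℝ) :
    ∃ C : ℝ, 0 < C ∧ ∀ X b, TameRun S t₀ D β₁ X b → ∀ t, 1 ≤ t → Good S X t →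
      sqNorm (X.x (t + 1)) ≤ C * (sqNorm (X.x t) + logTerm S t) ∧
      sqNorm (z X t) ≤ C * (sqNorm (X.x t) + logTerm S t) := by
  set k := D ^ 2 + S.κ ^ 2 with hk
  have hk0 : 0 ≤ k := by positivity
  set c₁ := 10 * S.σ ^ 2 * (n + m * S.κ ^ 2 * S.ϑ ^ 2) with hc₁
  have hc₁0 : 0 ≤ c₁ := by positivity
  set c₂ := 10 * S.κ ^ 2 * S.σ ^ 2 * m with hc₂
  have hc₂0 : 0 ≤ c₂ := by positivity
  refine ⟨1 + 2 * S.ϑ ^ 2 * (1 + k) + 2 * c₁ + 2 * k + 2 * c₂, by positivity,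
    fun X b hX t ht hg => ?_⟩
  have hH := one_le_logTerm hS ht
  have hx := sqNorm_nonneg (X.x t)
  have hK := hX.run.sqNorm_K_le hn hS hX.cond hX.init ht hg (X.x t)
  have hd := sqNorm_disturbance_le hg ht
  have hp := sqNorm_perturbation_le hg ht
  have hϑ := sq_nonneg S.ϑ
  rw [← hk] at hK
  rw [← hc₁] at hd
  rw [← hc₂] at hp
  have e : ∀ a : ℝ, 0 ≤ a → 0 ≤ a * sqNorm (X.x t) ∧ 0 ≤ a * logTerm S t := fun a ha =>
    ⟨mul_nonneg ha hx, mul_nonneg ha (by linarith)⟩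
  have e0 := e 1 zero_le_one
  have e1 := e (2 * S.ϑ ^ 2 * (1 + k)) (by positivity)
  have e2 := e c₁ hc₁0
  have e3 := e k hk0
  have e4 := e c₂ hc₂0
  constructor
  · rw [hX.run.x_succ ht, ← Theta_transpose_mulVec]
    have h1 := sqNorm_add_le (S.Thetaᵀ *ᵥ Sum.elim (X.x t) (K S X b t *ᵥ X.x t))
      (S.B *ᵥ X.η t + X.w (t + 1))
    have h2 := hS.sqNorm_Theta_le (Sum.elim (X.x t) (K S X b t *ᵥ X.x t))
    rw [sqNorm_sumElim] at h2
    have h3 := mul_le_mul_of_nonneg_left hK hϑ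
    linarith
  · rw [z, sqNorm_sumElim, hX.run.input t ht]
    have h1 := sqNorm_add_le (K S X b t *ᵥ X.x t) (X.η t)
    linarith

/-- Iteration of the growth bound over a fixed number of steps. The good event is required up to `t
- 1` only, since `x_t` involves no later disturbance. -/
lemma exists_initial_state_bound (hn : 0 < n) (hS : S.Admissible) (ht₀ : 1 ≤ t₀) (D β₁ : ℝ)
    (N : ℕ) : ∃ C : ℝ, 0 < C ∧ ∀ X b, TameRun S t₀ D β₁ X b → ∀ t, 1 ≤ t → t ≤ N + 1 →
      Good S X (t - 1) → sqNorm (X.x t) ≤ C := by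
  obtain ⟨c, hc, hgrow⟩ := exists_growth_bound hn hS t₀ D β₁
  induction N with
  | zero =>
    refine ⟨D ^ 2 + 1, by positivity, fun X b hX t ht ht' _ => ?_⟩
    obtain rfl : t = 1 := by omega
    linarith [hX.init.1 1 le_rfl ht₀]
  | succ N ih =>
    obtain ⟨C, hC, h⟩ := ih
    have hH := one_le_logTerm hS (show 1 ≤ N + 1 by omega)
    refine ⟨C + c * (C + logTerm S (N + 1)), by positivity, fun X b hX t ht ht' hg => ?_⟩
    have hpos : 0 < c * (C + logTerm S (N + 1)) := by positivity
    rcases Nat.lt_or_ge (N + 1) t with h1 | h1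
    · obtain rfl : t = N + 1 + 1 := by omega
      rw [Nat.add_sub_cancel] at hg
      have h2 := (hgrow X b hX (N + 1) (by omega) hg).1
      have h3 := h X b hX (N + 1) (by omega) le_rfl (hg.mono (by omega))
      have h4 := mul_le_mul_of_nonneg_left (add_le_add h3 (le_refl (logTerm S (N + 1)))) hc.le
      linarith
    · linarith [h X b hX t ht h1 hg]

lemma tendsto_lam (hS : S.Admissible) : Filter.Tendsto S.lam Filter.atTop Filter.atTop :=
  ((Real.tendsto_log_atTop.comp
    (tendsto_natCast_atTop_atTop.atTop_div_const hS.δ_pos))).const_mul_atTop hS.G_pos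

/-- From some time on, the policy in force has been computed after time `t₀`. -/
lemma exists_time_tau_ge (hn : 0 < n) (hS : S.Admissible) (ht₀ : 1 ≤ t₀) (D β₁ : ℝ) :
    ∃ t₁ : ℕ, t₀ ≤ t₁ ∧ ∀ X b, TameRun S t₀ D β₁ X b → ∀ t, 1 ≤ t → Good S X t →
      tau S X b t < t₀ → t < t₁ := by
  obtain ⟨c, hc, hgrow⟩ := exists_growth_bound hn hS t₀ D β₁
  -- A policy from before `t₀` can stay in force only while `det V_t ≤ M`, but `det V_t` is at least
  -- a power of `λ_t`, which is unbounded.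
  set M := (1 + β₁) * (S.lam t₀ + t₀ * |c * (D ^ 2 + logTerm S t₀)|) ^
    Fintype.card (Fin n ⊕ Fin m) with hM
  obtain ⟨t₁, ht₁⟩ := ((tendsto_lam hS).eventually_gt_atTop (max 1 M)).exists_forall_of_atTop
  refine ⟨max t₀ t₁, le_max_left _ _, fun X b hX t ht hg hτ => ?_⟩
  by_contra hlt
  rw [not_lt, max_le_iff] at hlt
  have hl := max_lt_iff.1 (ht₁ t hlt.2)
  have hτ1 := (one_le_tau_and_le S X b ht).1
  have h1 : (V S X (tau S X b t)).det ≤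
      (S.lam t₀ + t₀ * |c * (D ^ 2 + logTerm S t₀)|) ^ Fintype.card (Fin n ⊕ Fin m) := by
    refine (det_V_mono hS hτ1 hτ.le).trans (det_le_pow_of_quad_le (V_posDef hS X ht₀).posSemidef
      (quad_V_le fun s hs1 hs2 => ((hgrow X b hX s hs1 (hg.mono (by omega))).2.trans ?_)))
    exact mul_le_mul_of_nonneg_left
      (add_le_add (hX.init.1 s hs1 hs2.le) (logTerm_mono hS hs1 hs2.le)) hc.le
  have h2 := det_V_le_tau (X := X) hS hX.nonneg ht
  have h3 := lam_pow_le_det_V (X := X) hS ht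
  have h4 : S.lam t ≤ S.lam t ^ Fintype.card (Fin n ⊕ Fin m) :=
    le_self_pow₀ hl.1.le (by rw [Fintype.card_sum, Fintype.card_fin]; omega)
  have h5 : (1 + b (tau S X b t)) * (V S X (tau S X b t)).det ≤ M :=
    mul_le_mul (by linarith [hX.le _ hτ1]) h1 (V_posDef hS X hτ1).det_pos.le
      (by linarith [hX.le _ hτ1, hX.nonneg _ hτ1])
  linarith

/-- After a fixed time all gains in force contract the norm of `P_*` by the same factor `√ρ`, so
changes of policy do no harm, and disturbances of squared size `O(log t)` accumulate geometrically.
-/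
lemma exists_state_bound (hn : 0 < n) (hS : S.Admissible) (ht₀ : 1 ≤ t₀) (D β₁ : ℝ) :
    ∃ C : ℝ, 0 < C ∧ ∀ X b, TameRun S t₀ D β₁ X b → ∀ t, 1 ≤ t → Good S X (t - 1) →
      sqNorm (X.x t) ≤ C * logTerm S t := by
  obtain ⟨t₁, -, ht₁⟩ := exists_time_tau_ge hn hS ht₀ D β₁
  obtain ⟨C₀, hC₀, hinit⟩ := exists_initial_state_bound hn hS ht₀ D β₁ t₁
  have hα := hS.α₀_pos
  have hκ2 := hS.two_le_κ_sq hn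
  have hn' : (1 : ℝ) ≤ n := by exact_mod_cast hn
  have htr : 0 < S.Pstar.trace := by nlinarith [hS.trace_Pstar_ge]
  set ρ := 1 - 1 / S.κ ^ 2 with hρ
  have hρ1 : √ρ < 1 := by
    rw [Real.sqrt_lt' one_pos, hρ, one_pow]
    have : 0 < 1 / S.κ ^ 2 := by positivity
    linarith
  set c := S.Pstar.trace * (10 * S.σ ^ 2 * (n + m * S.κ ^ 2 * S.ϑ ^ 2)) with hc
  have hc0 : 0 ≤ c := by positivity
  -- The first summand makes `√ρ √M + √c ≤ √M`, so the bound propagates by one step; the second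
  -- makes `M` cover the initial phase.
  set M := (√c / (1 - √ρ) + √(S.Pstar.trace * C₀)) ^ 2 with hM
  have hρ2 : 0 < 1 - √ρ := by linarith
  have hMs : √M = √c / (1 - √ρ) + √(S.Pstar.trace * C₀) := Real.sqrt_sq (by positivity)
  have hM0 : S.Pstar.trace * C₀ ≤ M := by
    have h1 : √(S.Pstar.trace * C₀) ≤ √M := by
      rw [hMs]; linarith [div_nonneg (Real.sqrt_nonneg c) hρ2.le]
    exact (Real.sqrt_le_sqrt_iff (sq_nonneg _)).1 h1
  have hMpos : 0 < M := (mul_pos htr hC₀).trans_le hM0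
  have hMc : √ρ * √M + √c ≤ √M := by
    have h1 : √c ≤ (1 - √ρ) * √M := by
      rw [hMs, mul_add, mul_div_cancel₀ _ hρ2.ne']
      linarith [mul_nonneg hρ2.le (Real.sqrt_nonneg (S.Pstar.trace * C₀))]
    linarith
  refine ⟨M / S.α₀, div_pos hMpos hα, fun X b hX t ht hg => ?_⟩
  have key : ∀ t, 1 ≤ t → Good S X (t - 1) → quad S.Pstar (X.x t) ≤ M * logTerm S t := by
    intro t ht
    have hsmall : ∀ t, 1 ≤ t → t ≤ t₁ + 1 → Good S X (t - 1) →
        quad S.Pstar (X.x t) ≤ M * logTerm S t := fun t ht ht' hg => by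
      have h1 := hinit X b hX t ht ht' hg
      have h2 := quad_le_trace hS.riccati.1 (X.x t)
      have h3 := mul_le_mul_of_nonneg_left h1 htr.le
      nlinarith [one_le_logTerm hS ht]
    induction t, ht using Nat.le_induction with
    | base => exact hsmall 1 le_rfl (by omega)
    | succ t ht ih =>
      intro hg
      rw [Nat.add_sub_cancel] at hg
      rcases Nat.lt_or_ge t t₁ with h | h
      · exact hsmall (t + 1) (by omega) (by omega) hg
      · have hτ : t₀ ≤ tau S X b t := by
          by_contra hlt
          exact absurd (ht₁ X b hX t ht hg (not_le.1 hlt)) (not_lt.2 h)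
        have hH := one_le_logTerm hS ht
        have h1 := (hX.run.gain_stable hn hS hX.cond ht hg hτ (X.x t)).1
        have h2 := ih (hg.mono (by omega))
        have h3 : quad S.Pstar (S.B *ᵥ X.η t + X.w (t + 1)) ≤ c * logTerm S t := by
          rw [hc, mul_assoc]
          exact (quad_le_trace hS.riccati.1 _).trans
            (mul_le_mul_of_nonneg_left (sqNorm_disturbance_le hg ht) htr.le)
        have h4 := sqrt_quad_add_le hS.riccati.1
          (S.A *ᵥ X.x t + S.B *ᵥ (K S X b t *ᵥ X.x t)) (S.B *ᵥ X.η t + X.w (t + 1))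
        rw [← hX.run.x_succ ht] at h4
        have hρ0 : 0 ≤ ρ := by
          rw [hρ, sub_nonneg, div_le_one (by positivity)]; linarith
        have h5 : √(quad S.Pstar (S.A *ᵥ X.x t + S.B *ᵥ (K S X b t *ᵥ X.x t))) ≤
            √ρ * √M * √(logTerm S t) := by
          rw [← Real.sqrt_mul hρ0, ← Real.sqrt_mul (mul_nonneg hρ0 hMpos.le), mul_assoc]
          exact Real.sqrt_le_sqrt (h1.trans (mul_le_mul_of_nonneg_left h2 hρ0))
        have h6 : √(quad S.Pstar (S.B *ᵥ X.η t + X.w (t + 1))) ≤ √c * √(logTerm S t) := by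
          rw [← Real.sqrt_mul hc0]; exact Real.sqrt_le_sqrt h3
        have h7 : √(quad S.Pstar (X.x (t + 1))) ≤ √(M * logTerm S t) := by
          rw [Real.sqrt_mul hMpos.le]
          have := mul_le_mul_of_nonneg_right hMc (Real.sqrt_nonneg (logTerm S t))
          linarith
        have h8 : quad S.Pstar (X.x (t + 1)) ≤ M * logTerm S t :=
          (Real.sqrt_le_sqrt_iff (by positivity)).1 h7
        exact h8.trans (mul_le_mul_of_nonneg_left (logTerm_mono hS ht (Nat.le_succ t)) hMpos.le)
  rw [div_mul_eq_mul_div, le_div_iff₀ hα, mul_comm]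
  exact (hS.le_quad_Pstar _).trans (key t ht hg)

lemma exists_z_bound (hn : 0 < n) (hS : S.Admissible) (ht₀ : 1 ≤ t₀) (D β₁ : ℝ) :
    ∃ C : ℝ, 0 < C ∧ ∀ X b, TameRun S t₀ D β₁ X b → ∀ t, 1 ≤ t → Good S X t →
      sqNorm (z X t) ≤ C * logTerm S t := by
  obtain ⟨c, hc, hgrow⟩ := exists_growth_bound hn hS t₀ D β₁
  obtain ⟨C, hC, hx⟩ := exists_state_bound hn hS ht₀ D β₁
  refine ⟨c * (C + 1), by positivity, fun X b hX t ht hg => ?_⟩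
  have h1 := (hgrow X b hX t ht hg).2
  have h2 := hx X b hX t ht (hg.mono (by omega))
  nlinarith [mul_le_mul_of_nonneg_left h2 hc.le]

lemma exists_quad_V_bound (hn : 0 < n) (hS : S.Admissible) (ht₀ : 1 ≤ t₀) (D β₁ : ℝ) :
    ∃ C : ℝ, 0 < C ∧ ∀ X b, TameRun S t₀ D β₁ X b → ∀ t, 1 ≤ t → Good S X (t - 1) → ∀ v,
      quad (V S X t) v ≤ C * t * logTerm S t * sqNorm v := by
  obtain ⟨c, hc, hz⟩ := exists_z_bound hn hS ht₀ D β₁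
  have hG := hS.G_pos
  refine ⟨S.G + c, by positivity, fun X b hX t ht hg v => ?_⟩
  have hH := one_le_logTerm hS ht
  have ht1 : (1 : ℝ) ≤ t := by exact_mod_cast ht
  refine (quad_V_le (c := c * logTerm S t) (fun s h1 h2 => ?_) v).trans
    (mul_le_mul_of_nonneg_right ?_ (sqNorm_nonneg v))
  · exact (hz X b hX s h1 (hg.mono (by omega))).trans
      (mul_le_mul_of_nonneg_left (logTerm_mono hS h1 h2.le) hc.le)
  · rw [abs_of_pos (by positivity)]
    have h1 : S.lam t ≤ S.G * logTerm S t :=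
      mul_le_mul_of_nonneg_left (log_le_logTerm t) hG.le
    have h2 : S.G * logTerm S t ≤ S.G * logTerm S t * t := le_mul_of_one_le_right (by positivity) ht1
    linarith

lemma exists_log_det_V_bound (hn : 0 < n) (hS : S.Admissible) (ht₀ : 1 ≤ t₀) (D β₁ : ℝ) :
    ∃ C : ℝ, 0 < C ∧ ∀ X b, TameRun S t₀ D β₁ X b → ∀ t, 1 ≤ t → Good S X (t - 1) →
      Real.log (V S X t).det ≤ C * logTerm S t := by
  obtain ⟨c, hc, hV⟩ := exists_quad_V_bound hn hS ht₀ D β₁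
  refine ⟨Fintype.card (Fin n ⊕ Fin m) * (|Real.log c| + 2) + 1, by positivity,
    fun X b hX t ht hg => ?_⟩
  have hH := one_le_logTerm hS ht
  have ht1 : (1 : ℝ) ≤ t := by exact_mod_cast ht
  have h1 := det_le_pow_of_quad_le (V_posDef hS X ht).posSemidef (hV X b hX t ht hg)
  have h2 := Real.log_le_log (V_posDef hS X ht).det_pos h1
  rw [Real.log_pow, Real.log_mul (by positivity) (by positivity),
    Real.log_mul (by positivity) (by positivity)] at h2
  have h3 : Real.log c + Real.log t + Real.log (logTerm S t) ≤
      (|Real.log c| + 2) * logTerm S t := by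
    have h4 := log_natCast_le_logTerm hS ht
    have h5 := Real.log_le_sub_one_of_pos (show 0 < logTerm S t by linarith)
    have h6 := le_abs_self (Real.log c)
    have h7 := le_mul_of_one_le_right (abs_nonneg (Real.log c)) hH
    linarith
  have h8 := mul_le_mul_of_nonneg_left h3
    (Nat.cast_nonneg (α := ℝ) (Fintype.card (Fin n ⊕ Fin m)))
  linarith

/-- From `(a + b)² ≤ 2a² + 2b²`; the absolute values also cover negative arguments, whose square
root is zero. -/
lemma r_le {t : ℕ} :
    r S X t ≤ 4 * S.σ ^ 2 * n * |Real.log (n * (V S X t).det /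
      (S.δ * (S.lam t • (1 : Matrix (Fin n ⊕ Fin m) (Fin n ⊕ Fin m) ℝ)).det))| +
      2 * |S.lam t| * S.ε ^ 2 := by
  set l := Real.log (n * (V S X t).det /
      (S.δ * (S.lam t • (1 : Matrix (Fin n ⊕ Fin m) (Fin n ⊕ Fin m) ℝ)).det)) with hl
  have h1 : √(2 * n * l) ^ 2 ≤ 2 * n * |l| := by
    rcases le_total 0 l with h | h
    · rw [Real.sq_sqrt (by positivity), abs_of_nonneg h]
    · rw [Real.sqrt_eq_zero_of_nonpos (mul_nonpos_of_nonneg_of_nonpos (by positivity) h),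
        zero_pow two_ne_zero]
      positivity
  have h2 : √(S.lam t) ^ 2 ≤ |S.lam t| := by
    rcases le_total 0 (S.lam t) with h | h
    · rw [Real.sq_sqrt h, abs_of_nonneg h]
    · rw [Real.sqrt_eq_zero_of_nonpos h, zero_pow two_ne_zero]; positivity
  rw [r, ← hl]
  have h3 := mul_le_mul_of_nonneg_left h1 (sq_nonneg S.σ)
  have h4 := mul_le_mul_of_nonneg_right h2 (sq_nonneg S.ε)
  nlinarith [sq_nonneg (S.σ * √(2 * n * l) - √(S.lam t) * S.ε)]

lemma exists_r_bound (hn : 0 < n) (hS : S.Admissible) (ht₀ : 1 ≤ t₀) (D β₁ : ℝ) :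
    ∃ C : ℝ, 0 < C ∧ ∀ X b, TameRun S t₀ D β₁ X b → ∀ t, 1 ≤ t → Good S X (t - 1) →
      r S X t ≤ C * logTerm S t := by
  obtain ⟨c, hc, hV⟩ := exists_log_det_V_bound hn hS ht₀ D β₁
  have hn' : (0 : ℝ) < n := by exact_mod_cast hn
  have hδ := hS.δ_pos
  have hG := hS.G_pos
  set d := Fintype.card (Fin n ⊕ Fin m) with hd
  set a := |Real.log (n / S.δ)| + c + d * |Real.log (S.lam 1)| with ha
  have ha0 : 0 < a := by positivity
  refine ⟨4 * S.σ ^ 2 * n * a + 2 * S.G * S.ε ^ 2 + 1, by positivity, fun X b hX t ht hg => ?_⟩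
  have hH := one_le_logTerm hS ht
  have hdet := (V_posDef hS X ht).det_pos
  have hlam := hS.lam_pos ht
  have h1 : |Real.log (n * (V S X t).det /
      (S.δ * (S.lam t • (1 : Matrix (Fin n ⊕ Fin m) (Fin n ⊕ Fin m) ℝ)).det))| ≤
      a * logTerm S t := by
    rw [det_lam_smul, ← hd, mul_div_mul_comm, Real.log_mul (by positivity) (by positivity),
      Real.log_div hdet.ne' (by positivity), Real.log_pow]
    have h2 := hV X b hX t ht hg
    have h3 := Real.log_le_log (by positivity) (lam_pow_le_det_V (X := X) hS ht)
    rw [← hd, Real.log_pow] at h3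
    have h4 := Real.log_le_log (hS.lam_pos le_rfl) (hS.lam_mono le_rfl ht)
    have h5 : (d : ℝ) * -|Real.log (S.lam 1)| ≤ d * Real.log (S.lam t) :=
      mul_le_mul_of_nonneg_left ((neg_abs_le _).trans h4) (by positivity)
    have h6 : 0 ≤ |Real.log (n / S.δ)| := abs_nonneg _
    have h7 : 0 ≤ d * |Real.log (S.lam 1)| := by positivity
    have h8 : |Real.log (V S X t).det - d * Real.log (S.lam t)| ≤
        c * logTerm S t + d * |Real.log (S.lam 1)| := by
      rw [abs_of_nonneg (by linarith)]; linarith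
    have h9 := abs_add_le (Real.log (n / S.δ)) (Real.log (V S X t).det - d * Real.log (S.lam t))
    have h10 := le_mul_of_one_le_right h6 hH
    have h11 := le_mul_of_one_le_right h7 hH
    linarith
  have h2 : |S.lam t| ≤ S.G * logTerm S t := by
    rw [abs_of_pos hlam]; exact mul_le_mul_of_nonneg_left (log_le_logTerm t) hG.le
  have h3 := mul_le_mul_of_nonneg_left h1 (show 0 ≤ 4 * S.σ ^ 2 * n by positivity)
  have h4 := mul_le_mul_of_nonneg_right h2 (sq_nonneg S.ε)
  linarith [r_le (S := S) (X := X) (t := t)]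

/-- The growth comes from the factor `√‖V_t‖` alone: `r_t` is logarithmic and `‖V_t‖` is of order
`t` up to a logarithm. -/
lemma exists_mu_bound (hn : 0 < n) (hS : S.Admissible) (ht₀ : 1 ≤ t₀) (D β₁ : ℝ) :
    ∃ C : ℝ, 0 < C ∧ ∀ X b, TameRun S t₀ D β₁ X b → ∀ t, 1 ≤ t → Good S X (t - 1) →
      mu S X t ≤ C * √t * logTerm S t := by
  obtain ⟨c, hc, hr⟩ := exists_r_bound hn hS ht₀ D β₁
  obtain ⟨v, hv, hV⟩ := exists_quad_V_bound hn hS ht₀ D β₁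
  have hϑ := hS.ϑ_pos
  refine ⟨c + 2 * S.ϑ * √c * √v, by positivity, fun X b hX t ht hg => ?_⟩
  have hH := one_le_logTerm hS ht
  have ht1 : (1 : ℝ) ≤ t := by exact_mod_cast ht
  have h1 := hr X b hX t ht hg
  have h2 : ‖V S X t‖ ≤ v * t * logTerm S t :=
    norm_le_of_quad_le (V_posDef hS X ht).posSemidef (hV X b hX t ht hg) (by positivity)
  have h3 : √(r S X t) * √‖V S X t‖ ≤ √c * √v * √t * logTerm S t := by
    calc √(r S X t) * √‖V S X t‖ ≤ √(c * logTerm S t) * √(v * t * logTerm S t) :=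
          mul_le_mul (Real.sqrt_le_sqrt h1) (Real.sqrt_le_sqrt h2) (Real.sqrt_nonneg _)
            (Real.sqrt_nonneg _)
      _ = √c * √v * √t * (√(logTerm S t) * √(logTerm S t)) := by
          rw [Real.sqrt_mul hc.le, Real.sqrt_mul (by positivity), Real.sqrt_mul hv.le]; ring
      _ = _ := by rw [Real.mul_self_sqrt (by linarith)]
  have h4 : c * logTerm S t ≤ c * √t * logTerm S t := by
    have : 1 ≤ √(t : ℝ) := Real.one_le_sqrt.2 ht1
    have := le_mul_of_one_le_right (show 0 ≤ c * logTerm S t by positivity) this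
    linarith
  have h5 := mul_le_mul_of_nonneg_left h3 (show 0 ≤ 2 * S.ϑ by positivity)
  rw [mu]
  linarith

/-- Elliptical potential argument: `x ≤ (1 + q) log (1 + x)` for `0 ≤ x ≤ q`, and the logarithms
telescope to `log det V`. The uniform bound `q` on the terms exists because `|z_t|²` is at most
logarithmic while `λ_t` grows logarithmically. -/
lemma exists_sum_quad_inv_bound (hn : 0 < n) (hS : S.Admissible) (ht₀ : 1 ≤ t₀) (D β₁ : ℝ) :
    ∃ C : ℝ, 0 < C ∧ ∀ X b, TameRun S t₀ D β₁ X b → ∀ T, 1 ≤ T → Good S X T →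
      ∑ t ∈ Finset.Icc 1 T, quad (V S X t)⁻¹ (z X t) ≤ C * logTerm S T := by
  obtain ⟨c, hc, hz⟩ := exists_z_bound hn hS ht₀ D β₁
  obtain ⟨v, hv, hV⟩ := exists_log_det_V_bound hn hS ht₀ D β₁
  have hG := hS.G_pos
  set L := Real.log ((1 : ℕ) / S.δ) with hL
  have hL0 : 0 < L := hS.log_pos le_rfl
  set q := c * (1 + 1 / L) / S.G with hq
  have hq0 : 0 < q := by positivity
  set e := |Real.log (S.lam 1 ^ Fintype.card (Fin n ⊕ Fin m))| with he
  refine ⟨(1 + q) * (2 * v + e), by positivity, fun X b hX T hT hg => ?_⟩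
  have hstep : ∀ t, 1 ≤ t → t ≤ T → quad (V S X t)⁻¹ (z X t) ≤
      (1 + q) * (Real.log (V S X (t + 1)).det - Real.log (V S X t).det) := by
    intro t ht htT
    have hdet := (V_posDef hS X ht).det_pos
    have h0 : 0 ≤ quad (V S X t)⁻¹ (z X t) :=
      quad_nonneg (V_posDef hS X ht).inv.posSemidef _
    have h1 : quad (V S X t)⁻¹ (z X t) ≤ q := by
      refine (quad_inv_le_of_smul_le (V_posDef hS X ht) (hS.lam_pos ht) le_quad_V _).trans ?_
      rw [div_le_iff₀ (hS.lam_pos ht)]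
      refine (hz X b hX t ht (hg.mono htT)).trans ?_
      have h2 : q * S.lam t = c * ((1 + 1 / L) * Real.log (t / S.δ)) := by
        rw [hq, Setup.lam]; field_simp
      rw [h2]
      refine mul_le_mul_of_nonneg_left ?_ hc.le
      have h3 : L ≤ Real.log (t / S.δ) := hS.log_mono le_rfl ht
      have h4 : 1 ≤ 1 / L * Real.log (t / S.δ) := by
        rw [div_mul_eq_mul_div, one_mul, le_div_iff₀ hL0]; linarith
      rw [logTerm]; linarith
    have h2 := Real.log_le_log (by positivity) (det_V_mul_le_det_V_succ (X := X) hS ht)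
    rw [Real.log_mul hdet.ne' (by positivity)] at h2
    have h3 := Real.one_sub_inv_le_log_of_pos (show 0 < 1 + quad (V S X t)⁻¹ (z X t) by positivity)
    have h4 : quad (V S X t)⁻¹ (z X t) ≤
        (1 + q) * (1 - (1 + quad (V S X t)⁻¹ (z X t))⁻¹) := by
      have h5 : 1 - (1 + quad (V S X t)⁻¹ (z X t))⁻¹ =
          quad (V S X t)⁻¹ (z X t) / (1 + quad (V S X t)⁻¹ (z X t)) := by
        field_simp; ring
      rw [h5, mul_div_assoc', le_div_iff₀ (by positivity)]
      nlinarith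
    refine h4.trans (mul_le_mul_of_nonneg_left ?_ (by positivity))
    linarith
  have hsum : ∀ T', T' ≤ T → ∑ t ∈ Finset.Icc 1 T', quad (V S X t)⁻¹ (z X t) ≤
      (1 + q) * (Real.log (V S X (T' + 1)).det - Real.log (V S X 1).det) := by
    intro T'
    induction T' with
    | zero => simp
    | succ N ih =>
      intro hN
      rw [Finset.sum_Icc_succ_top (by omega)]
      linarith [ih (by omega), hstep (N + 1) (by omega) hN]
  have hH := one_le_logTerm hS hT
  have h1 := hV X b hX (T + 1) (by omega) hg
  have h2 := mul_le_mul_of_nonneg_left (logTerm_succ_le hS hT) hv.le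
  have h3 : -e ≤ Real.log (V S X 1).det :=
    (neg_abs_le _).trans (Real.log_le_log (pow_pos (hS.lam_pos le_rfl) _)
      (lam_pow_le_det_V (X := X) hS le_rfl))
  have h4 := le_mul_of_one_le_right (show 0 ≤ e from abs_nonneg _) hH
  refine (hsum T le_rfl).trans ?_
  rw [mul_assoc]
  refine mul_le_mul_of_nonneg_left ?_ (by positivity)
  linarith

end StateBounds

/-! ### Decomposition of the regret -/

section Regret

variable {n m : ℕ} {S : Setup n m} {t₀ : ℕ} {D β₁ : ℝ} {X : Traj n m} {b : ℕ → ℝ}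

lemma Setup.Admissible.trace_Pstar_pos (hn : 0 < n) (hS : S.Admissible) : 0 < S.Pstar.trace := by
  have hn' : (0 : ℝ) < n := by exact_mod_cast hn
  exact (mul_pos hn' hS.α₀_pos).trans_le hS.trace_Pstar_ge

lemma quad_inv_V_nonneg (hS : S.Admissible) {t : ℕ} (ht : 1 ≤ t) (v : Fin n ⊕ Fin m → ℝ) :
    0 ≤ quad (V S X t)⁻¹ v := quad_nonneg (V_posDef hS X ht).inv.posSemidef v

/-- Under a policy computed before time `t₀`, which is in force for a bounded time only, the regret
of a step exceeds the corresponding terms of the decomposition by a constant at most. -/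
lemma exists_initial_step_regret_le (hn : 0 < n) (hS : S.Admissible) (ht₀ : 1 ≤ t₀) (D β₁ : ℝ)
    (t₁ : ℕ) :
    ∃ C : ℝ, 0 < C ∧ ∀ X b, TameRun S t₀ D β₁ X b → ∀ t, 1 ≤ t → t ≤ t₁ → Good S X t →
      quad S.Q (X.x t) + quad S.R (X.u t) - S.Jstar ≤
      quad (PP S X b t) (X.x t) - quad (PP S X b t) (S.A *ᵥ X.x t + S.B *ᵥ X.u t) -
        S.σw ^ 2 * (PP S X b t).trace +
      2 * S.ν / S.σw ^ 2 * ((1 + b (tau S X b t)) * mu S X (tau S X b t) *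
        quad (V S X t)⁻¹ (z X t)) + quad (S.R + S.Bᵀ * PP S X b t * S.B) (X.η t) + C := by
  obtain ⟨c, hc, hz⟩ := exists_z_bound hn hS ht₀ D β₁
  have htr := hS.trace_Pstar_pos hn
  have hσ : 0 < S.σw ^ 2 := pow_pos hS.σw_pos 2
  have hν := hS.ν_pos
  refine ⟨|S.α₁| * (c * |logTerm S t₁|) + S.Pstar.trace * (S.ϑ ^ 2 * (c * |logTerm S t₁|))
    + S.σw ^ 2 * S.Pstar.trace, by positivity, fun X b hX t ht htt hg => ?_⟩
  have hP := hX.run.posSemidef_PP hn hS ht hg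
  have hPtr := hX.run.trace_PP_le hn hS ht hg
  have hτ := one_le_tau_and_le S X b ht
  have h0 : sqNorm (z X t) ≤ c * |logTerm S t₁| :=
    (hz X b hX t ht hg).trans (mul_le_mul_of_nonneg_left
      ((logTerm_mono hS ht htt).trans (le_abs_self _)) hc.le)
  have hz0 := sqNorm_nonneg (z X t)
  have h1 : quad S.Q (X.x t) + quad S.R (X.u t) ≤ |S.α₁| * (c * |logTerm S t₁|) := by
    have h2 := hS.quad_Q_le (X.x t)
    have h3 := hS.quad_R_le (X.u t)
    have h4 : sqNorm (z X t) = sqNorm (X.x t) + sqNorm (X.u t) := sqNorm_sumElim _ _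
    have h5 := mul_le_mul_of_nonneg_right (le_abs_self S.α₁) hz0
    have h6 := mul_le_mul_of_nonneg_left h0 (abs_nonneg S.α₁)
    rw [h4] at h5 h6
    linarith
  have h2 : quad (PP S X b t) (S.A *ᵥ X.x t + S.B *ᵥ X.u t) ≤
      S.Pstar.trace * (S.ϑ ^ 2 * (c * |logTerm S t₁|)) := by
    refine (quad_le_trace hP _).trans (mul_le_mul hPtr ?_ (sqNorm_nonneg _) htr.le)
    rw [← Theta_transpose_mulVec]
    exact (hS.sqNorm_Theta_le _).trans (mul_le_mul_of_nonneg_left h0 (sq_nonneg _))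
  have h3 := mul_le_mul_of_nonneg_left hPtr hσ.le
  have h4 : 0 ≤ S.Jstar := by rw [Setup.Jstar, trace_mul_W]; positivity
  have h5 := quad_nonneg hP (X.x t)
  have h6 : 0 ≤ quad (S.R + S.Bᵀ * PP S X b t * S.B) (X.η t) := by
    rw [quad_add, quad_conj]
    have h7 := hS.le_quad_R (X.η t)
    have h8 := mul_nonneg hS.α₀_pos.le (sqNorm_nonneg (X.η t))
    linarith [quad_nonneg hP (S.B *ᵥ X.η t)]
  have h7 : 0 ≤ 2 * S.ν / S.σw ^ 2 * ((1 + b (tau S X b t)) * mu S X (tau S X b t) *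
        quad (V S X t)⁻¹ (z X t)) := by
    have h8 := hX.nonneg _ hτ.1
    have h9 := mu_nonneg (X := X) hS (tau S X b t)
    have h10 := quad_inv_V_nonneg (X := X) hS ht (z X t)
    positivity
  linarith

/-- The one-step inequality is summed. Expanding the form at `x_{t+1} = A x_t + B u_t + w_{t+1}`
produces the terms of `R₂` and `R₃`, and the finitely many steps under early policies add a
constant. -/
lemma exists_regret_bound (hn : 0 < n) (hS : S.Admissible) (ht₀ : 1 ≤ t₀) (D β₁ : ℝ) :
    ∃ C : ℝ, 0 < C ∧ ∀ X b, TameRun S t₀ D β₁ X b → ∀ T, Good S X T →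
      regret S X T ≤ R1 S X b T + R2 S X b T + R3 S X b T + R4 S X b T + R5 S X b T + C := by
  obtain ⟨t₁, -, ht₁⟩ := exists_time_tau_ge hn hS ht₀ D β₁
  obtain ⟨c, hc, hinit⟩ := exists_initial_step_regret_le hn hS ht₀ D β₁ t₁
  refine ⟨t₁ * c + 1, by positivity, fun X b hX T hg => ?_⟩
  rw [R1, R2, R3, R4, R5, goodSum_of_good hg, goodSum_of_good hg, goodSum_of_good hg,
    goodSum_of_good hg, goodSum_of_good hg, Finset.mul_sum, ← Finset.sum_add_distrib,
    ← Finset.sum_add_distrib, ← Finset.sum_add_distrib, ← Finset.sum_add_distrib, regret]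
  have hcount : ∑ t ∈ Finset.Icc 1 T, (if t < t₁ then c else 0) ≤ t₁ * c := by
    rw [← Finset.sum_filter, Finset.sum_const, nsmul_eq_mul]
    refine mul_le_mul_of_nonneg_right ?_ hc.le
    have h : (Finset.Icc 1 T).filter (· < t₁) ⊆ Finset.range t₁ := fun t ht =>
      Finset.mem_range.2 (Finset.mem_filter.1 ht).2
    exact_mod_cast (Finset.card_le_card h).trans (Finset.card_range t₁).le
  refine le_trans (Finset.sum_le_sum (g := fun t => _ + if t < t₁ then c else 0) fun t ht => ?_)
    ((Finset.sum_add_distrib).le.trans (add_le_add le_rfl (hcount.trans (by linarith))))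
  obtain ⟨ht1, htT⟩ := Finset.mem_Icc.1 ht
  have hgt := hg.mono htT
  have hP := hX.run.posSemidef_PP hn hS ht1 hgt
  have hsym := transpose_eq_of_posSemidef hP
  have hexp : quad (PP S X b t) (X.x (t + 1)) =
      quad (PP S X b t) (S.A *ᵥ X.x t + S.B *ᵥ X.u t) +
      2 * (X.w (t + 1) ⬝ᵥ (PP S X b t *ᵥ (S.A *ᵥ X.x t + S.B *ᵥ X.u t))) +
      quad (PP S X b t) (X.w (t + 1)) := by
    rw [hX.run.dyn t ht1, quad_add_vec hsym, dot_mulVec_comm hsym]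
  rw [hexp]
  rcases Nat.lt_or_ge (tau S X b t) t₀ with hτ | hτ
  · have h1 := ht₁ X b hX t ht1 hgt hτ
    rw [if_pos h1]
    linarith [hinit X b hX t ht1 h1.le hgt]
  · have h1 := hX.run.step_regret_le hn hS hX.nonneg hX.cond ht1 hgt hτ
    have h2 : (0 : ℝ) ≤ if t < t₁ then c else 0 := by split_ifs <;> linarith
    linarith

/-- Between updates the sum telescopes; each update leaves one value `x_tᵀ P_t x_t`, of order `log
T` by the state bound and `tr P_t ≤ tr P_*`. -/
lemma exists_R1_bound (hn : 0 < n) (hS : S.Admissible) (ht₀ : 1 ≤ t₀) (D β₁ : ℝ) :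
    ∃ C : ℝ, 0 < C ∧ ∀ X b, TameRun S t₀ D β₁ X b → ∀ T, 1 ≤ T → Good S X T →
      R1 S X b T ≤ C * logTerm S T * numUpdates S X b T := by
  obtain ⟨c, hc, hx⟩ := exists_state_bound hn hS ht₀ D β₁
  have htr := hS.trace_Pstar_pos hn
  refine ⟨S.Pstar.trace * c, by positivity, fun X b hX T hT hg => ?_⟩
  have hb : ∀ t, 1 ≤ t → t ≤ T →
      quad (PP S X b t) (X.x t) ≤ S.Pstar.trace * c * logTerm S T := fun t ht htT => by
    have h1 := quad_le_trace (hX.run.posSemidef_PP hn hS ht (hg.mono htT)) (X.x t)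
    have h2 := hX.run.trace_PP_le hn hS ht (hg.mono htT)
    have h3 := (hx X b hX t ht (hg.mono (by omega))).trans
      (mul_le_mul_of_nonneg_left (logTerm_mono hS ht htT) hc.le)
    rw [mul_assoc]
    exact h1.trans (mul_le_mul h2 h3 (sqNorm_nonneg _) htr.le)
  rw [R1, goodSum_of_good hg]
  -- The induction keeps the last telescoping term on the left: it cancels if the policy is kept,
  -- and is dropped by nonnegativity at an update.
  have key : ∀ t, 1 ≤ t → t ≤ T → ∑ s ∈ Finset.Icc 1 t,
      (quad (PP S X b s) (X.x s) - quad (PP S X b s) (X.x (s + 1))) +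
        quad (PP S X b t) (X.x (t + 1)) ≤
      S.Pstar.trace * c * logTerm S T * numUpdates S X b t := by
    intro t ht
    induction t, ht using Nat.le_induction with
    | base =>
      intro _
      rw [Finset.Icc_self, Finset.sum_singleton, numUpdates_one, Nat.cast_one, mul_one]
      linarith [hb 1 le_rfl hT]
    | succ t ht ih =>
      intro htT
      have h1 := ih (by omega)
      have hlt := (one_le_tau_and_le S X b ht).2
      rw [Finset.sum_Icc_succ_top (by omega), numUpdates_succ]
      rcases tau_succ S X b ht with ⟨h, -⟩ | ⟨h, -⟩
      · rw [if_pos h]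
        have h2 := quad_nonneg (hX.run.posSemidef_PP hn hS ht (hg.mono (by omega))) (X.x (t + 1))
        push_cast
        linarith [hb (t + 1) (by omega) htT]
      · have h2 : PP S X b (t + 1) = PP S X b t := by rw [PP, PP, h]
        rw [if_neg (by omega), h2, add_zero]
        linarith
  have h1 := quad_nonneg (hX.run.posSemidef_PP hn hS hT hg) (X.x (T + 1))
  linarith [key T hT le_rfl]

/-- The difference is a sum of `β_τ μ_τ z_tᵀ V_t⁻¹ z_t`, to which the elliptical potential bound
applies once `β_τ μ_τ ≤ g`. -/
lemma exists_R4_sub_R4free_bound (hn : 0 < n) (hS : S.Admissible) (ht₀ : 1 ≤ t₀) (D β₁ : ℝ) :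
    ∃ C : ℝ, 0 < C ∧ ∀ X b, TameRun S t₀ D β₁ X b → ∀ T, 1 ≤ T → Good S X T → ∀ g : ℝ,
      (∀ τ, 1 ≤ τ → τ ≤ T → b τ * mu S X τ ≤ g) →
      R4 S X b T ≤ R4free S X b T + C * logTerm S T * g := by
  obtain ⟨c, hc, hsum⟩ := exists_sum_quad_inv_bound hn hS ht₀ D β₁
  have hσ : 0 < S.σw ^ 2 := pow_pos hS.σw_pos 2
  have hν := hS.ν_pos
  refine ⟨2 * S.ν / S.σw ^ 2 * c, by positivity, fun X b hX T hT hg g hbg => ?_⟩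
  have hg0 : 0 ≤ g :=
    (mul_nonneg (hX.nonneg 1 le_rfl) (mu_nonneg hS 1)).trans (hbg 1 le_rfl hT)
  rw [R4, R4free, goodSum_of_good hg, goodSum_of_good hg,
    show 2 * S.ν / S.σw ^ 2 * c * logTerm S T * g =
      2 * S.ν / S.σw ^ 2 * (g * (c * logTerm S T)) by ring, ← mul_add]
  refine mul_le_mul_of_nonneg_left ?_ (by positivity)
  have h1 := mul_le_mul_of_nonneg_left (hsum X b hX T hT hg) hg0
  rw [Finset.mul_sum] at h1
  refine le_trans ?_ (add_le_add le_rfl h1)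
  rw [← Finset.sum_add_distrib]
  refine Finset.sum_le_sum fun t ht => ?_
  obtain ⟨ht1, htT⟩ := Finset.mem_Icc.1 ht
  have hτ := one_le_tau_and_le S X b ht1
  have h2 := mul_le_mul_of_nonneg_right (hbg _ hτ.1 (hτ.2.trans htT))
    (quad_inv_V_nonneg (X := X) hS ht1 (z X t))
  linarith

/-- The excess of the regret and of `R₁ + R₄` over the terms that do not depend on the update rule,
in terms of the number of updates and of a bound `g` of `β_τ μ_τ`. -/
lemma exists_excess_bound (hn : 0 < n) (hS : S.Admissible) (ht₀ : 1 ≤ t₀) (D β₁ : ℝ) :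
    ∃ C : ℝ, 0 < C ∧ ∀ X b, TameRun S t₀ D β₁ X b → ∀ T, 1 ≤ T → Good S X T → ∀ g : ℝ,
      (∀ τ, 1 ≤ τ → τ ≤ T → b τ * mu S X τ ≤ g) →
      R1 S X b T + R4 S X b T ≤ R4free S X b T + C * logTerm S T * (numUpdates S X b T + g) ∧
      regret S X T ≤ R2 S X b T + R3 S X b T + R4free S X b T + R5 S X b T +
        C * logTerm S T * (numUpdates S X b T + g) := by
  obtain ⟨c, hc, h1⟩ := exists_R1_bound hn hS ht₀ D β₁
  obtain ⟨d, hd, h4⟩ := exists_R4_sub_R4free_bound hn hS ht₀ D β₁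
  obtain ⟨e, he, hr⟩ := exists_regret_bound hn hS ht₀ D β₁
  refine ⟨c + d + e, by positivity, fun X b hX T hT hg g hbg => ?_⟩
  have hg0 : 0 ≤ g :=
    (mul_nonneg (hX.nonneg 1 le_rfl) (mu_nonneg hS 1)).trans (hbg 1 le_rfl hT)
  have hH := one_le_logTerm hS hT
  -- The computation at time `1` counts as an update, which lets the additive constant be absorbed.
  have hN : (1 : ℝ) ≤ numUpdates S X b T := by
    have : 1 ≤ numUpdates S X b T := by
      rw [numUpdates, Nat.one_le_iff_ne_zero, ← Nat.pos_iff_ne_zero, Finset.card_pos]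
      exact ⟨1, Finset.mem_filter.2 ⟨Finset.mem_Icc.2 ⟨le_rfl, hT⟩, tau_one S X b⟩⟩
    exact_mod_cast this
  have e1 := h1 X b hX T hT hg
  have e2 := h4 X b hX T hT hg g hbg
  have e3 := hr X b hX T hg
  have p (a : ℝ) (ha : 0 < a) : 0 ≤ a * logTerm S T * g ∧
      a ≤ a * logTerm S T * numUpdates S X b T := by
    refine ⟨by positivity, ?_⟩
    calc a = a * 1 * 1 := by ring
      _ ≤ _ := mul_le_mul (mul_le_mul_of_nonneg_left hH ha.le) hN zero_le_one (by positivity)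
  have p1 := p c hc
  have p2 := p d hd
  have p3 := p e he
  constructor <;> linarith

/-- The excess does not grow while the good event fails. -/
lemma excess_le_of_good {rate : ℕ → ℝ} (h0 : ∀ T, 1 ≤ T → 0 ≤ rate T)
    (hmono : ∀ T, 1 ≤ T → rate T ≤ rate (T + 1))
    (h : ∀ T, 1 ≤ T → Good S X T → R1 S X b T + R4 S X b T ≤ R4free S X b T + rate T) :
    ∀ T, 1 ≤ T → R1 S X b T + R4 S X b T ≤ R4free S X b T + rate T := by
  have hsucc : ∀ T, ¬ Good S X (T + 1) → R1 S X b (T + 1) = R1 S X b T ∧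
      R4 S X b (T + 1) = R4 S X b T ∧ R4free S X b (T + 1) = R4free S X b T := fun T hT =>
    ⟨goodSum_succ_of_not_good hT _, by rw [R4, R4, goodSum_succ_of_not_good hT],
      by rw [R4free, R4free, goodSum_succ_of_not_good hT]⟩
  intro T hT
  induction T, hT using Nat.le_induction with
  | base =>
    by_cases hg : Good S X 1
    · exact h 1 le_rfl hg
    · obtain ⟨e1, e2, e3⟩ := hsucc 0 hg
      rw [zero_add] at e1 e2 e3
      rw [e1, e2, e3, R1, R4, R4free, goodSum_zero, goodSum_zero, goodSum_zero]
      linarith [h0 1 le_rfl]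
  | succ T hT ih =>
    by_cases hg : Good S X (T + 1)
    · exact h _ (by omega) hg
    · obtain ⟨e1, e2, e3⟩ := hsucc T hg
      rw [e1, e2, e3]
      linarith [hmono T hT]

lemma exists_log_det_sub_bound (hn : 0 < n) (hS : S.Admissible) (ht₀ : 1 ≤ t₀) (D β₁ : ℝ) :
    ∃ C : ℝ, 0 < C ∧ ∀ X b, TameRun S t₀ D β₁ X b → ∀ t, 1 ≤ t → Good S X (t - 1) →
      Real.log (V S X t).det - Real.log (V S X 1).det ≤ C * logTerm S t := by
  obtain ⟨v, hv, hV⟩ := exists_log_det_V_bound hn hS ht₀ D β₁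
  refine ⟨v + |Real.log (S.lam 1 ^ Fintype.card (Fin n ⊕ Fin m))|, by positivity,
    fun X b hX t ht hg => ?_⟩
  have h1 := hV X b hX t ht hg
  have h3 := (neg_abs_le _).trans (Real.log_le_log (pow_pos (hS.lam_pos le_rfl) _)
      (lam_pow_le_det_V (X := X) hS le_rfl))
  have h4 := le_mul_of_one_le_right
    (abs_nonneg (Real.log (S.lam 1 ^ Fintype.card (Fin n ⊕ Fin m)))) (one_le_logTerm hS ht)
  linarith

end Regret

/-! ### The adaptive threshold and the two rates -/

section Rates

variable {n m : ℕ} {S : Setup n m} {t₀ : ℕ} {D : ℝ} {X : Traj n m}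

lemma rpow_quarter_sq (t : ℕ) : ((t : ℝ) ^ (1 / 4 : ℝ)) ^ 2 = √t := by
  rw [← Real.rpow_natCast, ← Real.rpow_mul (Nat.cast_nonneg t), Real.sqrt_eq_rpow]
  norm_num

lemma one_le_rpow_quarter {t : ℕ} (ht : 1 ≤ t) : 1 ≤ (t : ℝ) ^ (1 / 4 : ℝ) :=
  Real.one_le_rpow (by exact_mod_cast ht) (by norm_num)

lemma rpow_quarter_mono {s t : ℕ} (h : s ≤ t) : (s : ℝ) ^ (1 / 4 : ℝ) ≤ (t : ℝ) ^ (1 / 4 : ℝ) :=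
  Real.rpow_le_rpow (Nat.cast_nonneg s) (by exact_mod_cast h) (by norm_num)

lemma Setup.Admissible.αbar_pos (hn : 0 < n) (hS : S.Admissible) : 0 < S.αbar := by
  have hκ := hS.κ_pos
  have hα : 0 < S.α := hκ.trans_le hS.κ_le_α
  have hσ := hS.σ_pos
  have hγ : 0 < S.γ := by rw [Setup.γ]; positivity
  have hn' : (0 : ℝ) < n := by exact_mod_cast hn
  rw [Setup.αbar]
  positivity

lemma Setup.Admissible.neg_log_pos (hS : S.Admissible) : 0 < -Real.log S.δ :=
  neg_pos.2 (Real.log_neg hS.δ_pos hS.δ_lt_one)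

lemma Setup.Admissible.neg_log_le (hS : S.Admissible) {t : ℕ} (ht : 1 ≤ t) :
    -Real.log S.δ ≤ Real.log (t / S.δ) := by
  have := hS.log_mono le_rfl ht
  rwa [Nat.cast_one, one_div, Real.log_inv] at this

/-- Needed to keep the denominator of the adaptive `β` away from zero; it holds because `det V_t ≥
det (λ_t I)` and `n ≥ 1`. -/
lemma le_r (hn : 0 < n) (hS : S.Admissible) {t : ℕ} (ht : 1 ≤ t) :
    S.σ ^ 2 * (2 * n * -Real.log S.δ) ≤ r S X t := by
  have hn' : (1 : ℝ) ≤ n := by exact_mod_cast hn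
  have hδ := hS.δ_pos
  have hL := hS.neg_log_pos
  set l := Real.log (n * (V S X t).det /
      (S.δ * (S.lam t • (1 : Matrix (Fin n ⊕ Fin m) (Fin n ⊕ Fin m) ℝ)).det)) with hl
  have h1 : -Real.log S.δ ≤ l := by
    rw [hl, ← Real.log_inv, det_lam_smul]
    refine Real.log_le_log (by positivity) ?_
    have h2 := lam_pow_le_det_V (X := X) hS ht
    have h3 := pow_pos (hS.lam_pos ht) (Fintype.card (Fin n ⊕ Fin m))
    rw [inv_eq_one_div, div_le_div_iff₀ hδ (by positivity), one_mul, mul_comm]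
    refine mul_le_mul_of_nonneg_right ?_ hδ.le
    exact h2.trans (le_mul_of_one_le_left (h3.le.trans h2) hn')
  have h2 : S.σ ^ 2 * (2 * n * l) = (S.σ * √(2 * n * l)) ^ 2 := by
    rw [mul_pow, Real.sq_sqrt (mul_nonneg (by positivity) (hL.le.trans h1))]
  rw [r, ← hl]
  calc S.σ ^ 2 * (2 * n * -Real.log S.δ) ≤ S.σ ^ 2 * (2 * n * l) := by gcongr
    _ = (S.σ * √(2 * n * l)) ^ 2 := h2
    _ ≤ _ := by
      have := hS.σ_pos
      have := hS.ε_nonneg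
      gcongr
      linarith [mul_nonneg (Real.sqrt_nonneg (S.lam t)) hS.ε_nonneg]

/-- Under the root, the numerator is `O(log τ)` and the denominator is at least a multiple of `√τ`,
through its summand with `√(G + ᾱ τ)`. No run is involved, as the lower bound of `r` holds for every
trajectory. -/
lemma exists_betaAdaptive_le (hn : 0 < n) (hS : S.Admissible) :
    ∃ C : ℝ, 0 < C ∧ ∀ (X : Traj n m) (τ : ℕ), 1 ≤ τ →
      betaAdaptive S X τ ≤ C * ((τ : ℝ) ^ (1 / 4 : ℝ))⁻¹ * logTerm S τ := by
  have hn' : (0 : ℝ) < n := by exact_mod_cast hn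
  have hL := hS.neg_log_pos
  set L := -Real.log S.δ with hLdef
  have hG := hS.G_pos
  have hν := hS.ν_pos
  have hϑ := hS.ϑ_pos
  have hσ := hS.σ_pos
  have hαb := hS.αbar_pos hn
  set a := S.αbar / S.G with ha
  have ha0 : 0 < a := div_pos hαb hG
  set p := 2 * (Real.log (1 + a) + 1 + |Real.log L| + 1) with hp
  have hla : 0 ≤ Real.log (1 + a) := Real.log_nonneg (by linarith)
  have hp0 : 0 < p := by positivity
  set d := 4 * S.ν * (n + m) * (1 + a) *
    (2 * S.ϑ * √S.αbar * √(S.σ ^ 2 * (2 * n * L) * L)) with hd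
  have hd0 : 0 < d := by positivity
  refine ⟨√(p / d), by positivity, fun X τ hτ => ?_⟩
  have hτ1 : (1 : ℝ) ≤ τ := by exact_mod_cast hτ
  have hH := one_le_logTerm hS hτ
  have hl := hS.log_pos hτ
  have hq := one_le_rpow_quarter hτ
  have hnum : 2 * Real.log (-((1 + a * τ) * Real.log S.δ * Real.log (τ / S.δ))) ≤
      p * logTerm S τ := by
    have h1 : -((1 + a * τ) * Real.log S.δ * Real.log (τ / S.δ)) =
        (1 + a * τ) * L * Real.log (τ / S.δ) := by rw [hLdef]; ring
    rw [h1, Real.log_mul (by positivity) hl.ne', Real.log_mul (by positivity) hL.ne']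
    have h2 : Real.log (1 + a * τ) ≤ Real.log (1 + a) + Real.log τ := by
      rw [← Real.log_mul (by positivity) (by positivity)]
      exact Real.log_le_log (by positivity) (by nlinarith)
    have h3 := log_natCast_le_logTerm hS hτ
    have h4 := Real.log_le_sub_one_of_pos hl
    have h5 : Real.log (τ / S.δ) ≤ logTerm S τ := log_le_logTerm τ
    have h6 := le_mul_of_one_le_right hla hH
    have h7 := le_mul_of_one_le_right (abs_nonneg (Real.log L)) hH
    have h8 := le_abs_self (Real.log L)
    rw [hp]
    linarith
  have hden : d * √τ ≤ 4 * S.ν * (n + m) * (1 + a) *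
      (r S X τ + 2 * S.ϑ * √(S.G + S.αbar * τ) * √(r S X τ * Real.log (τ / S.δ))) := by
    rw [hd, mul_assoc]
    refine mul_le_mul_of_nonneg_left ?_ (by positivity)
    have hr := le_r (X := X) hn hS hτ
    have hr0 := r_nonneg (S := S) (X := X) τ
    have h1 : √S.αbar * √τ ≤ √(S.G + S.αbar * τ) := by
      rw [← Real.sqrt_mul hαb.le]; exact Real.sqrt_le_sqrt (by linarith)
    have h2 : √(S.σ ^ 2 * (2 * n * L) * L) ≤ √(r S X τ * Real.log (τ / S.δ)) :=
      Real.sqrt_le_sqrt (mul_le_mul hr (hS.neg_log_le hτ) hL.le hr0)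
    calc 2 * S.ϑ * √S.αbar * √(S.σ ^ 2 * (2 * n * L) * L) * √τ =
          2 * S.ϑ * ((√S.αbar * √τ) * √(S.σ ^ 2 * (2 * n * L) * L)) := by ring
      _ ≤ 2 * S.ϑ * (√(S.G + S.αbar * τ) * √(r S X τ * Real.log (τ / S.δ))) := by gcongr
      _ ≤ _ := by linarith
  have hs : 0 < √(τ : ℝ) := Real.sqrt_pos.2 (by linarith)
  rw [betaAdaptive, Real.sqrt_le_left (by positivity)]
  calc _ ≤ p * logTerm S τ / (d * √τ) :=
        (div_le_div_of_nonneg_right hnum (le_trans (by positivity) hden)).trans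
          (div_le_div_of_nonneg_left (by positivity) (by positivity) hden)
    _ = p / d * (√τ)⁻¹ * logTerm S τ := by field_simp
    _ ≤ p / d * (√τ)⁻¹ * logTerm S τ ^ 2 := by gcongr; exact le_self_pow₀ hH two_ne_zero
    _ = _ := by rw [mul_pow, mul_pow, Real.sq_sqrt (by positivity), inv_pow, rpow_quarter_sq]

/-- `log τ = 4 log (τ^(1/4))` is dominated by `τ^(1/4)`. The result supplies the uniform threshold
bound of a `TameRun`. -/
lemma exists_betaAdaptive_le_const (hn : 0 < n) (hS : S.Admissible) :
    ∃ C : ℝ, 0 < C ∧ ∀ (X : Traj n m) (τ : ℕ), 1 ≤ τ → betaAdaptive S X τ ≤ C := by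
  obtain ⟨c, hc, h⟩ := exists_betaAdaptive_le hn hS
  have hL := hS.neg_log_pos
  refine ⟨c * (5 + -Real.log S.δ), by positivity, fun X τ hτ => (h X τ hτ).trans ?_⟩
  have hq := one_le_rpow_quarter hτ
  have hτ0 : (0 : ℝ) < τ := by exact_mod_cast hτ
  rw [mul_assoc]
  refine mul_le_mul_of_nonneg_left ?_ hc.le
  rw [inv_mul_le_iff₀ (by linarith), logTerm, Real.log_div hτ0.ne' hS.δ_pos.ne']
  have h1 := Real.log_le_sub_one_of_pos (show 0 < (τ : ℝ) ^ (1 / 4 : ℝ) by linarith)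
  rw [Real.log_rpow hτ0] at h1
  nlinarith

/-- A matching lower bound, which limits the number of updates. Unlike the upper bound it uses the
logarithmic growth of `r` along a run, hence the good event. -/
lemma exists_le_betaAdaptive (hn : 0 < n) (hS : S.Admissible) (ht₀ : 1 ≤ t₀) (D β₁ : ℝ) :
    ∃ (c : ℝ) (τ₀ : ℕ), 0 < c ∧ ∀ X b, TameRun S t₀ D β₁ X b → ∀ τ, 1 ≤ τ → τ₀ ≤ τ →
      Good S X (τ - 1) → c / ((τ : ℝ) ^ (1 / 4 : ℝ) * logTerm S τ) ≤ betaAdaptive S X τ := by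
  obtain ⟨R, hR, hr⟩ := exists_r_bound hn hS ht₀ D β₁
  have hn' : (0 : ℝ) < n := by exact_mod_cast hn
  have hL := hS.neg_log_pos
  set L := -Real.log S.δ with hLdef
  have hG := hS.G_pos
  have hν := hS.ν_pos
  have hϑ := hS.ϑ_pos
  have hαb := hS.αbar_pos hn
  set a := S.αbar / S.G with ha
  have ha0 : 0 < a := div_pos hαb hG
  set d := 4 * S.ν * (n + m) * (1 + a) * (R + 2 * S.ϑ * √(S.G + S.αbar) * √R) with hd
  have hd0 : 0 < d := by positivity
  -- From `τ₀ ≥ e / (a L²)` on, the argument of the logarithm in the rule is at least `e`, so the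
  -- radicand is positive.
  obtain ⟨τ₀, hτ₀⟩ := exists_nat_ge (Real.exp 1 / (a * L * L))
  refine ⟨√(2 / d), τ₀, by positivity, fun X b hX τ hτ hττ hg => ?_⟩
  have hτ1 : (1 : ℝ) ≤ τ := by exact_mod_cast hτ
  have hs1 : 1 ≤ √(τ : ℝ) := Real.one_le_sqrt.2 hτ1
  have hH := one_le_logTerm hS hτ
  have hl := hS.neg_log_le hτ
  have hq := one_le_rpow_quarter hτ
  have hnum : 2 ≤ 2 * Real.log (-((1 + a * τ) * Real.log S.δ * Real.log (τ / S.δ))) := by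
    have h1 : -((1 + a * τ) * Real.log S.δ * Real.log (τ / S.δ)) =
        (1 + a * τ) * L * Real.log (τ / S.δ) := by rw [hLdef]; ring
    have h2 : Real.exp 1 ≤ a * τ * L * L := by
      have h3 : Real.exp 1 / (a * L * L) ≤ τ := hτ₀.trans (by exact_mod_cast hττ)
      rw [div_le_iff₀ (by positivity)] at h3
      linarith
    have h4 : a * τ * L * L ≤ (1 + a * τ) * L * Real.log (τ / S.δ) :=
      mul_le_mul (mul_le_mul_of_nonneg_right (by linarith) hL.le) hl hL.le (by positivity)
    rw [h1]
    have h5 := Real.log_le_log (Real.exp_pos 1) (h2.trans h4)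
    rw [Real.log_exp] at h5
    linarith
  have hr1 := hr X b hX τ hτ hg
  have hr0 := le_r (X := X) hn hS hτ
  have hσ := hS.σ_pos
  have hrpos : 0 < r S X τ := lt_of_lt_of_le (by positivity) hr0
  have hlpos := hS.log_pos hτ
  have hden : 4 * S.ν * (n + m) * (1 + a) *
      (r S X τ + 2 * S.ϑ * √(S.G + S.αbar * τ) * √(r S X τ * Real.log (τ / S.δ))) ≤
      d * √τ * logTerm S τ := by
    rw [hd, mul_assoc _ (R + _), mul_assoc _ (_ * √(τ : ℝ))]
    refine mul_le_mul_of_nonneg_left ?_ (by positivity)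
    have h1 : √(S.G + S.αbar * τ) ≤ √(S.G + S.αbar) * √τ := by
      rw [← Real.sqrt_mul (by positivity)]
      exact Real.sqrt_le_sqrt (by nlinarith)
    have h2 : √(r S X τ * Real.log (τ / S.δ)) ≤ √R * logTerm S τ := by
      have h3 : r S X τ * Real.log (τ / S.δ) ≤ R * logTerm S τ ^ 2 := by
        rw [sq, ← mul_assoc]
        exact mul_le_mul hr1 (log_le_logTerm τ) hlpos.le (by positivity)
      refine (Real.sqrt_le_sqrt h3).trans (le_of_eq ?_)
      rw [Real.sqrt_mul hR.le, Real.sqrt_sq (by linarith)]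
    have h3 : R * logTerm S τ ≤ R * √τ * logTerm S τ :=
      mul_le_mul_of_nonneg_right (le_mul_of_one_le_right hR.le hs1) (by linarith)
    calc _ ≤ R * √τ * logTerm S τ +
          2 * S.ϑ * (√(S.G + S.αbar) * √τ) * (√R * logTerm S τ) := by
          gcongr
          exact hr1.trans h3
      _ = _ := by ring
  rw [betaAdaptive]
  refine Real.le_sqrt_of_sq_le ?_
  rw [div_pow, mul_pow, rpow_quarter_sq, Real.sq_sqrt (by positivity)]
  calc 2 / d / (√τ * logTerm S τ ^ 2) ≤ 2 / d / (√τ * logTerm S τ) := by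
        gcongr; exact le_self_pow₀ hH two_ne_zero
    _ = 2 / (d * √τ * logTerm S τ) := by field_simp
    _ ≤ _ := (div_le_div_of_nonneg_left zero_le_two (by positivity) hden).trans
        (div_le_div_of_nonneg_right hnum (by positivity))

/-- The balance: with `β_τ` between multiples of `τ^(-1/4)` up to logarithms, the number of updates
is at most about `log det V_T / β_T ~ T^(1/4)`, and `β_τ μ_τ` is at most about `T^(-1/4) √T`. -/
lemma exists_adaptive_excess_bound (hn : 0 < n) (hS : S.Admissible) (ht₀ : 1 ≤ t₀) (D : ℝ) :
    ∃ C : ℝ, 0 < C ∧ ∀ X, IsRun S X (betaAdaptive S X) → Cond0 S X t₀ →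
      InitBound S X (betaAdaptive S X) t₀ D → ∀ T, 1 ≤ T →
      R1 S X (betaAdaptive S X) T + R4 S X (betaAdaptive S X) T ≤
        R4free S X (betaAdaptive S X) T + C * (T : ℝ) ^ (1 / 4 : ℝ) * logTerm S T ^ 3 ∧
      (Good S X T → regret S X T ≤ R2 S X (betaAdaptive S X) T + R3 S X (betaAdaptive S X) T +
        R4free S X (betaAdaptive S X) T + R5 S X (betaAdaptive S X) T +
        C * (T : ℝ) ^ (1 / 4 : ℝ) * logTerm S T ^ 3) := by
  obtain ⟨β₁, hβ₁, hβ⟩ := exists_betaAdaptive_le_const hn hS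
  obtain ⟨u, hu, hup⟩ := exists_betaAdaptive_le hn hS
  obtain ⟨l, τ₀, hl, hlow⟩ := exists_le_betaAdaptive hn hS ht₀ D β₁
  obtain ⟨c, hc, hμ⟩ := exists_mu_bound hn hS ht₀ D β₁
  obtain ⟨e, he, hex⟩ := exists_excess_bound hn hS ht₀ D β₁
  obtain ⟨v, hv, hdet⟩ := exists_log_det_sub_bound hn hS ht₀ D β₁
  refine ⟨e * (τ₀ + 1 + v * (1 + β₁) / l + u * c), by positivity, fun X hrun hcond hinit => ?_⟩
  have hX : TameRun S t₀ D β₁ X (betaAdaptive S X) :=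
    ⟨hrun, fun τ _ => Real.sqrt_nonneg _, hβ X, hcond, hinit⟩
  have hgood : ∀ T, 1 ≤ T → Good S X T →
      e * logTerm S T * (numUpdates S X (betaAdaptive S X) T +
        u * c * (T : ℝ) ^ (1 / 4 : ℝ) * logTerm S T ^ 2) ≤
      e * (τ₀ + 1 + v * (1 + β₁) / l + u * c) * (T : ℝ) ^ (1 / 4 : ℝ) * logTerm S T ^ 3 ∧
      ∀ τ, 1 ≤ τ → τ ≤ T → betaAdaptive S X τ * mu S X τ ≤
        u * c * (T : ℝ) ^ (1 / 4 : ℝ) * logTerm S T ^ 2 := by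
    intro T hT hg
    have hH := one_le_logTerm hS hT
    have hq := one_le_rpow_quarter hT
    set q := (T : ℝ) ^ (1 / 4 : ℝ) with hqdef
    set H := logTerm S T with hHdef
    constructor
    -- A lower bound for all `log (1 + β_τ)` with `τ₀ ≤ τ ≤ T`, from `log (1 + β) ≥ β / (1 + β)` and
    -- `β ≤ β₁`.
    · set k := l / ((1 + β₁) * (q * H)) with hk
      have hk0 : 0 < k := by positivity
      have h1 := numUpdates_mul_le (X := X) (b := betaAdaptive S X) hS (T := T) (τ₀ := τ₀) hk0.le
        (fun τ h1 h2 h3 => ⟨Real.sqrt_nonneg _, by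
          have h4 := hlow X _ hX τ h1 h2 (hg.mono (by omega))
          have h5 := logTerm_mono hS h1 h3
          have h6 := one_le_logTerm hS h1
          have h7 := one_le_rpow_quarter h1
          have h8 : l / (q * H) ≤ betaAdaptive S X τ := by
            refine le_trans (div_le_div_of_nonneg_left hl.le (by positivity) ?_) h4
            exact mul_le_mul (rpow_quarter_mono h3) h5 (by linarith) (by linarith)
          have h9 : (0 : ℝ) ≤ betaAdaptive S X τ := Real.sqrt_nonneg _
          have h10 := Real.one_sub_inv_le_log_of_pos
            (show 0 < 1 + betaAdaptive S X τ by linarith)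
          have h11 : 1 - (1 + betaAdaptive S X τ)⁻¹ =
              betaAdaptive S X τ / (1 + betaAdaptive S X τ) := by
            field_simp; ring
          have h12 : k ≤ betaAdaptive S X τ / (1 + betaAdaptive S X τ) := by
            have h13 : k = l / (q * H) / (1 + β₁) := by rw [hk]; field_simp
            rw [h13]
            exact div_le_div₀ h9 h8 (by linarith) (by linarith [hβ X τ h1])
          linarith⟩) hT
      have h2 := hdet X _ hX T hT (hg.mono (by omega))
      have h3 : (numUpdates S X (betaAdaptive S X) T : ℝ) ≤
          (τ₀ + 1) + v * (1 + β₁) / l * (q * H ^ 2) := by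
        refine le_of_mul_le_mul_right (h1.trans ?_) hk0
        rw [add_mul ((τ₀ : ℝ) + 1)]
        refine add_le_add le_rfl (h2.trans (le_of_eq ?_))
        rw [hk]; field_simp; exact hHdef.symm
      have h4 : 1 ≤ q * H ^ 2 := one_le_mul_of_one_le_of_one_le hq (one_le_pow₀ hH)
      have h5 : ((τ₀ : ℝ) + 1) ≤ (τ₀ + 1) * (q * H ^ 2) :=
        le_mul_of_one_le_right (by positivity) h4
      calc e * H * (numUpdates S X (betaAdaptive S X) T + u * c * q * H ^ 2) ≤
            e * H * ((τ₀ + 1 + v * (1 + β₁) / l + u * c) * (q * H ^ 2)) := by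
            refine mul_le_mul_of_nonneg_left ?_ (by positivity)
            linarith
        _ = _ := by ring
    · intro τ h1 h2
      have h3 := logTerm_mono hS h1 h2
      have h4 := one_le_logTerm hS h1
      have h5 := one_le_rpow_quarter h1
      have h6 := hμ X _ hX τ h1 (hg.mono (by omega))
      calc betaAdaptive S X τ * mu S X τ ≤
            (u * ((τ : ℝ) ^ (1 / 4 : ℝ))⁻¹ * logTerm S τ) * (c * √τ * logTerm S τ) :=
            mul_le_mul (hup X τ h1) h6 (mu_nonneg hS τ) (by positivity)
        _ = u * c * (τ : ℝ) ^ (1 / 4 : ℝ) * logTerm S τ ^ 2 := by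
            rw [← rpow_quarter_sq]; field_simp
        _ ≤ _ := by
            have := rpow_quarter_mono h2
            gcongr
  intro T hT
  refine ⟨excess_le_of_good (rate := fun T =>
    e * (τ₀ + 1 + v * (1 + β₁) / l + u * c) * (T : ℝ) ^ (1 / 4 : ℝ) * logTerm S T ^ 3)
    (fun T hT => ?_) (fun T hT => ?_) (fun T hT hg => ?_) T hT, fun hg => ?_⟩
  · have := one_le_logTerm hS hT
    positivity
  · have h1 := one_le_logTerm hS hT
    have h2 := logTerm_mono hS hT (Nat.le_succ T)
    have h3 := rpow_quarter_mono (Nat.le_succ T)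
    gcongr
  · obtain ⟨h1, h2⟩ := hgood T hT hg
    exact (hex X _ hX T hT hg _ h2).1.trans (add_le_add le_rfl h1)
  · obtain ⟨h1, h2⟩ := hgood T hT hg
    exact (hex X _ hX T hT hg _ h2).2.trans (add_le_add le_rfl h1)

/-- The same scheme with about `log det V_T / log (1 + ξ)` updates and `ξ μ_τ` of order `ξ √T`. The
bound `Ξ` keeps the constants uniform in `ξ`. -/
lemma exists_const_excess_bound (hn : 0 < n) (hS : S.Admissible) (ht₀ : 1 ≤ t₀) (D Ξ : ℝ) :
    ∃ C : ℝ, 0 < C ∧ ∀ ξ, 0 < ξ → ξ ≤ Ξ → ∀ X, IsRun S X (fun _ => ξ) → Cond0 S X t₀ →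
      InitBound S X (fun _ => ξ) t₀ D → ∀ T, 1 ≤ T →
      R1 S X (fun _ => ξ) T + R4 S X (fun _ => ξ) T ≤ R4free S X (fun _ => ξ) T +
        C * (ξ * √T * logTerm S T ^ 2 + logTerm S T ^ 2 / Real.log (1 + ξ)) ∧
      (Good S X T → regret S X T ≤ R2 S X (fun _ => ξ) T + R3 S X (fun _ => ξ) T +
        R4free S X (fun _ => ξ) T + R5 S X (fun _ => ξ) T +
        C * (ξ * √T * logTerm S T ^ 2 + logTerm S T ^ 2 / Real.log (1 + ξ))) := by
  obtain ⟨c, hc, hμ⟩ := exists_mu_bound hn hS ht₀ D Ξ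
  obtain ⟨e, he, hex⟩ := exists_excess_bound hn hS ht₀ D Ξ
  obtain ⟨v, hv, hdet⟩ := exists_log_det_sub_bound hn hS ht₀ D Ξ
  refine ⟨e * (|Ξ| + v + c), by positivity, fun ξ hξ hξΞ X hrun hcond hinit => ?_⟩
  have hX : TameRun S t₀ D Ξ X (fun _ => ξ) :=
    ⟨hrun, fun _ _ => hξ.le, fun _ _ => hξΞ, hcond, hinit⟩
  have hlog : 0 < Real.log (1 + ξ) := Real.log_pos (by linarith)
  have hlogΞ : Real.log (1 + ξ) ≤ |Ξ| := by
    linarith [Real.log_le_sub_one_of_pos (show 0 < 1 + ξ by linarith), le_abs_self Ξ]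
  have hgood : ∀ T, 1 ≤ T → Good S X T →
      e * logTerm S T * (numUpdates S X (fun _ => ξ) T + ξ * (c * √T * logTerm S T)) ≤
      e * (|Ξ| + v + c) * (ξ * √T * logTerm S T ^ 2 + logTerm S T ^ 2 / Real.log (1 + ξ)) ∧
      ∀ τ, 1 ≤ τ → τ ≤ T → ξ * mu S X τ ≤ ξ * (c * √T * logTerm S T) := by
    intro T hT hg
    have hH := one_le_logTerm hS hT
    constructor
    -- With `τ₀ = 0` one extra update remains; its weight `log (1 + ξ)` is at most `|Ξ|`.
    · have h1 := numUpdates_mul_le (X := X) (b := fun _ => ξ) hS (T := T) (τ₀ := 0) hlog.le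
        (fun _ _ _ _ => ⟨hξ.le, le_rfl⟩) hT
      have h2 := hdet X _ hX T hT (hg.mono (by omega))
      have h3 : (numUpdates S X (fun _ => ξ) T : ℝ) ≤
          (|Ξ| + v) * logTerm S T / Real.log (1 + ξ) := by
        rw [le_div_iff₀ hlog]
        have := le_mul_of_one_le_right (abs_nonneg Ξ) hH
        push_cast at h1
        linarith
      calc e * logTerm S T * (numUpdates S X (fun _ => ξ) T + ξ * (c * √T * logTerm S T)) ≤
            e * logTerm S T * ((|Ξ| + v) * logTerm S T / Real.log (1 + ξ) +
              ξ * (c * √T * logTerm S T)) := by gcongr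
        _ = e * ((|Ξ| + v) * (logTerm S T ^ 2 / Real.log (1 + ξ)) +
              c * (ξ * √T * logTerm S T ^ 2)) := by ring
        _ ≤ e * ((|Ξ| + v + c) * (logTerm S T ^ 2 / Real.log (1 + ξ)) +
              (|Ξ| + v + c) * (ξ * √T * logTerm S T ^ 2)) := by
            refine mul_le_mul_of_nonneg_left (add_le_add
              (mul_le_mul_of_nonneg_right (by linarith) (by positivity))
              (mul_le_mul_of_nonneg_right ?_ (by positivity))) he.le
            linarith [abs_nonneg Ξ]
        _ = _ := by ring
    · intro τ h1 h2
      refine mul_le_mul_of_nonneg_left ((hμ X _ hX τ h1 (hg.mono (by omega))).trans ?_) hξ.le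
      have h3 := logTerm_mono hS h1 h2
      have h4 := one_le_logTerm hS h1
      have h5 : (τ : ℝ) ≤ T := by exact_mod_cast h2
      gcongr
  intro T hT
  refine ⟨excess_le_of_good (rate := fun T =>
    e * (|Ξ| + v + c) * (ξ * √T * logTerm S T ^ 2 + logTerm S T ^ 2 / Real.log (1 + ξ)))
    (fun T hT => by positivity) (fun T hT => ?_) (fun T hT hg => ?_) T hT, fun hg => ?_⟩
  · have h1 := one_le_logTerm hS hT
    have h2 := logTerm_mono hS hT (Nat.le_succ T)
    have h3 : (T : ℝ) ≤ (T + 1 : ℕ) := by exact_mod_cast Nat.le_succ T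
    gcongr
  · obtain ⟨h1, h2⟩ := hgood T hT hg
    exact (hex X _ hX T hT hg _ h2).1.trans (add_le_add le_rfl h1)
  · obtain ⟨h1, h2⟩ := hgood T hT hg
    exact (hex X _ hX T hT hg _ h2).2.trans (add_le_add le_rfl h1)

lemma logTerm_le (hS : S.Admissible) {t : ℕ} (ht : 1 ≤ t) :
    logTerm S t ≤ (1 + (-Real.log S.δ)⁻¹) * Real.log (t / S.δ) := by
  have h1 := hS.neg_log_pos
  have h2 := hS.neg_log_le ht
  have h3 : 1 ≤ (-Real.log S.δ)⁻¹ * Real.log (t / S.δ) := by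
    rw [inv_mul_eq_div, le_div_iff₀ h1]; linarith
  rw [logTerm]; linarith

/-- Both rates carry the same power of the logarithm, so the ratio is at most `T^(1/4) / (ξ √T)`;
the nonnegative second summand of the constant rate is not needed. -/
lemma rateAdaptive_isLittleO_rateConst (hS : S.Admissible) {C : ℝ} (hC : 0 < C) (k : ℕ) {ξ : ℝ}
    (hξ : 0 < ξ) :
    (fun T : ℕ => rateAdaptive S.δ C k T) =o[Filter.atTop] fun T : ℕ => rateConst S.δ C k ξ T := by
  rw [Asymptotics.isLittleO_iff]
  intro c hc
  have hq : Filter.Tendsto (fun T : ℕ => (T : ℝ) ^ (1 / 4 : ℝ)) Filter.atTop Filter.atTop :=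
    (tendsto_rpow_atTop (by norm_num)).comp tendsto_natCast_atTop_atTop
  filter_upwards [hq.eventually_ge_atTop (1 / (c * ξ)), Filter.eventually_ge_atTop 1] with T h1 hT
  have hl := hS.log_pos hT
  have hq1 := one_le_rpow_quarter hT
  have hlogξ : 0 < Real.log (1 + ξ) := Real.log_pos (by linarith)
  rw [div_le_iff₀ (by positivity)] at h1
  have h2 : 0 ≤ Real.log (T / S.δ) * Real.logb (1 + ξ) (T / S.δ) := by
    rw [Real.logb]; positivity
  rw [rateAdaptive, rateConst, Real.norm_of_nonneg (by positivity),
    Real.norm_of_nonneg (by positivity), ← rpow_quarter_sq]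
  calc C * (T : ℝ) ^ (1 / 4 : ℝ) * Real.log (T / S.δ) ^ k =
        C * (T : ℝ) ^ (1 / 4 : ℝ) * Real.log (T / S.δ) ^ k * 1 := by ring
    _ ≤ C * (T : ℝ) ^ (1 / 4 : ℝ) * Real.log (T / S.δ) ^ k *
          ((T : ℝ) ^ (1 / 4 : ℝ) * (c * ξ)) := by gcongr
    _ = c * (C * (ξ * ((T : ℝ) ^ (1 / 4 : ℝ)) ^ 2 * Real.log (T / S.δ) ^ k + 0)) := by ring
    _ ≤ _ := by gcongr

end Rates

/-! ### Conversion from powers of `1 + log (t/δ)` to powers of `log (t/δ)` -/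

section LogPowers

variable {n m : ℕ} {S : Setup n m}

lemma logTerm_cube_le (hS : S.Admissible) {t : ℕ} (ht : 1 ≤ t) :
    logTerm S t ^ 3 ≤ (1 + (-Real.log S.δ)⁻¹) ^ 3 * Real.log (t / S.δ) ^ 3 := by
  have := one_le_logTerm hS ht
  rw [← mul_pow]
  exact pow_le_pow_left₀ (by linarith) (logTerm_le hS ht) 3

lemma le_rateAdaptive (hS : S.Admissible) {C C' : ℝ} (hC : 0 ≤ C)
    (h : C * (1 + (-Real.log S.δ)⁻¹) ^ 3 ≤ C') {T : ℕ} (hT : 1 ≤ T) :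
    C * (T : ℝ) ^ (1 / 4 : ℝ) * logTerm S T ^ 3 ≤ rateAdaptive S.δ C' 3 T := by
  have hl := hS.log_pos hT
  calc C * (T : ℝ) ^ (1 / 4 : ℝ) * logTerm S T ^ 3 ≤ C * (T : ℝ) ^ (1 / 4 : ℝ) *
        ((1 + (-Real.log S.δ)⁻¹) ^ 3 * Real.log (T / S.δ) ^ 3) := by
        gcongr; exact logTerm_cube_le hS hT
    _ = C * (1 + (-Real.log S.δ)⁻¹) ^ 3 * (T : ℝ) ^ (1 / 4 : ℝ) * Real.log (T / S.δ) ^ 3 := by ring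
    _ ≤ _ := by rw [rateAdaptive]; gcongr

lemma le_rateConst (hS : S.Admissible) {C C' ξ : ℝ} (hC : 0 ≤ C) (hξ : 0 < ξ)
    (h : C * (1 + (-Real.log S.δ)⁻¹) ^ 3 ≤ C') {T : ℕ} (hT : 1 ≤ T) :
    C * (ξ * √T * logTerm S T ^ 2 + logTerm S T ^ 2 / Real.log (1 + ξ)) ≤
      rateConst S.δ C' 3 ξ T := by
  have hl := hS.log_pos hT
  have hH := one_le_logTerm hS hT
  have hL := inv_pos.2 hS.neg_log_pos
  have hlog : 0 < Real.log (1 + ξ) := Real.log_pos (by linarith)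
  set a := 1 + (-Real.log S.δ)⁻¹ with ha
  -- The exponent is raised to three so that both rules share the same power `k`.
  have h1 : logTerm S T ^ 2 ≤ a ^ 3 * Real.log (T / S.δ) ^ 3 :=
    (pow_le_pow_right₀ hH (by norm_num)).trans (logTerm_cube_le hS hT)
  have h2 : logTerm S T ^ 2 ≤ a ^ 3 * Real.log (T / S.δ) ^ 2 := by
    calc logTerm S T ^ 2 ≤ (a * Real.log (T / S.δ)) ^ 2 :=
          pow_le_pow_left₀ (by linarith) (logTerm_le hS hT) 2
      _ = a ^ 2 * Real.log (T / S.δ) ^ 2 := by ring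
      _ ≤ _ := by
        refine mul_le_mul_of_nonneg_right (pow_le_pow_right₀ ?_ (by norm_num)) (sq_nonneg _)
        linarith
  have h3 : 0 ≤ ξ * √T * Real.log (T / S.δ) ^ 3 +
      Real.log (T / S.δ) * Real.logb (1 + ξ) (T / S.δ) := by
    rw [Real.logb]; positivity
  calc C * (ξ * √T * logTerm S T ^ 2 + logTerm S T ^ 2 / Real.log (1 + ξ)) ≤
        C * (ξ * √T * (a ^ 3 * Real.log (T / S.δ) ^ 3) +
          a ^ 3 * Real.log (T / S.δ) ^ 2 / Real.log (1 + ξ)) := by gcongr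
    _ = C * a ^ 3 * (ξ * √T * Real.log (T / S.δ) ^ 3 +
      Real.log (T / S.δ) * Real.logb (1 + ξ) (T / S.δ)) := by rw [Real.logb]; ring
    _ ≤ _ := mul_le_mul_of_nonneg_right h h3

end LogPowers

end ASLO

/-! ### Assembly of the main theorem -/

theorem mainTheorem3 {n m : ℕ} (hn : 0 < n) (S : ASLO.Setup n m) (hS : S.Admissible)
    (t₀ : ℕ) (ht₀ : 1 ≤ t₀) (D Ξ : ℝ) :
    ∃ (C : ℝ) (k : ℕ), 0 < C ∧
      -- the adaptive `β` is of order `τ ^ (-1/4)` up to logarithmic factors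
      (∀ (X : ASLO.Traj n m) (τ : ℕ), 1 ≤ τ →
        ASLO.betaAdaptive S X τ ≤
          C * (τ : ℝ) ^ (-(1 / 4) : ℝ) * Real.log (τ / S.δ) ^ k) ∧
      -- the adaptive update rule
      (∀ (Ω : Type u) [MeasurableSpace Ω] (Pr : MeasureTheory.Measure Ω)
          [MeasureTheory.IsProbabilityMeasure Pr] (X : Ω → ASLO.Traj n m),
        ASLO.StochasticModel S Pr X →
        (∀ᵐ ω ∂Pr, ASLO.IsRun S (X ω) (ASLO.betaAdaptive S (X ω))) →
        (∀ T : ℕ, 1 ≤ T →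
          Pr {ω | ¬ ASLO.Good S (X ω) T} ≤ ENNReal.ofReal (ASLO.failProb S.δ T)) ∧
        ∀ᵐ ω ∂Pr, ASLO.Cond0 S (X ω) t₀ →
          ASLO.InitBound S (X ω) (ASLO.betaAdaptive S (X ω)) t₀ D →
          ∀ T : ℕ, 1 ≤ T →
            ASLO.R1 S (X ω) (ASLO.betaAdaptive S (X ω)) T
                + ASLO.R4 S (X ω) (ASLO.betaAdaptive S (X ω)) T
              ≤ ASLO.R4free S (X ω) (ASLO.betaAdaptive S (X ω)) T
                + ASLO.rateAdaptive S.δ C k T ∧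
            (ASLO.Good S (X ω) T →
              ASLO.regret S (X ω) T
                ≤ ASLO.R2 S (X ω) (ASLO.betaAdaptive S (X ω)) T
                  + ASLO.R3 S (X ω) (ASLO.betaAdaptive S (X ω)) T
                  + ASLO.R4free S (X ω) (ASLO.betaAdaptive S (X ω)) T
                  + ASLO.R5 S (X ω) (ASLO.betaAdaptive S (X ω)) T
                  + ASLO.rateAdaptive S.δ C k T)) ∧
      -- the constant update rule `β = ξ`
      (∀ ξ : ℝ, 0 < ξ → ξ ≤ Ξ →
        ∀ (Ω : Type u) [MeasurableSpace Ω] (Pr : MeasureTheory.Measure Ω)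
          [MeasureTheory.IsProbabilityMeasure Pr] (X : Ω → ASLO.Traj n m),
        ASLO.StochasticModel S Pr X →
        (∀ᵐ ω ∂Pr, ASLO.IsRun S (X ω) (fun _ => ξ)) →
        (∀ T : ℕ, 1 ≤ T →
          Pr {ω | ¬ ASLO.Good S (X ω) T} ≤ ENNReal.ofReal (ASLO.failProb S.δ T)) ∧
        ∀ᵐ ω ∂Pr, ASLO.Cond0 S (X ω) t₀ →
          ASLO.InitBound S (X ω) (fun _ => ξ) t₀ D →
          ∀ T : ℕ, 1 ≤ T →
            ASLO.R1 S (X ω) (fun _ => ξ) T + ASLO.R4 S (X ω) (fun _ => ξ) T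
              ≤ ASLO.R4free S (X ω) (fun _ => ξ) T + ASLO.rateConst S.δ C k ξ T ∧
            (ASLO.Good S (X ω) T →
              ASLO.regret S (X ω) T
                ≤ ASLO.R2 S (X ω) (fun _ => ξ) T + ASLO.R3 S (X ω) (fun _ => ξ) T
                  + ASLO.R4free S (X ω) (fun _ => ξ) T + ASLO.R5 S (X ω) (fun _ => ξ) T
                  + ASLO.rateConst S.δ C k ξ T)) ∧
      -- the adaptive bound is of smaller order than the bound for any constant
      (∀ ξ : ℝ, 0 < ξ →
        (fun T : ℕ => ASLO.rateAdaptive S.δ C k T)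
          =o[Filter.atTop] fun T : ℕ => ASLO.rateConst S.δ C k ξ T) := by
  obtain ⟨C₁, hC₁, h₁⟩ := ASLO.exists_betaAdaptive_le hn hS
  obtain ⟨C₂, hC₂, h₂⟩ := ASLO.exists_adaptive_excess_bound hn hS ht₀ D
  obtain ⟨C₃, hC₃, h₃⟩ := ASLO.exists_const_excess_bound hn hS ht₀ D Ξ
  have hL := inv_pos.2 hS.neg_log_pos
  have ha : 0 < (1 + (-Real.log S.δ)⁻¹) ^ 3 := by positivity
  -- One constant must serve all parts; the cube is the price of turning `1 + log (t/δ)` into `log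
  -- (t/δ)` in the third power, which is bounded below because `δ < 1`.
  set C := (C₁ + C₂ + C₃) * (1 + (-Real.log S.δ)⁻¹) ^ 3 with hC
  have hC0 : 0 < C := by positivity
  have hCle : ∀ c, c ≤ C₁ + C₂ + C₃ → c * (1 + (-Real.log S.δ)⁻¹) ^ 3 ≤ C := fun c hc =>
    mul_le_mul_of_nonneg_right hc ha.le
  refine ⟨C, 3, hC0, fun X τ hτ => ?_, fun Ω _ Pr _ X hX hrun => ⟨fun T hT => ?_, ?_⟩,
    fun ξ hξ hξΞ Ω _ Pr _ X hX hrun => ⟨fun T hT => ?_, ?_⟩,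
    fun ξ hξ => ASLO.rateAdaptive_isLittleO_rateConst hS hC0 3 hξ⟩
  · have hH := ASLO.one_le_logTerm hS hτ
    have hl := hS.log_pos hτ
    rw [Real.rpow_neg (Nat.cast_nonneg τ)]
    calc ASLO.betaAdaptive S X τ ≤ C₁ * ((τ : ℝ) ^ (1 / 4 : ℝ))⁻¹ * ASLO.logTerm S τ := h₁ X τ hτ
      _ ≤ C₁ * ((τ : ℝ) ^ (1 / 4 : ℝ))⁻¹ *
          ((1 + (-Real.log S.δ)⁻¹) ^ 3 * Real.log (τ / S.δ) ^ 3) :=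
          mul_le_mul_of_nonneg_left ((le_self_pow₀ hH (by norm_num)).trans
            (ASLO.logTerm_cube_le hS hτ)) (by positivity)
      _ = C₁ * (1 + (-Real.log S.δ)⁻¹) ^ 3 * ((τ : ℝ) ^ (1 / 4 : ℝ))⁻¹ *
          Real.log (τ / S.δ) ^ 3 := by ring
      _ ≤ _ := by gcongr; exact hCle C₁ (by linarith)
  · exact ASLO.measure_not_good_le hn hS hX (hrun.mono fun ω h => h.dyn) hT
  · filter_upwards [hrun] with ω hω hcond hinit T hT
    have hrate := ASLO.le_rateAdaptive hS hC₂.le (hCle C₂ (by linarith)) hT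
    obtain ⟨e₁, e₂⟩ := h₂ (X ω) hω hcond hinit T hT
    exact ⟨e₁.trans (add_le_add le_rfl hrate), fun hg => (e₂ hg).trans (add_le_add le_rfl hrate)⟩
  · exact ASLO.measure_not_good_le hn hS hX (hrun.mono fun ω h => h.dyn) hT
  · filter_upwards [hrun] with ω hω hcond hinit T hT
    have hrate := ASLO.le_rateConst hS hC₃.le hξ (hCle C₃ (by linarith)) hT
    obtain ⟨e₁, e₂⟩ := h₃ ξ hξ hξΞ (X ω) hω hcond hinit T hT
    exact ⟨e₁.trans (add_le_add le_rfl hrate), fun hg => (e₂ hg).trans (add_le_add le_rfl hrate)⟩
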